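/- **Conventions.** Algebras are associative complex algebras, not necessarily unital. A *locally convex algebra* is an algebra with a Hausdorff locally convex topology for which multiplication is jointly continuous. A *complex Fréchet–Michael algebra* is a complete locally convex algebra $A$ whose topology is defined by a countable family of seminorms $p$ with $p(xy)\le p(x)p(y)$ for all $x,y\in A$. Put $A^+=A\oplus\mathbb C$ (unit adjoined), $GL_m(A)=\ker(GL_m(A^+)\to GL_m(\mathbb C))$, $GL(A)=\varinjlim_m GL_m(A)$ along $g\mapsto \mathrm{diag}(g,1)$, and let $K_0(A)=\ker(K_0(A^+)\to K_0(\mathbb C))$ be the Grothendieck group. Let $I=[0,1]$. Let $\mathcal I(A)$ be the algebra of smooth maps $f:I\to A$ (all derivatives exist on $I$, one-sided at the endpoints) with $f(0)=0$, with pointwise operations and the topology of uniform convergence of all derivatives. Let $\mathcal J(A)$ be the algebra of continuous maps $f:I\to A$ with $f(0)=0$, with the topology of uniform convergence. For $P\in\{\mathcal I,\mathcal J\}$ let $\tau: P(A)\to A$ be $f\mapsto f(1)$, and let $P^+_*(A)$ be the augmented simplicial algebra $P_*(A)\to A$ of the path cotriple: $P_n(A)=P^{n+1}(A)$ for $n\ge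 0$, with faces $\delta_i=P^i\tau P^{n-i}$, degeneracies induced by $f\mapsto\big(s\mapsto (t\mapsto f(st))\big)$, and augmentation $\tau:P(A)\to A$. For the augmented simplicial group $GL(P^+_*(A))$ write $\pi_{-1}=\operatorname{coker}(GL(P(A))\to GL(A))$, $\pi_0=\ker(\pi_0GL(P_*(A))\to GL(A))$ and $\pi_j=\pi_jGL(P_*(A))$ for $j\ge1$. Define $$K^{sm}_n(A)=\pi_{n-2}\,GL(\mathcal I^+_*(A)),\qquad K^{top}_n(A)=\pi_{n-2}\,GL(\mathcal J^+_*(A))\qquad(n\ge1),$$ $$K^{sm}_0(A)=K^{top}_0(A)=K_0(A).$$ For $n\ge 1$ let $\beta_n(A):K^{sm}_n(A)\to K^{top}_n(A)$ be the homomorphism induced by the inclusions $\mathcal I\subset\mathcal J$, and let $\beta_0(A)$ be the identity of $K_0(A)$. **Theorem 1.14.** Let $A$ be a complex Fréchet–Michael algebra. Then $\beta_n(A): K^{sm}_n(A)\to K^{top}_n(A)$ is an isomorphism of groups for every $n\ge 0$. -/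

import Mathlib

open Topology Filter

universe u

namespace SmoothK

noncomputable section

/-! ### Locally convex algebras -/

/-- A complex locally convex algebra: an associative, not necessarily unital `ℂ`-algebra with a
Hausdorff locally convex topology for which the multiplication is jointly continuous.
(Completeness is not part of the structure; it is imposed separately where it is needed.) -/
structure LCAlg : Type (u + 1) where
  carrier : Type u
  [ring : NonUnitalRing carrier]
  [module : Module ℂ carrier]
  [isScalarTower : IsScalarTower ℂ carrier carrier]
  [smulCommClass : SMulCommClass ℂ carrier carrier]
  [top : TopologicalSpace carrier]
  [isTopologicalRing : IsTopologicalRing carrier]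
  [continuousSMul : ContinuousSMul ℂ carrier]
  [locallyConvex : LocallyConvexSpace ℝ carrier]
  [t2 : T2Space carrier]

namespace LCAlg

instance : CoeSort LCAlg.{u} (Type u) := ⟨LCAlg.carrier⟩

attribute [instance] ring module isScalarTower smulCommClass top isTopologicalRing
  continuousSMul locallyConvex t2

instance continuousSMul_real (A : LCAlg.{u}) : ContinuousSMul ℝ A :=
  ⟨(Complex.continuous_ofReal.comp continuous_fst).smul continuous_snd⟩

/-- Continuous `ℂ`-algebra homomorphisms (not assumed to preserve units). -/
structure Hom (A B : LCAlg.{u}) extends A →ₙₐ[ℂ] B where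
  cont : Continuous toFun

namespace Hom

instance (A B : LCAlg.{u}) : FunLike (Hom A B) A B where
  coe f := f.toFun
  coe_injective f g h := by
    cases f; cases g; congr 1; exact DFunLike.coe_injective h

instance (A B : LCAlg.{u}) : NonUnitalAlgHomClass (Hom A B) ℂ A B where
  map_smulₛₗ f := f.map_smul'
  map_add f := f.map_add'
  map_zero f := f.map_zero'
  map_mul f := f.map_mul'

theorem continuous {A B : LCAlg.{u}} (f : Hom A B) : Continuous f := f.cont

@[ext] theorem ext {A B : LCAlg.{u}} {f g : Hom A B} (h : ∀ a, f a = g a) : f = g :=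
  DFunLike.ext _ _ h

/-- The composite `g ∘ f`. -/
def comp {A B C : LCAlg.{u}} (g : Hom B C) (f : Hom A B) : Hom A C where
  toNonUnitalAlgHom := g.toNonUnitalAlgHom.comp f.toNonUnitalAlgHom
  cont := g.cont.comp f.cont

@[simp] theorem comp_apply {A B C : LCAlg.{u}} (g : Hom B C) (f : Hom A B) (a : A) :
    g.comp f a = g (f a) := rfl

@[simp] theorem toNonUnitalAlgHom_apply {A B : LCAlg.{u}} (f : Hom A B) (a : A) :
    f.toNonUnitalAlgHom a = f a := rfl

end Hom

/-- The kernel of a continuous homomorphism, with the subspace topology. -/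
def ker {A B : LCAlg.{u}} (f : Hom A B) : LCAlg.{u} :=
  let S : NonUnitalSubalgebra ℂ A :=
    { carrier := {a | f a = 0}
      add_mem' := fun {a b} ha hb => by
        change _ = _ at *; rw [map_add, ha, hb, add_zero]
      zero_mem' := map_zero f
      mul_mem' := fun {a b} ha hb => by
        change _ = _ at *; rw [map_mul, ha, hb, mul_zero]
      smul_mem' := fun c {a} ha => by
        change _ = _ at *; rw [map_smul, ha, smul_zero] }
  haveI : IsTopologicalRing S :=
    { continuous_add := by
        refine continuous_induced_rng.2 ?_
        exact (continuous_subtype_val.comp continuous_fst).add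
          (continuous_subtype_val.comp continuous_snd)
      continuous_mul := by
        refine continuous_induced_rng.2 ?_
        exact (continuous_subtype_val.comp continuous_fst).mul
          (continuous_subtype_val.comp continuous_snd)
      continuous_neg := by
        refine continuous_induced_rng.2 ?_
        exact continuous_subtype_val.neg }
  haveI : ContinuousSMul ℂ S :=
    { continuous_smul := by
        refine continuous_induced_rng.2 ?_
        exact continuous_fst.smul (continuous_subtype_val.comp continuous_snd) }
  haveI : LocallyConvexSpace ℝ S :=
    LocallyConvexSpace.induced (𝕜 := ℝ) (E := S) (F := A)
      { toFun := fun x => (x : A), map_add' := fun _ _ => rfl, map_smul' := fun _ _ => rfl }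
  { carrier := S }

/-- The inclusion of the kernel. -/
def kerIncl {A B : LCAlg.{u}} (f : Hom A B) : Hom (ker f) A where
  toFun := Subtype.val
  map_smul' _ _ := rfl
  map_zero' := rfl
  map_add' _ _ := rfl
  map_mul' _ _ := rfl
  cont := continuous_subtype_val

/-- An element killed by `f`, as an element of `ker f`. -/
def kerMk {A B : LCAlg.{u}} (f : Hom A B) (a : A) (h : f a = 0) : ker f := ⟨a, h⟩

theorem apply_kerIncl {A B : LCAlg.{u}} (f : Hom A B) (x : ker f) : f (kerIncl f x) = 0 := x.2

theorem kerIncl_injective {A B : LCAlg.{u}} (f : Hom A B) :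
    Function.Injective (kerIncl f) := Subtype.val_injective

/-- A homomorphism killed by `f` factors through `ker f`. -/
def kerLift {A B C : LCAlg.{u}} (f : Hom A B) (g : Hom C A) (h : ∀ c, f (g c) = 0) :
    Hom C (ker f) where
  toFun c := ⟨g c, h c⟩
  map_smul' _ _ := Subtype.ext (map_smul g _ _)
  map_zero' := Subtype.ext (map_zero g)
  map_add' _ _ := Subtype.ext (map_add g _ _)
  map_mul' _ _ := Subtype.ext (map_mul g _ _)
  cont := g.continuous.subtype_mk _

@[simp] theorem kerIncl_kerLift {A B C : LCAlg.{u}} (f : Hom A B) (g : Hom C A)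
    (h : ∀ c, f (g c) = 0) (c : C) : kerIncl f (kerLift f g h c) = g c := rfl

/-- A complex Fréchet–Michael algebra: a complete (Hausdorff) locally convex algebra whose
topology is given by a countable family of submultiplicative seminorms. -/
def IsFrechetMichael (A : LCAlg.{u}) : Prop :=
  @CompleteSpace A (IsTopologicalAddGroup.rightUniformSpace A) ∧
    ∃ p : SeminormFamily ℂ A ℕ, WithSeminorms p ∧ ∀ n x y, p n (x * y) ≤ p n x * p n y

/-! ### Continuous paths -/

/-- The algebra `A^I` of continuous maps `I = [0,1] → A`, with the topology of uniform
convergence (i.e. the compact-open topology). -/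
def contPath (A : LCAlg.{u}) : LCAlg.{u} :=
  haveI : LocallyConvexSpace ℝ C(unitInterval, A) := ContinuousMap.instLocallyConvexSpace
  { carrier := C(unitInterval, A) }

/-! ### Smooth paths -/

/-- `g` is the derivative of `f` on `[0,1]` (one-sided at the endpoints):
`(f s - f t) / (s - t) → g t` as `s → t`, `s ≠ t`. -/
def HasPathDeriv {A : LCAlg.{u}} (f g : C(unitInterval, A)) : Prop :=
  ∀ t : unitInterval,
    Tendsto (fun s : unitInterval => (((s : ℝ) - (t : ℝ) : ℝ) : ℂ)⁻¹ • (f s - f t))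
      (𝓝[≠] t) (𝓝 (g t))

instance neBot_punctured (t : unitInterval) : (𝓝[≠] t).NeBot := inferInstance

section deriv

variable {A : LCAlg.{u}}

theorem HasPathDeriv.unique {f g g' : C(unitInterval, A)} (h : HasPathDeriv f g)
    (h' : HasPathDeriv f g') : g = g' :=
  ContinuousMap.ext fun t => tendsto_nhds_unique (h t) (h' t)

theorem HasPathDeriv.zero : HasPathDeriv (0 : C(unitInterval, A)) 0 := fun t => by
  simp

theorem HasPathDeriv.const (a : A) : HasPathDeriv (ContinuousMap.const unitInterval a) 0 :=
  fun t => by simp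

theorem HasPathDeriv.add {f f' g g' : C(unitInterval, A)} (hf : HasPathDeriv f f')
    (hg : HasPathDeriv g g') : HasPathDeriv (f + g) (f' + g') := fun t => by
  refine ((hf t).add (hg t)).congr fun s => ?_
  rw [← smul_add, ContinuousMap.add_apply, ContinuousMap.add_apply, add_sub_add_comm]

theorem HasPathDeriv.smul {f f' : C(unitInterval, A)} (c : ℂ) (hf : HasPathDeriv f f') :
    HasPathDeriv (c • f) (c • f') := fun t => by
  refine ((hf t).const_smul c).congr fun s => ?_
  rw [ContinuousMap.smul_apply, ContinuousMap.smul_apply, ← smul_sub, smul_comm]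

theorem HasPathDeriv.nsmul {f f' : C(unitInterval, A)} (n : ℕ) (hf : HasPathDeriv f f') :
    HasPathDeriv (n • f) (n • f') := by
  simpa [Nat.cast_smul_eq_nsmul] using hf.smul (n : ℂ)

theorem HasPathDeriv.sum {ι : Type*} (s : Finset ι) {f f' : ι → C(unitInterval, A)}
    (h : ∀ i ∈ s, HasPathDeriv (f i) (f' i)) :
    HasPathDeriv (∑ i ∈ s, f i) (∑ i ∈ s, f' i) := by
  classical
  induction s using Finset.induction_on with
  | empty => simpa using HasPathDeriv.zero
  | insert a s ha ih =>
    rw [Finset.sum_insert ha, Finset.sum_insert ha]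
    exact (h a (Finset.mem_insert_self a s)).add
      (ih fun i hi => h i (Finset.mem_insert_of_mem hi))

theorem HasPathDeriv.mul {f f' g g' : C(unitInterval, A)} (hf : HasPathDeriv f f')
    (hg : HasPathDeriv g g') : HasPathDeriv (f * g) (f * g' + f' * g) := fun t => by
  have h1 : Tendsto (fun s => g s) (𝓝[≠] t) (𝓝 (g t)) :=
    (g.continuous.tendsto t).mono_left nhdsWithin_le_nhds
  refine (((hg t).const_mul (f t)).add ((hf t).mul h1)).congr fun s => ?_
  rw [mul_smul_comm, smul_mul_assoc, ← smul_add, ContinuousMap.mul_apply,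
    ContinuousMap.mul_apply, mul_sub, sub_mul]
  congr 1
  abel

theorem HasPathDeriv.map {B : LCAlg.{u}} (φ : Hom A B) {f f' : C(unitInterval, A)}
    (hf : HasPathDeriv f f') :
    HasPathDeriv ((⟨φ, φ.continuous⟩ : C(A, B)).comp f)
      ((⟨φ, φ.continuous⟩ : C(A, B)).comp f') := fun t => by
  refine ((φ.continuous.tendsto _).comp (hf t)).congr fun s => ?_
  simp [map_smul, map_sub]

end deriv

/-- The space of smooth maps `[0,1] → A`.  A smooth map `f` is recorded as the sequence
`(f, f', f'', …)` of its derivatives (all of which exist and are continuous); by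
`smoothMaps_ext` the sequence is determined by its zeroth term `f`. -/
def smoothMaps (A : LCAlg.{u}) : Submodule ℂ (ℕ → C(unitInterval, A)) where
  carrier := {F | ∀ n, HasPathDeriv (F n) (F (n + 1))}
  add_mem' hF hG n := (hF n).add (hG n)
  zero_mem' _ := HasPathDeriv.zero
  smul_mem' c _ hF n := (hF n).smul c

theorem smoothMaps_ext {A : LCAlg.{u}} {F G : smoothMaps A} (h : F.1 0 = G.1 0) : F = G := by
  refine Subtype.ext (funext fun n => ?_)
  induction n with
  | zero => exact h
  | succ n ih => exact (F.2 n).unique (ih ▸ G.2 n)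

/-- Pointwise product of smooth maps; its derivatives are given by the Leibniz rule. -/
instance (A : LCAlg.{u}) : Mul (smoothMaps A) where
  mul F G := ⟨fun n => ∑ p ∈ Finset.HasAntidiagonal.antidiagonal n, n.choose p.1 • (F.1 p.1 * G.1 p.2), fun n => by
    have key := HasPathDeriv.sum (Finset.HasAntidiagonal.antidiagonal n) fun p _ =>
      (((F.2 p.1).mul (G.2 p.2)).nsmul (n.choose p.1))
    convert! key using 1
    beta_reduce
    rw [Finset.sum_antidiagonal_choose_succ_nsmul (fun i j => F.1 i * G.1 j) n,
      ← Finset.sum_add_distrib]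
    refine Finset.sum_congr rfl fun p hp => ?_
    rw [smul_add, Nat.choose_symm_of_eq_add (Finset.HasAntidiagonal.mem_antidiagonal.1 hp).symm]⟩

theorem smoothMaps_mul_zero {A : LCAlg.{u}} (F G : smoothMaps A) :
    (F * G).1 0 = F.1 0 * G.1 0 := by
  change ∑ p ∈ Finset.HasAntidiagonal.antidiagonal 0, Nat.choose 0 p.1 • (F.1 p.1 * G.1 p.2) = _
  simp

instance (A : LCAlg.{u}) : NonUnitalRing (smoothMaps A) where
  left_distrib F G H := smoothMaps_ext <| by
    rw [smoothMaps_mul_zero]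
    change F.1 0 * (G.1 0 + H.1 0) = (F * G).1 0 + (F * H).1 0
    rw [smoothMaps_mul_zero, smoothMaps_mul_zero, mul_add]
  right_distrib F G H := smoothMaps_ext <| by
    rw [smoothMaps_mul_zero]
    change (F.1 0 + G.1 0) * H.1 0 = (F * H).1 0 + (G * H).1 0
    rw [smoothMaps_mul_zero, smoothMaps_mul_zero, add_mul]
  zero_mul F := smoothMaps_ext <| by
    rw [smoothMaps_mul_zero]; exact zero_mul _
  mul_zero F := smoothMaps_ext <| by
    rw [smoothMaps_mul_zero]; exact mul_zero _
  mul_assoc F G H := smoothMaps_ext <| by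
    simp only [smoothMaps_mul_zero, mul_assoc]

instance (A : LCAlg.{u}) : IsScalarTower ℂ (smoothMaps A) (smoothMaps A) where
  smul_assoc c F G := smoothMaps_ext <| by
    rw [smul_eq_mul, smoothMaps_mul_zero]
    change (c • F.1 0) * G.1 0 = c • (F * G).1 0
    rw [smoothMaps_mul_zero, smul_mul_assoc]

instance (A : LCAlg.{u}) : SMulCommClass ℂ (smoothMaps A) (smoothMaps A) where
  smul_comm c F G := smoothMaps_ext <| by
    change c • (F * G).1 0 = (F * (c • G)).1 0
    rw [smoothMaps_mul_zero, smoothMaps_mul_zero]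
    exact (mul_smul_comm c (F.1 0) (G.1 0)).symm

instance (A : LCAlg.{u}) : IsTopologicalRing (smoothMaps A) where
  continuous_mul := by
    refine continuous_induced_rng.2 (continuous_pi fun n => ?_)
    change Continuous fun x : smoothMaps A × smoothMaps A =>
      ∑ p ∈ Finset.HasAntidiagonal.antidiagonal n, n.choose p.1 • (x.1.1 p.1 * x.2.1 p.2)
    refine continuous_finsetSum _ fun p _ => ?_
    have h : Continuous fun x : smoothMaps A × smoothMaps A => x.1.1 p.1 * x.2.1 p.2 := ((continuous_apply p.1).comp (continuous_subtype_val.comp continuous_fst)).mul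
      ((continuous_apply p.2).comp (continuous_subtype_val.comp continuous_snd))
    exact h.const_smul (n.choose p.1)

/-- The constant map with value `a`, as a smooth map. -/
def constSmooth {A : LCAlg.{u}} (a : A) : smoothMaps A :=
  ⟨fun n => if n = 0 then ContinuousMap.const unitInterval a else 0, fun n => by
    cases n with
    | zero => exact HasPathDeriv.const a
    | succ n => exact HasPathDeriv.zero⟩

/-- The algebra `A^{∞(I)}` of smooth maps `I → A`, with pointwise operations and the topology of
uniform convergence of all derivatives (the subspace topology from the product of copies of
`C(I, A)`). -/
def smoothPath (A : LCAlg.{u}) : LCAlg.{u} :=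
  haveI : LocallyConvexSpace ℝ C(unitInterval, A) := ContinuousMap.instLocallyConvexSpace
  haveI : LocallyConvexSpace ℝ (ℕ → C(unitInterval, A)) := Pi.locallyConvexSpace
  haveI : LocallyConvexSpace ℝ (smoothMaps A) :=
    LocallyConvexSpace.induced (𝕜 := ℝ) (E := smoothMaps A) (F := ℕ → C(unitInterval, A))
      { toFun := fun x => x.1, map_add' := fun _ _ => rfl, map_smul' := fun _ _ => rfl }
  { carrier := smoothMaps A }

/-! ### Path functors and their cones -/

/-- A functorial algebra of free paths `A ↦ A^I`, with evaluations `ε₀, ε₁` at the endpoints and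
the inclusion of constant paths.  Only the two instances `smooth` and `cont` below are used; the
structure serves to carry out the construction of the `K`-groups once for both of them. -/
structure PathFunctor where
  obj : LCAlg.{u} → LCAlg.{u}
  map : ∀ {A B : LCAlg.{u}}, Hom A B → Hom (obj A) (obj B)
  map_comp : ∀ {A B C : LCAlg.{u}} (g : Hom B C) (f : Hom A B) (x : obj A),
    map (g.comp f) x = map g (map f x)
  ev0 : ∀ A : LCAlg.{u}, Hom (obj A) A
  ev1 : ∀ A : LCAlg.{u}, Hom (obj A) A
  const : ∀ A : LCAlg.{u}, Hom A (obj A)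
  ev0_map : ∀ {A B : LCAlg.{u}} (f : Hom A B) (x : obj A), ev0 B (map f x) = f (ev0 A x)
  ev1_map : ∀ {A B : LCAlg.{u}} (f : Hom A B) (x : obj A), ev1 B (map f x) = f (ev1 A x)
  map_const : ∀ {A B : LCAlg.{u}} (f : Hom A B) (a : A), map f (const A a) = const B (f a)
  ev0_const : ∀ {A : LCAlg.{u}} (a : A), ev0 A (const A a) = a
  ev1_const : ∀ {A : LCAlg.{u}} (a : A), ev1 A (const A a) = a

/-- A homomorphism `φ` as a continuous map. -/
def Hom.toCMap {A B : LCAlg.{u}} (φ : Hom A B) : C(A, B) := ⟨φ, φ.continuous⟩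

/-- Continuous paths: `A ↦ A^I`. -/
def PathFunctor.cont : PathFunctor.{u} where
  obj := contPath
  map {A B} φ :=
    { toFun := fun f : C(unitInterval, A) => (φ.toCMap.comp f : C(unitInterval, B))
      map_smul' := fun c (f : C(unitInterval, A)) => ContinuousMap.ext fun t => map_smul φ c (f t)
      map_zero' := ContinuousMap.ext fun _ => map_zero φ
      map_add' := fun (f g : C(unitInterval, A)) => ContinuousMap.ext fun t => map_add φ (f t) (g t)
      map_mul' := fun (f g : C(unitInterval, A)) => ContinuousMap.ext fun t => map_mul φ (f t) (g t)
      cont := ContinuousMap.continuous_postcomp φ.toCMap }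
  map_comp _ _ _ := rfl
  ev0 A :=
    { toFun := fun f : C(unitInterval, A) => f 0
      map_smul' := fun _ _ => rfl
      map_zero' := rfl
      map_add' := fun _ _ => rfl
      map_mul' := fun _ _ => rfl
      cont := continuous_eval_const (F := C(unitInterval, A)) (0 : unitInterval) }
  ev1 A :=
    { toFun := fun f : C(unitInterval, A) => f 1
      map_smul' := fun _ _ => rfl
      map_zero' := rfl
      map_add' := fun _ _ => rfl
      map_mul' := fun _ _ => rfl
      cont := continuous_eval_const (F := C(unitInterval, A)) (1 : unitInterval) }
  const A :=
    { toFun := fun a => (ContinuousMap.const unitInterval a : C(unitInterval, A))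
      map_smul' := fun _ _ => rfl
      map_zero' := rfl
      map_add' := fun _ _ => rfl
      map_mul' := fun _ _ => rfl
      cont := ContinuousMap.continuous_const' }
  ev0_map _ _ := rfl
  ev1_map _ _ := rfl
  map_const _ _ := rfl
  ev0_const _ := rfl
  ev1_const _ := rfl

/-- The underlying continuous map of a smooth path, as a homomorphism `A^{∞(I)} → A^I`. -/
def smoothToCont (A : LCAlg.{u}) : Hom (smoothPath A) (contPath A) where
  toFun := fun F : smoothMaps A => (F.1 0 : C(unitInterval, A))
  map_smul' _ _ := rfl
  map_zero' := rfl
  map_add' _ _ := rfl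
  map_mul' F G := smoothMaps_mul_zero (A := A) F G
  cont := (continuous_apply 0).comp continuous_subtype_val

/-- Smooth paths: `A ↦ A^{∞(I)}`. -/
def PathFunctor.smooth : PathFunctor.{u} where
  obj := smoothPath
  map {A B} φ :=
    { toFun := fun F : smoothMaps A =>
        (⟨fun n => φ.toCMap.comp (F.1 n), fun n => (F.2 n).map φ⟩ : smoothMaps B)
      map_smul' := fun c (F : smoothMaps A) => smoothMaps_ext (A := B) <|
        ContinuousMap.ext fun t => map_smul φ c (F.1 0 t)
      map_zero' := smoothMaps_ext (A := B) <| ContinuousMap.ext fun _ => map_zero φ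
      map_add' := fun (F G : smoothMaps A) => smoothMaps_ext (A := B) <|
        ContinuousMap.ext fun t => map_add φ (F.1 0 t) (G.1 0 t)
      map_mul' := fun (F G : smoothMaps A) => smoothMaps_ext (A := B) <| by
        refine Eq.trans ?_ (smoothMaps_mul_zero _ _).symm
        change φ.toCMap.comp ((F * G).1 0) = _
        rw [smoothMaps_mul_zero]
        exact ContinuousMap.ext fun t => map_mul φ (F.1 0 t) (G.1 0 t)
      cont := by
        refine continuous_induced_rng.2 (continuous_pi fun n => ?_)
        exact (ContinuousMap.continuous_postcomp φ.toCMap).comp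
          ((continuous_apply n).comp continuous_subtype_val) }
  map_comp _ _ _ := rfl
  ev0 A := (PathFunctor.cont.ev0 A).comp (smoothToCont A)
  ev1 A := (PathFunctor.cont.ev1 A).comp (smoothToCont A)
  const A :=
    { toFun := fun a : A => (constSmooth a : smoothMaps A)
      map_smul' := fun _ _ => smoothMaps_ext (A := A) rfl
      map_zero' := smoothMaps_ext (A := A) rfl
      map_add' := fun _ _ => smoothMaps_ext (A := A) rfl
      map_mul' := fun a b =>
        smoothMaps_ext (A := A) (smoothMaps_mul_zero (constSmooth a) (constSmooth b)).symm
      cont := by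
        refine continuous_induced_rng.2 (continuous_pi fun n => ?_)
        cases n with
        | zero => exact ContinuousMap.continuous_const'
        | succ n => exact continuous_const }
  ev0_map _ _ := rfl
  ev1_map _ _ := rfl
  map_const {_ B} _ _ := smoothMaps_ext (A := B) rfl
  ev0_const _ := rfl
  ev1_const _ := rfl

namespace PathFunctor

variable (P : PathFunctor.{u})

/-- The algebra of paths starting at `0`, i.e. the kernel of `ε₀`.  For smooth paths this is the
functor `𝓘`, for continuous paths it is the functor `𝓙`. -/
def cone (A : LCAlg.{u}) : LCAlg.{u} := ker (P.ev0 A)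

/-- Functoriality of the path algebra `P.cone`. -/
def coneMap {A B : LCAlg.{u}} (f : Hom A B) : Hom (P.cone A) (P.cone B) :=
  kerLift (P.ev0 B) ((P.map f).comp (kerIncl (P.ev0 A))) fun c => by
    exact (P.ev0_map f _).trans ((congrArg f (apply_kerIncl _ c)).trans (map_zero f))

/-- The endpoint map `τ_A : P.cone A → A`, the restriction of `ε₁`. -/
def tau (A : LCAlg.{u}) : Hom (P.cone A) A := (P.ev1 A).comp (kerIncl (P.ev0 A))

/-- The inclusion of the based paths into all paths. -/
abbrev incl (A : LCAlg.{u}) : Hom (P.cone A) (P.obj A) := kerIncl (P.ev0 A)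

theorem incl_coneMap {A B : LCAlg.{u}} (f : Hom A B) (x : P.cone A) :
    P.incl B (P.coneMap f x) = P.map f (P.incl A x) := rfl

theorem coneMap_comp {A B C : LCAlg.{u}} (g : Hom B C) (f : Hom A B) (x : P.cone A) :
    P.coneMap (g.comp f) x = P.coneMap g (P.coneMap f x) :=
  kerIncl_injective _ (P.map_comp g f _)

theorem tau_coneMap {A B : LCAlg.{u}} (f : Hom A B) (x : P.cone A) :
    P.tau B (P.coneMap f x) = f (P.tau A x) := P.ev1_map f _

/-- The iterated path algebras: `iter 0 = A` and `iter (n + 1) = P.cone (iter n)`, so that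
`iter (n + 1)` is the algebra in simplicial degree `n` of the augmented simplicial algebra of the
path cotriple, and `iter 0 = A` is its augmentation. -/
def iter (A : LCAlg.{u}) : ℕ → LCAlg.{u}
  | 0 => A
  | n + 1 => P.cone (iter A n)

/-- The face maps `δ_i = P^i τ P^{n-i} : iter (n + 1) → iter n`, `0 ≤ i ≤ n`
(for `n = 0` this is the augmentation). -/
def face (A : LCAlg.{u}) : ∀ n : ℕ, Fin (n + 1) → Hom (P.iter A (n + 1)) (P.iter A n)
  | 0, _ => P.tau A
  | n + 1, i =>
    Fin.cases (P.tau (P.iter A (n + 1))) (fun j => P.coneMap (face A n j)) i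

theorem face_zero (A : LCAlg.{u}) (n : ℕ) : P.face A n 0 = P.tau (P.iter A n) := by
  cases n <;> rfl

theorem face_succ (A : LCAlg.{u}) (n : ℕ) (j : Fin (n + 1)) :
    P.face A (n + 1) j.succ = P.coneMap (P.face A n j) := rfl

end PathFunctor

/-! ### The general linear group -/

/-- Functoriality of the unitization `A⁺ = ℂ ⊕ A`. -/
def unitMap {A B : LCAlg.{u}} (f : Hom A B) : Unitization ℂ A →ₐ[ℂ] Unitization ℂ B :=
  Unitization.lift ((Unitization.inrNonUnitalAlgHom ℂ B).comp f.toNonUnitalAlgHom)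

@[simp] theorem unitMap_fst {A B : LCAlg.{u}} (f : Hom A B) (x : Unitization ℂ A) :
    (unitMap f x).fst = x.fst := by simp [unitMap, Unitization.algebraMap_eq_inl]

@[simp] theorem unitMap_snd {A B : LCAlg.{u}} (f : Hom A B) (x : Unitization ℂ A) :
    (unitMap f x).snd = f x.snd := by simp [unitMap, Unitization.algebraMap_eq_inl]

end LCAlg

/-- The homomorphism induced by a ring homomorphism on invertible `m × m` matrices. -/
def unitsMat {R S : Type*} [Ring R] [Ring S] (m : ℕ) (f : R →+* S) :
    (Matrix (Fin m) (Fin m) R)ˣ →* (Matrix (Fin m) (Fin m) S)ˣ :=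
  Units.map (f.mapMatrix (m := Fin m)).toMonoidHom

/-- The block matrix `diag(g, 1)` of size `j`, for `g` of size `i ≤ j`. -/
def stabFun {R : Type*} [Ring R] {i : ℕ} (j : ℕ) (g : Matrix (Fin i) (Fin i) R) :
    Matrix (Fin j) (Fin j) R :=
  Matrix.of fun a b => if h : a.1 < i ∧ b.1 < i then g ⟨a, h.1⟩ ⟨b, h.2⟩ else if a = b then 1 else 0

theorem stabFun_one {R : Type*} [Ring R] {i j : ℕ} :
    stabFun j (1 : Matrix (Fin i) (Fin i) R) = 1 := by
  ext a b
  simp only [stabFun, Matrix.of_apply, Matrix.one_apply, Fin.ext_iff]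
  split_ifs <;> rfl

theorem stabFun_mul {R : Type*} [Ring R] {i j : ℕ} (h : i ≤ j) (g g' : Matrix (Fin i) (Fin i) R) :
    stabFun j (g * g') = stabFun j g * stabFun j g' := by
  ext a b
  rw [Matrix.mul_apply]
  by_cases ha : a.1 < i
  · have : ∑ c, stabFun j g a c * stabFun j g' c b =
        ∑ c : Fin i, g ⟨a, ha⟩ c * stabFun j g' (Fin.castLE h c) b := by
      symm
      refine Finset.sum_of_injOn (Fin.castLE h) (Fin.castLE_injective h).injOn (by simp) ?_ ?_
      · intro c _ hc
        have hc' : ¬ c.1 < i := fun h' => hc ⟨⟨c, h'⟩, by simp, rfl⟩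
        have hac : a ≠ c := fun h' => hc' (h' ▸ ha)
        simp [stabFun, hc', hac]
      · intro c _
        simp [stabFun, ha]
    rw [this]
    by_cases hb : b.1 < i
    · simp [stabFun, ha, hb, Matrix.mul_apply]
    · have hab : a ≠ b := fun h' => hb (h' ▸ ha)
      simp only [stabFun, Matrix.of_apply, ha, hb, hab]
      simp only [and_false, dite_false, if_false]
      refine (Finset.sum_eq_zero fun c _ => ?_).symm
      have hcb : Fin.castLE h c ≠ b := fun h' => hb (h' ▸ c.2)
      simp [hcb]
  · have : ∑ c, stabFun j g a c * stabFun j g' c b = stabFun j g' a b := by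
      rw [Finset.sum_eq_single a]
      · simp [stabFun, ha]
      · intro c _ hc
        simp [stabFun, ha, hc.symm]
      · simp
    rw [this]
    simp [stabFun, ha]

/-- `g ↦ diag(g, 1)` on invertible matrices. -/
def stab {R : Type*} [Ring R] {i j : ℕ} (h : i ≤ j) :
    (Matrix (Fin i) (Fin i) R)ˣ →* (Matrix (Fin j) (Fin j) R)ˣ :=
  Units.map
    { toFun := stabFun j, map_one' := stabFun_one, map_mul' := stabFun_mul h }

theorem stab_val {R : Type*} [Ring R] {i j : ℕ} (h : i ≤ j) (g : (Matrix (Fin i) (Fin i) R)ˣ) :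
    (stab h g).1 = stabFun j g.1 := rfl

theorem stab_injective {R : Type*} [Ring R] {i j : ℕ} (h : i ≤ j) :
    Function.Injective (stab (R := R) h) := by
  intro g g' hg
  ext a b
  have hv : stabFun j g.1 = stabFun j g'.1 := congrArg Units.val hg
  have := congrFun (congrFun hv (Fin.castLE h a)) (Fin.castLE h b)
  simpa [stabFun] using this

theorem unitsMat_stab {R S : Type*} [Ring R] [Ring S] (f : R →+* S) {i j : ℕ} (h : i ≤ j)
    (g : (Matrix (Fin i) (Fin i) R)ˣ) : unitsMat j f (stab h g) = stab h (unitsMat i f g) := by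
  refine Units.ext ?_
  change f.mapMatrix (stabFun j g.1) = stabFun j (f.mapMatrix g.1)
  refine Matrix.ext fun a b => ?_
  change f (stabFun j g.1 a b) = stabFun j (g.1.map f) a b
  simp only [stabFun, Matrix.of_apply, Matrix.map_apply]
  split_ifs <;> simp

namespace LCAlg

/-- `GL_m(A) = ker (GL_m(A⁺) → GL_m(ℂ))`. -/
def GLm (m : ℕ) (A : LCAlg.{u}) : Subgroup (Matrix (Fin m) (Fin m) (Unitization ℂ A))ˣ :=
  (unitsMat m (Unitization.fstHom ℂ A).toRingHom).ker

/-- The stabilization `GL_i(A) → GL_j(A)`, `g ↦ diag(g, 1)`, for `i ≤ j`. -/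
def stabGL (A : LCAlg.{u}) (i j : ℕ) (h : i ≤ j) : GLm i A →* GLm j A :=
  ((stab h).comp (GLm i A).subtype).codRestrict (GLm j A) fun g => by
    have hg : unitsMat i (Unitization.fstHom ℂ A).toRingHom g.1 = 1 := g.2
    change unitsMat j _ (stab h g.1) = 1
    rw [unitsMat_stab, hg, map_one]

theorem stabGL_injective (A : LCAlg.{u}) (i j : ℕ) (h : i ≤ j) :
    Function.Injective (stabGL A i j h) := fun _ _ hx =>
  Subtype.ext (stab_injective h (congrArg Subtype.val hx))

instance (A : LCAlg.{u}) : DirectedSystem (fun m => GLm m A) (fun i j h => stabGL A i j h) where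
  map_self i x := by
    refine Subtype.ext (Units.ext (Matrix.ext fun a b => ?_))
    change stabFun i x.1.1 a b = _
    simp [stabFun]
  map_map k j i hij hjk x := by
    refine Subtype.ext (Units.ext (Matrix.ext fun a b => ?_))
    change stabFun k (stabFun j x.1.1) a b = stabFun k x.1.1 a b
    simp only [stabFun, Matrix.of_apply, Fin.mk.injEq]
    by_cases h : a.1 < i ∧ b.1 < i
    · simp [h, h.1.trans_le hij, h.2.trans_le hij]
    · simp only [h, dite_false, Fin.ext_iff]
      split_ifs <;> rfl

/-- The stable general linear group `GL(A) = colim_m GL_m(A)`. -/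
def StGL (A : LCAlg.{u}) : Type u := DirectLimit (fun m => GLm m A) (fun i j h => stabGL A i j h)

instance (A : LCAlg.{u}) : Group (StGL A) :=
  inferInstanceAs (Group (DirectLimit (fun m => GLm m A) (fun i j h => stabGL A i j h)))

/-- The class in `GL(A)` of an element of `GL_m(A)`. -/
def StGL.mk {A : LCAlg.{u}} (m : ℕ) (g : GLm m A) : StGL A := ⟦⟨m, g⟩⟧

theorem StGL.mk_surj {A : LCAlg.{u}} (z : StGL A) : ∃ m g, z = StGL.mk m g :=
  DirectLimit.exists_eq_mk _ z

theorem StGL.mk_one {A : LCAlg.{u}} (m : ℕ) : StGL.mk m (1 : GLm m A) = 1 :=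
  (DirectLimit.one_def m).symm

theorem StGL.mk_mul {A : LCAlg.{u}} (m : ℕ) (g g' : GLm m A) :
    StGL.mk m (g * g') = StGL.mk m g * StGL.mk m g' :=
  (DirectLimit.mul_def (G := fun m => GLm m A) (f := fun i j h => stabGL A i j h) m g g').symm

theorem StGL.mk_injective {A : LCAlg.{u}} (m : ℕ) : Function.Injective (StGL.mk (A := A) m) :=
  DirectLimit.mk_injective _ (stabGL_injective A) m

/-- The homomorphism `GL_m(f)`. -/
def GLm.map {A B : LCAlg.{u}} (m : ℕ) (f : Hom A B) : GLm m A →* GLm m B :=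
  ((unitsMat m (unitMap f).toRingHom).comp (GLm m A).subtype).codRestrict (GLm m B) fun g => by
    have hg : unitsMat m (Unitization.fstHom ℂ A).toRingHom g.1 = 1 := g.2
    change unitsMat m (Unitization.fstHom ℂ B).toRingHom
      (unitsMat m (unitMap f).toRingHom g.1) = 1
    rw [← hg]
    refine Units.ext (Matrix.ext fun a b => ?_)
    exact unitMap_fst f _

theorem GLm.map_apply {A B : LCAlg.{u}} (m : ℕ) (f : Hom A B) (g : GLm m A) (a b : Fin m) :
    (GLm.map m f g).1.1 a b = unitMap f (g.1.1 a b) := rfl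

/-- The homomorphism `GL(f)`. -/
def StGL.map {A B : LCAlg.{u}} (f : Hom A B) : StGL A →* StGL B where
  toFun := DirectLimit.map _ _ (fun m => GLm.map m f) fun _ _ h x =>
    Subtype.ext (unitsMat_stab (unitMap f).toRingHom h x.1).symm
  map_one' := by
    rw [← StGL.mk_one 0, ← StGL.mk_one 0, ← map_one (GLm.map 0 f)]
    rfl
  map_mul' := by
    refine DirectLimit.induction₂ _ fun m x y => ?_
    change DirectLimit.map _ _ _ _ (StGL.mk m x * StGL.mk m y) =
      StGL.mk m (GLm.map m f x) * StGL.mk m (GLm.map m f y)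
    rw [← StGL.mk_mul, ← StGL.mk_mul, ← map_mul]
    rfl

theorem StGL.map_mk {A B : LCAlg.{u}} (f : Hom A B) (m : ℕ) (g : GLm m A) :
    StGL.map f (StGL.mk m g) = StGL.mk m (GLm.map m f g) := rfl

theorem StGL.map_map {A B C : LCAlg.{u}} (g : Hom B C) (f : Hom A B) (z : StGL A) :
    StGL.map g (StGL.map f z) = StGL.map (g.comp f) z := by
  obtain ⟨m, x, rfl⟩ := StGL.mk_surj z
  simp only [StGL.map_mk]
  congr 1
  refine Subtype.ext (Units.ext ?_)
  ext a b : 1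
  simp only [GLm.map_apply]
  ext <;> simp

theorem StGL.map_congr {A B : LCAlg.{u}} {f g : Hom A B} (h : ∀ x, f x = g x) (z : StGL A) :
    StGL.map f z = StGL.map g z := by rw [Hom.ext h]

theorem StGL.map_kerIncl_injective {A B : LCAlg.{u}} (f : Hom A B) :
    Function.Injective (StGL.map (kerIncl f)) := by
  rw [injective_iff_map_eq_one]
  intro z hz
  obtain ⟨m, x, rfl⟩ := StGL.mk_surj z
  rw [StGL.map_mk, ← StGL.mk_one m] at hz
  have h := StGL.mk_injective m hz
  rw [← StGL.mk_one m]
  congr 1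
  refine Subtype.ext (Units.ext ?_)
  ext a b : 1
  have h' : unitMap (kerIncl f) (x.1.1 a b) = (1 : Matrix (Fin m) (Fin m) (Unitization ℂ A)) a b :=
    congrFun (congrFun (congrArg (fun g : GLm m A => g.1.1) h) a) b
  have e : (1 : Matrix (Fin m) (Fin m) (Unitization ℂ A)) a b = unitMap (kerIncl f)
      ((1 : Matrix (Fin m) (Fin m) (Unitization ℂ (ker f))) a b) := by
    simp only [Matrix.one_apply]; split_ifs <;> simp
  rw [e] at h'
  ext
  · simpa using congrArg (fun z => z.fst) h'
  · exact kerIncl_injective f (by simpa using congrArg (fun z => z.snd) h')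

/-- Left exactness of `GL`: the elements killed by `GL(f)` come from `GL(ker f)`. -/
theorem StGL.exists_of_map_eq_one {A B : LCAlg.{u}} (f : Hom A B) (z : StGL A)
    (hz : StGL.map f z = 1) : ∃ w : StGL (ker f), StGL.map (kerIncl f) w = z := by
  obtain ⟨m, x, rfl⟩ := StGL.mk_surj z
  rw [StGL.map_mk, ← StGL.mk_one m] at hz
  have key : ∀ y : GLm m A, GLm.map m f y = 1 → ∀ a b, f (y.1.1 a b).snd = 0 := by
    intro y hy a b
    have h1 : unitMap f (y.1.1 a b) = (1 : Matrix (Fin m) (Fin m) (Unitization ℂ B)) a b :=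
      congrFun (congrFun (congrArg (fun g : GLm m B => g.1.1) hy) a) b
    have h2 := congrArg (fun z => z.snd) h1
    rw [unitMap_snd] at h2
    rw [h2, Matrix.one_apply]
    split_ifs <;> simp
  have hx := StGL.mk_injective m hz
  have hx' : GLm.map m f x⁻¹ = 1 := by rw [map_inv, hx, inv_one]
  let lift : ∀ y : GLm m A, (∀ a b, f (y.1.1 a b).snd = 0) →
      Matrix (Fin m) (Fin m) (Unitization ℂ (ker f)) := fun y hy =>
    Matrix.of fun a b => (Unitization.inl (y.1.1 a b).fst : Unitization ℂ (ker f)) +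
      (Unitization.inr (kerMk f (y.1.1 a b).snd (hy a b) : ker f) : Unitization ℂ (ker f))
  have inj : Function.Injective (unitMap (kerIncl f)).toRingHom := by
    intro p q hpq
    ext
    · simpa using congrArg (fun z => z.fst) hpq
    · exact kerIncl_injective f (by simpa using congrArg (fun z => z.snd) hpq)
  have hl : ∀ y hy, (unitMap (kerIncl f)).toRingHom.mapMatrix (lift y hy) = y.1.1 := by
    intro y hy
    ext a b : 1
    change unitMap (kerIncl f) (lift y hy a b) = _
    ext
    · rw [unitMap_fst]; simp [lift]
    · rw [unitMap_snd]
      have : (lift y hy a b).snd = kerMk f (y.1.1 a b).snd (hy a b) := by simp [lift]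
      rw [this]; rfl
  have injM : Function.Injective ((unitMap (kerIncl f)).toRingHom.mapMatrix (m := Fin m)) := by
    intro p q hpq
    ext a b : 1
    exact inj (congrFun (congrFun hpq a) b)
  let u : (Matrix (Fin m) (Fin m) (Unitization ℂ (ker f)))ˣ :=
    { val := lift x (key x hx)
      inv := lift x⁻¹ (key _ hx')
      val_inv := injM (by rw [map_mul, hl, hl, map_one]; exact x.1.mul_inv)
      inv_val := injM (by rw [map_mul, hl, hl, map_one]; exact x.1.inv_mul) }
  have hu : u ∈ GLm m (ker f) := by
    have hg : unitsMat m (Unitization.fstHom ℂ A).toRingHom x.1 = 1 := x.2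
    change unitsMat m (Unitization.fstHom ℂ (ker f)).toRingHom u = 1
    refine Units.ext (Matrix.ext fun a b => ?_)
    have hv : (Unitization.fstHom ℂ A).toRingHom.mapMatrix x.1.1 = 1 := congrArg Units.val hg
    have := congrFun (congrFun hv a) b
    refine Eq.trans ?_ this
    change (lift x (key x hx) a b).fst = (x.1.1 a b).fst
    simp [lift]
  refine ⟨StGL.mk m ⟨u, hu⟩, ?_⟩
  rw [StGL.map_mk]
  congr 1
  exact Subtype.ext (Units.ext (hl x _))

theorem StGL.map_eq_one {A B : LCAlg.{u}} {f : Hom A B} (h : ∀ x, f x = 0) (z : StGL A) :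
    StGL.map f z = 1 := by
  obtain ⟨m, x, rfl⟩ := StGL.mk_surj z
  rw [StGL.map_mk, ← StGL.mk_one m]
  congr 1
  have hg : unitsMat m (Unitization.fstHom ℂ A).toRingHom x.1 = 1 := x.2
  have hv : (Unitization.fstHom ℂ A).toRingHom.mapMatrix x.1.1 = 1 := congrArg Units.val hg
  refine Subtype.ext (Units.ext (Matrix.ext fun a b => ?_))
  have h1 : (x.1.1 a b).fst = (1 : Matrix (Fin m) (Fin m) ℂ) a b := congrFun (congrFun hv a) b
  change unitMap f (x.1.1 a b) = (1 : Matrix (Fin m) (Fin m) (Unitization ℂ B)) a b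
  ext
  · rw [unitMap_fst, h1, Matrix.one_apply, Matrix.one_apply]
    split_ifs <;> simp
  · rw [unitMap_snd, h, Matrix.one_apply]
    split_ifs <;> simp

/-! ### Homotopy groups of the augmented simplicial group `GL(P_*^+(A))` -/

namespace PathFunctor

variable (P : PathFunctor.{u})

theorem face_face_zero (A : LCAlg.{u}) (n : ℕ) (i : Fin (n + 1)) (x : P.iter A (n + 2)) :
    P.face A n i (P.face A (n + 1) 0 x) = P.face A n 0 (P.face A (n + 1) i.succ x) := by
  rw [face_zero, face_zero, face_succ]
  exact (P.tau_coneMap (P.face A n i) x).symm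

/-- The Moore complex of the augmented simplicial group `GL(P_*^+(A))`: in simplicial degree `m`
(that is, for `n = m + 1`) it is the intersection of the kernels of all faces but `δ_0`, and in
degree `-1` (that is, for `n = 0`) it is all of `GL(A)`.  Its differential is `δ_0`.
(The homotopy groups of a simplicial group, being the homology of its Moore complex, only involve
the face maps, so the degeneracies need not be recorded.) -/
def moore (A : LCAlg.{u}) : ∀ n : ℕ, Subgroup (StGL (P.iter A n))
  | 0 => ⊤
  | n + 1 => ⨅ i : Fin n, (StGL.map (P.face A n i.succ)).ker

/-- The cycles of the Moore complex: the elements killed by all faces. -/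
def cycles (A : LCAlg.{u}) : ∀ n : ℕ, Subgroup (StGL (P.iter A n))
  | 0 => ⊤
  | n + 1 => ⨅ i : Fin (n + 1), (StGL.map (P.face A n i)).ker

/-- The boundaries of the Moore complex. -/
def boundaries (A : LCAlg.{u}) (n : ℕ) : Subgroup (StGL (P.iter A n)) :=
  (P.moore A (n + 1)).map (StGL.map (P.face A n 0))

theorem boundaries_le_cycles (A : LCAlg.{u}) (n : ℕ) : P.boundaries A n ≤ P.cycles A n := by
  cases n with
  | zero => exact le_top
  | succ n =>
    rintro _ ⟨x, hx, rfl⟩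
    refine Subgroup.mem_iInf.2 fun i => ?_
    have hx' : StGL.map (P.face A (n + 1) i.succ) x = 1 := Subgroup.mem_iInf.1 hx i
    change StGL.map _ (StGL.map _ x) = 1
    rw [StGL.map_map, StGL.map_congr (g := (P.face A n 0).comp (P.face A (n + 1) i.succ))
      (fun y => P.face_face_zero A n i y), ← StGL.map_map, hx', map_one]

instance boundaries_normal (A : LCAlg.{u}) (n : ℕ) : (P.boundaries A n).Normal where
  conj_mem := by
    rintro _ ⟨x', hx, rfl⟩ g
    obtain ⟨x, rfl⟩ : ∃ x : StGL (P.cone (P.iter A n)), x = x' := ⟨x', rfl⟩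
    have hev : ∀ (w : StGL (P.cone (P.iter A n))), StGL.map (P.face A n 0) w =
        StGL.map (P.ev1 _) (StGL.map (P.incl _) w) := fun w => by
      rw [face_zero, StGL.map_map]; rfl
    have hc0 : StGL.map (P.ev0 _) (StGL.map (P.const (P.iter A n)) g) = g := by
      rw [StGL.map_map]
      obtain ⟨m, y, rfl⟩ := StGL.mk_surj g
      rw [StGL.map_mk]
      congr 1
      refine Subtype.ext (Units.ext (Matrix.ext fun a b => ?_))
      change unitMap _ (y.1.1 a b) = _
      ext
      · rw [unitMap_fst]
      · rw [unitMap_snd]; exact P.ev0_const _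
    have hc1 : StGL.map (P.ev1 _) (StGL.map (P.const (P.iter A n)) g) = g := by
      rw [StGL.map_map]
      obtain ⟨m, y, rfl⟩ := StGL.mk_surj g
      rw [StGL.map_mk]
      congr 1
      refine Subtype.ext (Units.ext (Matrix.ext fun a b => ?_))
      change unitMap _ (y.1.1 a b) = _
      ext
      · rw [unitMap_fst]
      · rw [unitMap_snd]; exact P.ev1_const _
    obtain ⟨w, hw⟩ := StGL.exists_of_map_eq_one (P.ev0 (P.iter A n))
      (StGL.map (P.const _) g * StGL.map (P.incl _) x * (StGL.map (P.const _) g)⁻¹) (by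
        have h0 : StGL.map ((P.ev0 (P.iter A n)).comp (P.incl (P.iter A n))) x = 1 :=
          StGL.map_eq_one (fun y => apply_kerIncl (P.ev0 (P.iter A n)) y) x
        rw [map_mul, map_mul, map_inv, hc0, StGL.map_map, h0, mul_one, mul_inv_cancel])
    refine ⟨w, ?_, ?_⟩
    · cases n with
      | zero => exact Subgroup.mem_iInf.2 fun i => i.elim0
      | succ n =>
        refine Subgroup.mem_iInf.2 fun i => ?_
        have hx' : StGL.map (P.coneMap (P.face A n i)) x = 1 := Subgroup.mem_iInf.1 hx i
        change StGL.map (P.coneMap (P.face A n i)) w = 1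
        apply StGL.map_kerIncl_injective (P.ev0 (P.iter A n))
        have comm : ∀ v : StGL (P.cone (P.iter A (n + 1))),
            StGL.map (P.incl (P.iter A n)) (StGL.map (P.coneMap (P.face A n i)) v) =
              StGL.map (P.map (P.face A n i)) (StGL.map (P.incl (P.iter A (n + 1))) v) := by
          intro v
          rw [StGL.map_map, StGL.map_map]
          exact StGL.map_congr (fun y => P.incl_coneMap _ y) v
        refine (comm w).trans ?_
        refine (congrArg _ hw).trans ?_
        rw [map_mul, map_mul, map_inv, ← comm, hx', map_one, mul_one, mul_inv_cancel]
        exact (map_one (StGL.map (P.incl (P.iter A n)))).symm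
    · refine (hev w).trans ?_
      refine (congrArg _ hw).trans ?_
      rw [map_mul, map_mul, map_inv, hc1]
      exact congrArg (fun y => g * y * g⁻¹) (hev x).symm

/-- `P.homotopyGroup A n` is the homotopy group `π_{n-1}` of the augmented simplicial group
`GL(P_*^+(A))`, i.e. the homology of its Moore complex in simplicial degree `n - 1`.
For `n = 0` this is the cokernel of `GL(τ_A) : GL(P(A)) → GL(A)`, for `n = 1` it is the kernel of
`π_0 GL(P_*(A)) → GL(A)`, and for `n ≥ 2` it is `π_{n-1} GL(P_*(A))`. -/
def homotopyGroup (A : LCAlg.{u}) (n : ℕ) : Type u :=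
  P.cycles A n ⧸ (P.boundaries A n).subgroupOf (P.cycles A n)

instance (A : LCAlg.{u}) (n : ℕ) : Group (P.homotopyGroup A n) :=
  inferInstanceAs (Group (P.cycles A n ⧸ (P.boundaries A n).subgroupOf (P.cycles A n)))

end PathFunctor

end LCAlg

/-! ### The Grothendieck group `K_0` -/

section K0

variable {R : Type u} [Ring R]

/-- Murray–von Neumann equivalence of idempotent matrices `e = xy`, `f = yx`: the finitely
generated projective modules which are the images of `e` and `f` are isomorphic. -/
def MvN {ι κ : Type} [Fintype ι] [Fintype κ] (e : Matrix ι ι R) (f : Matrix κ κ R) : Prop :=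
  ∃ (x : Matrix ι κ R) (y : Matrix κ ι R), x * y = e ∧ y * x = f

section

variable {ι κ μ : Type} [Fintype ι] [Fintype κ] [Fintype μ]

theorem MvN.symm {e : Matrix ι ι R} {f : Matrix κ κ R} : MvN e f → MvN f e
  | ⟨x, y, h, h'⟩ => ⟨y, x, h', h⟩

theorem MvN.trans {e : Matrix ι ι R} {f : Matrix κ κ R} {g : Matrix μ μ R}
    (he : IsIdempotentElem e) (hg : IsIdempotentElem g) : MvN e f → MvN f g → MvN e g := by
  rintro ⟨x, y, hxy, hyx⟩ ⟨x', y', hxy', hyx'⟩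
  refine ⟨x * x', y' * y, ?_, ?_⟩
  · rw [Matrix.mul_assoc, ← Matrix.mul_assoc x', hxy', ← hyx, Matrix.mul_assoc,
      ← Matrix.mul_assoc, hxy]
    exact he
  · rw [Matrix.mul_assoc, ← Matrix.mul_assoc y, hyx, ← hxy', Matrix.mul_assoc,
      ← Matrix.mul_assoc, hyx']
    exact hg

theorem MvN.reindex {e : Matrix ι ι R} (he : IsIdempotentElem e) (σ : ι ≃ κ) :
    MvN e (e.submatrix σ.symm σ.symm) :=
  ⟨e.submatrix id σ.symm, e.submatrix σ.symm id,
    by rw [Matrix.submatrix_mul_equiv, he.eq, Matrix.submatrix_id_id],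
    by
      change e.submatrix σ.symm (Equiv.refl ι) * e.submatrix (Equiv.refl ι) σ.symm = _
      rw [Matrix.submatrix_mul_equiv, he.eq]⟩

theorem MvN.refl {e : Matrix ι ι R} (he : IsIdempotentElem e) : MvN e e :=
  ⟨e, e, he, he⟩

theorem MvN.blocks {ι' κ' : Type} [Fintype ι'] [Fintype κ'] {e : Matrix ι ι R} {f : Matrix κ κ R}
    {e' : Matrix ι' ι' R} {f' : Matrix κ' κ' R} : MvN e f → MvN e' f' →
    MvN (Matrix.fromBlocks e 0 0 e') (Matrix.fromBlocks f 0 0 f') := by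
  rintro ⟨x, y, hxy, hyx⟩ ⟨x', y', hxy', hyx'⟩
  exact ⟨Matrix.fromBlocks x 0 0 x', Matrix.fromBlocks y 0 0 y',
    by simp [Matrix.fromBlocks_multiply, hxy, hxy'],
    by simp [Matrix.fromBlocks_multiply, hyx, hyx']⟩

theorem idem_blocks {e : Matrix ι ι R} {f : Matrix κ κ R} (he : IsIdempotentElem e)
    (hf : IsIdempotentElem f) : IsIdempotentElem (Matrix.fromBlocks e 0 0 f) := by
  simp [IsIdempotentElem, Matrix.fromBlocks_multiply, he.eq, hf.eq]

theorem idem_submatrix {e : Matrix ι ι R} (he : IsIdempotentElem e) (σ : κ ≃ ι) :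
    IsIdempotentElem (e.submatrix σ σ) := by
  rw [IsIdempotentElem, Matrix.submatrix_mul_equiv, he.eq]

end

variable (R)

/-- An idempotent square matrix over `R`. -/
structure Idem where
  size : ℕ
  mat : Matrix (Fin size) (Fin size) R
  idem : IsIdempotentElem mat

instance idemSetoid : Setoid (Idem R) where
  r e f := MvN e.mat f.mat
  iseqv :=
    { refl := fun e => MvN.refl e.idem
      symm := fun h => h.symm
      trans := fun {e _ g} h h' => MvN.trans e.idem g.idem h h' }

variable {R}

/-- The block sum `diag(e, f)`. -/
def Idem.add (e f : Idem R) : Idem R where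
  size := e.size + f.size
  mat := (Matrix.fromBlocks e.mat 0 0 f.mat).submatrix finSumFinEquiv.symm finSumFinEquiv.symm
  idem := idem_submatrix (idem_blocks e.idem f.idem) _

theorem Idem.add_mvn (e f : Idem R) :
    MvN (Matrix.fromBlocks e.mat 0 0 f.mat) (e.add f).mat :=
  MvN.reindex (idem_blocks e.idem f.idem) finSumFinEquiv

variable (R)

/-- The monoid of isomorphism classes of finitely generated projective modules over `R`, in terms
of idempotent matrices. -/
def ProjMonoid : Type u := Quotient (idemSetoid R)

instance : Zero (ProjMonoid R) where
  zero := Quotient.mk _ ⟨0, 0, by simp [IsIdempotentElem]⟩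

instance : Add (ProjMonoid R) where
  add := Quotient.map₂ Idem.add fun e e' h f f' h' => by
    refine MvN.trans (e.add f).idem (e'.add f').idem (e.add_mvn f).symm ?_
    exact MvN.trans (idem_blocks e.idem f.idem) (e'.add f').idem (MvN.blocks h h')
      (e'.add_mvn f')

instance : AddCommMonoid (ProjMonoid R) where
  add_assoc := by
    rintro ⟨e⟩ ⟨f⟩ ⟨g⟩
    refine Quotient.sound ?_
    change MvN ((e.add f).add g).mat (e.add (f.add g)).mat
    have i1 := idem_blocks (idem_blocks e.idem f.idem) g.idem
    have i2 := idem_blocks e.idem (idem_blocks f.idem g.idem)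
    have h1 : MvN ((e.add f).add g).mat
        (Matrix.fromBlocks (Matrix.fromBlocks e.mat 0 0 f.mat) 0 0 g.mat) :=
      MvN.trans ((e.add f).add g).idem i1 ((e.add f).add_mvn g).symm
        (MvN.blocks (e.add_mvn f).symm (MvN.refl g.idem))
    have h2 : MvN (Matrix.fromBlocks e.mat 0 0 (Matrix.fromBlocks f.mat 0 0 g.mat))
        (e.add (f.add g)).mat :=
      MvN.trans i2 (e.add (f.add g)).idem (MvN.blocks (MvN.refl e.idem) (f.add_mvn g))
        (e.add_mvn (f.add g))
    have h3 : MvN (Matrix.fromBlocks (Matrix.fromBlocks e.mat 0 0 f.mat) 0 0 g.mat)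
        (Matrix.fromBlocks e.mat 0 0 (Matrix.fromBlocks f.mat 0 0 g.mat)) := by
      have := MvN.reindex i1 (Equiv.sumAssoc _ _ _)
      convert! this using 1
      ext (a | a | a) (b | b | b) <;> rfl
    exact MvN.trans ((e.add f).add g).idem (e.add (f.add g)).idem h1
      (MvN.trans i1 (e.add (f.add g)).idem h3 h2)
  add_comm := by
    rintro ⟨e⟩ ⟨f⟩
    refine Quotient.sound ?_
    change MvN (e.add f).mat (f.add e).mat
    have h3 : MvN (Matrix.fromBlocks e.mat 0 0 f.mat) (Matrix.fromBlocks f.mat 0 0 e.mat) := by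
      have := MvN.reindex (idem_blocks e.idem f.idem) (Equiv.sumComm _ _)
      convert! this using 1
      ext (a | a) (b | b) <;> rfl
    exact MvN.trans (e.add f).idem (f.add e).idem (e.add_mvn f).symm
      (MvN.trans (idem_blocks e.idem f.idem) (f.add e).idem h3 (f.add_mvn e))
  zero_add := by
    rintro ⟨e⟩
    refine Quotient.sound ?_
    let z : Idem R := ⟨0, 0, by simp [IsIdempotentElem]⟩
    change MvN (z.add e).mat e.mat
    have h3 : MvN (Matrix.fromBlocks z.mat 0 0 e.mat) e.mat := by
      have := MvN.reindex (idem_blocks z.idem e.idem) (Equiv.emptySum (Fin 0) (Fin e.size))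
      convert! this using 1
    exact MvN.trans (z.add e).idem e.idem (z.add_mvn e).symm h3
  add_zero := by
    rintro ⟨e⟩
    refine Quotient.sound ?_
    let z : Idem R := ⟨0, 0, by simp [IsIdempotentElem]⟩
    change MvN (e.add z).mat e.mat
    have h3 : MvN (Matrix.fromBlocks e.mat 0 0 z.mat) e.mat := by
      have := MvN.reindex (idem_blocks e.idem z.idem) (Equiv.sumEmpty (Fin e.size) (Fin 0))
      convert! this using 1
    exact MvN.trans (e.add z).idem e.idem (e.add_mvn z).symm h3
  nsmul := nsmulRec

/-- The Grothendieck group `K_0(R)` of a unital ring. -/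
abbrev K0Unital : Type u := Algebra.GrothendieckAddGroup (ProjMonoid R)

variable {R}

/-- Functoriality of the monoid of projective modules. -/
def ProjMonoid.map {R : Type u} {S : Type*} [Ring R] [Ring S] (f : R →+* S) :
    ProjMonoid R →+ ProjMonoid S where
  toFun := Quotient.map
    (fun e => ⟨e.size, f.mapMatrix e.mat, by rw [IsIdempotentElem, ← map_mul, e.idem.eq]⟩)
    (by
      rintro e e' ⟨x, y, h, h'⟩
      refine ⟨x.map f, y.map f, ?_, ?_⟩
      · rw [← Matrix.map_mul, h]; rfl
      · rw [← Matrix.map_mul, h']; rfl)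
  map_zero' := by
    refine Quotient.sound ?_
    exact ⟨0, 0, Subsingleton.elim (α := Matrix (Fin 0) (Fin 0) S) _ _,
      Subsingleton.elim (α := Matrix (Fin 0) (Fin 0) S) _ _⟩
  map_add' := by
    rintro ⟨e⟩ ⟨e'⟩
    refine congrArg (Quotient.mk _) ?_
    change Idem.mk _ _ _ = Idem.mk _ _ _
    congr 1
    change ((Matrix.fromBlocks e.mat 0 0 e'.mat).submatrix finSumFinEquiv.symm
      finSumFinEquiv.symm).map f = (Matrix.fromBlocks (e.mat.map f) 0 0 (e'.mat.map f)).submatrix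
        finSumFinEquiv.symm finSumFinEquiv.symm
    rw [← Matrix.submatrix_map, Matrix.fromBlocks_map]
    simp

/-- Functoriality of `K_0` for unital ring homomorphisms. -/
def K0Unital.map {R : Type u} {S : Type*} [Ring R] [Ring S] (f : R →+* S) :
    K0Unital R →+ K0Unital S :=
  Algebra.GrothendieckAddGroup.lift
    ((Algebra.GrothendieckAddGroup.of (M := ProjMonoid S)).comp (ProjMonoid.map f))

end K0

namespace LCAlg

/-- `K_0(A) = ker (K_0(A⁺) → K_0(ℂ))`. -/
def K0 (A : LCAlg.{u}) : AddSubgroup (K0Unital (Unitization ℂ A)) :=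
  (K0Unital.map (Unitization.fstHom ℂ A).toRingHom).ker

/-! ### The `K`-groups -/

/-- The `K`-groups defined by a path functor `P`: `K_0(A)` in degree `0`, and the homotopy group
`π_{n-2}` of `GL(P_*^+(A))` in degree `n ≥ 1`. -/
def PathFunctor.K (P : PathFunctor.{u}) (A : LCAlg.{u}) : ℕ → Type u
  | 0 => Multiplicative (K0 A)
  | n + 1 => P.homotopyGroup A n

instance (P : PathFunctor.{u}) (A : LCAlg.{u}) : ∀ n, Group (P.K A n)
  | 0 => inferInstanceAs (Group (Multiplicative (K0 A)))
  | n + 1 => inferInstanceAs (Group (P.homotopyGroup A n))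

/-- The smooth `K`-groups `K_n^{sm}(A)` (written multiplicatively). -/
abbrev Ksm (A : LCAlg.{u}) (n : ℕ) : Type u := PathFunctor.smooth.K A n

/-- The topological `K`-groups `K_n^{top}(A)` (written multiplicatively). -/
abbrev Ktop (A : LCAlg.{u}) (n : ℕ) : Type u := PathFunctor.cont.K A n

/-- The inclusion of smooth into continuous paths starting at `0`, `𝓘(A) → 𝓙(A)`. -/
def coneIncl (A : LCAlg.{u}) : Hom (PathFunctor.smooth.cone A) (PathFunctor.cont.cone A) :=
  kerLift (PathFunctor.cont.ev0 A) ((smoothToCont A).comp (PathFunctor.smooth.incl A))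
    fun c => apply_kerIncl (PathFunctor.smooth.ev0 A) c

theorem coneIncl_natural {A B : LCAlg.{u}} (f : Hom A B) (x : PathFunctor.smooth.cone A) :
    coneIncl B (PathFunctor.smooth.coneMap f x) = PathFunctor.cont.coneMap f (coneIncl A x) := rfl

theorem tau_coneIncl (A : LCAlg.{u}) (x : PathFunctor.smooth.cone A) :
    PathFunctor.cont.tau A (coneIncl A x) = PathFunctor.smooth.tau A x := rfl

/-- The morphism of augmented simplicial algebras `𝓘_*^+(A) → 𝓙_*^+(A)` induced by the inclusion
of smooth into continuous paths. -/
def cmp (A : LCAlg.{u}) : ∀ n, Hom (PathFunctor.smooth.iter A n) (PathFunctor.cont.iter A n)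
  | 0 => { NonUnitalAlgHom.id ℂ A with cont := continuous_id }
  | n + 1 => (PathFunctor.cont.coneMap (cmp A n)).comp (coneIncl (PathFunctor.smooth.iter A n))

theorem face_cmp (A : LCAlg.{u}) : ∀ (n : ℕ) (i : Fin (n + 1))
    (x : PathFunctor.smooth.iter A (n + 1)),
    PathFunctor.cont.face A n i (cmp A (n + 1) x) = cmp A n (PathFunctor.smooth.face A n i x)
  | n, i, x => by
    induction n with
    | zero => rfl
    | succ n ih =>
      refine Fin.cases ?_ (fun j => ?_) i
      · rw [PathFunctor.face_zero, PathFunctor.face_zero]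
        exact (PathFunctor.cont.tau_coneMap (cmp A (n + 1)) _)
      · rw [PathFunctor.face_succ, PathFunctor.face_succ]
        refine (PathFunctor.cont.coneMap_comp (PathFunctor.cont.face A n j) (cmp A (n + 1))
          (coneIncl _ x)).symm.trans ?_
        have : (PathFunctor.cont.face A n j).comp (cmp A (n + 1)) =
            (cmp A n).comp (PathFunctor.smooth.face A n j) := Hom.ext fun y => ih j y
        rw [this]
        exact PathFunctor.cont.coneMap_comp (cmp A n) (PathFunctor.smooth.face A n j)
          (coneIncl _ x)

theorem map_face_cmp (A : LCAlg.{u}) (n : ℕ) (i : Fin (n + 1))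
    (z : StGL (PathFunctor.smooth.iter A (n + 1))) :
    StGL.map (PathFunctor.cont.face A n i) (StGL.map (cmp A (n + 1)) z) =
      StGL.map (cmp A n) (StGL.map (PathFunctor.smooth.face A n i) z) := by
  rw [StGL.map_map, StGL.map_map]
  exact StGL.map_congr (face_cmp A n i) z

theorem cmp_cycles (A : LCAlg.{u}) (n : ℕ) (z : StGL (PathFunctor.smooth.iter A n))
    (hz : z ∈ PathFunctor.smooth.cycles A n) :
    StGL.map (cmp A n) z ∈ PathFunctor.cont.cycles A n := by
  cases n with
  | zero => trivial
  | succ n =>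
    refine Subgroup.mem_iInf.2 fun i => ?_
    have h : StGL.map (PathFunctor.smooth.face A n i) z = 1 := Subgroup.mem_iInf.1 hz i
    exact (map_face_cmp A n i z).trans (by rw [h, map_one])

theorem cmp_boundaries (A : LCAlg.{u}) (n : ℕ) (z : StGL (PathFunctor.smooth.iter A n))
    (hz : z ∈ PathFunctor.smooth.boundaries A n) :
    StGL.map (cmp A n) z ∈ PathFunctor.cont.boundaries A n := by
  obtain ⟨x, hx, rfl⟩ := hz
  refine ⟨StGL.map (cmp A (n + 1)) x, ?_, map_face_cmp A n 0 x⟩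
  refine Subgroup.mem_iInf.2 fun i => ?_
  have h : StGL.map (PathFunctor.smooth.face A n i.succ) x = 1 := Subgroup.mem_iInf.1 hx i
  exact (map_face_cmp A n i.succ x).trans (by rw [h, map_one])

/-- The map induced by `𝓘_*^+(A) → 𝓙_*^+(A)` on the homotopy groups of `GL`. -/
def homotopyCmp (A : LCAlg.{u}) (n : ℕ) :
    PathFunctor.smooth.homotopyGroup A n →* PathFunctor.cont.homotopyGroup A n :=
  QuotientGroup.map _ _
    (((StGL.map (cmp A n)).comp (PathFunctor.smooth.cycles A n).subtype).codRestrict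
      (PathFunctor.cont.cycles A n) fun z => cmp_cycles A n z.1 z.2)
    fun z hz => cmp_boundaries A n z.1 hz

/-- The natural homomorphism `β_n : K_n^{sm}(A) → K_n^{top}(A)`; it is the identity of `K_0(A)`
for `n = 0`. -/
def beta (A : LCAlg.{u}) : ∀ n, Ksm A n →* Ktop A n
  | 0 => MonoidHom.id (Multiplicative (K0 A))
  | n + 1 => homotopyCmp A n

end LCAlg

end

end SmoothK

set_option linter.unusedSectionVars false

namespace SmoothK

noncomputable section

/-! ### Quasi-units of non-unital rings -/

/-! Write `Ω_P A` for the kernel of `τ : P(A) → A`. Both path functors preserve joint kernels, so an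
element of `GL` of the `n`-fold path algebra that is killed by all faces comes from `GL(Ω_P^n A)`,
and the Moore boundaries are the image of `GL(P Ω_P^n A)`. Hence the `K`-group in degree `n + 1` is
`GL(Ω_P^n A)` modulo the endpoints of `P`-paths of invertible matrices starting at `1`
(`mem_cycles_iff`, `mem_boundaries_iff`). It remains to compare smooth with continuous
null-homotopies over a fixed algebra, and iterated smooth with iterated continuous loops. Degree
zero is the identity.

The analytic core is `exists_smooth_lift`: an invertible matrix that is the endpoint of a continuous
path from `1` is the endpoint of a smooth one. Smooth paths are dense, so a continuous path is a
smooth one times a remainder near `1`, and one would like to iterate as in the open mapping theorem.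
The smooth factors are small only uniformly, however, and their derivatives may be huge. The remedy
is that a smooth path uniformly close to `1` is, up to an arbitrarily small error in a given
`C^k`-seminorm, a finite product of exponentials whose exponents have small total sup norm
(`IsFM.exists_expProd`). The derivatives are weighted so that the path is small for a
submultiplicative `C^k`-seminorm as well. Replacing each exponent `z` by the straight path `t ↦ t
z(1)` keeps the endpoint and makes the product small in `C^k` (`PathComparison.almost_open`). The
infinite product of such corrections then converges (`PathComparison.exists_lift`).

This is next applied to algebras of paths and of loops, which are again given by complete sequences
of submultiplicative seminorms. It shows that `Ω_sm A → Ω_top A` is bijective on invertible matrices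
modulo continuously null-homotopic ones (`kBij_loopCmp`). Interchanging path variables identifies
`Ω_top` of this map with the same map for `Ω_top A`, so the bijectivity passes to iterated loops
(`kBijLoops_omegaCmp`). A last use of the lifting result turns continuous null-homotopies over
`Ω_sm^n A` into smooth ones, which gives `homotopyCmp_injective`; `homotopyCmp_surjective` needs
only the comparison of loops. -/

/-- An element `x` of a non-unital ring together with an element `y` such that `1 + x` and `1 + y`
are inverse to each other in the unitization. -/
@[ext] structure QUnit (R : Type*) [NonUnitalRing R] where
  val : R
  inv : R
  val_inv : val + inv + val * inv = 0
  inv_val : inv + val + inv * val = 0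

namespace QUnit

variable {R S T : Type*} [NonUnitalRing R] [NonUnitalRing S] [NonUnitalRing T]

/-- Uniqueness of inverses: with `b` a left and `c` a right quasi-inverse of `a`, bracketing `(1 +
b)(1 + a)(1 + c)` in two ways gives `b = c`. -/
theorem ext_val {x y : QUnit R} (h : x.val = y.val) : x = y := by
  refine QUnit.ext h ?_
  obtain ⟨a, b, h1, h2⟩ := x
  obtain ⟨a', c, h3, h4⟩ := y
  obtain rfl : a = a' := h
  change b = c
  have e1 : (b + a + b * a) + (b + a + b * a) * c = 0 := by rw [h2]; simp
  have e2 : (a + c + a * c) + b * (a + c + a * c) = 0 := by rw [h3]; simp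
  have : (b + a + b * a) + (b + a + b * a) * c - ((a + c + a * c) + b * (a + c + a * c))
      = b - c := by
    noncomm_ring
  rw [e1, e2] at this
  simpa [sub_eq_zero] using this.symm

instance : One (QUnit R) := ⟨⟨0, 0, by simp, by simp⟩⟩

/-- The circle product, chosen so that `1 + (x * y).val = (1 + x.val)(1 + y.val)` in the
unitization. -/
instance : Mul (QUnit R) := ⟨fun x y =>
  ⟨x.val + y.val + x.val * y.val, y.inv + x.inv + y.inv * x.inv, by
    have h1 := x.val_inv
    have h2 := y.val_inv
    have : x.val + y.val + x.val * y.val + (y.inv + x.inv + y.inv * x.inv) +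
      (x.val + y.val + x.val * y.val) * (y.inv + x.inv + y.inv * x.inv) =
      (x.val + x.inv + x.val * x.inv) + (y.val + y.inv + y.val * y.inv)
      + x.val * (y.val + y.inv + y.val * y.inv) + (y.val + y.inv + y.val * y.inv) * x.inv
      + x.val * (y.val + y.inv + y.val * y.inv) * x.inv := by noncomm_ring
    rw [this, h1, h2]; simp, by
    have h1 := x.inv_val
    have h2 := y.inv_val
    have : (y.inv + x.inv + y.inv * x.inv) + (x.val + y.val + x.val * y.val) +
      (y.inv + x.inv + y.inv * x.inv) * (x.val + y.val + x.val * y.val) =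
      (x.inv + x.val + x.inv * x.val) + (y.inv + y.val + y.inv * y.val)
      + y.inv * (x.inv + x.val + x.inv * x.val) + (x.inv + x.val + x.inv * x.val) * y.val
      + y.inv * (x.inv + x.val + x.inv * x.val) * y.val := by noncomm_ring
    rw [this, h1, h2]; simp⟩⟩

instance : Inv (QUnit R) := ⟨fun x => ⟨x.inv, x.val, x.inv_val, x.val_inv⟩⟩

@[simp] theorem one_val : (1 : QUnit R).val = 0 := rfl
@[simp] theorem mul_val (x y : QUnit R) : (x * y).val = x.val + y.val + x.val * y.val := rfl
@[simp] theorem inv_val' (x : QUnit R) : (x⁻¹).val = x.inv := rfl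
@[simp] theorem inv_inv' (x : QUnit R) : (x⁻¹).inv = x.val := rfl

instance : Group (QUnit R) :=
  Group.ofLeftAxioms
    (fun x y z => ext_val (by simp only [mul_val]; noncomm_ring))
    (fun x => ext_val (by simp))
    (fun x => ext_val (by simpa using x.inv_val))

/-- The difference `y - x` is exhibited as a factor, so that closeness of `x` and `y` makes the
quotient close to `1`. -/
theorem inv_mul_val (x y : QUnit R) :
    (x⁻¹ * y).val = (y.val - x.val) + x.inv * (y.val - x.val) := by
  have h := x.inv_val
  have : (x⁻¹ * y).val = (y.val - x.val) + x.inv * (y.val - x.val)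
      + (x.inv + x.val + x.inv * x.val) := by
    simp only [mul_val, inv_val']; noncomm_ring
  rw [this, h, add_zero]

/-- Functoriality of quasi-units. -/
def map (f : R →ₙ+* S) : QUnit R →* QUnit S where
  toFun x := ⟨f x.val, f x.inv, by rw [← map_mul, ← map_add, ← map_add, x.val_inv, map_zero],
    by rw [← map_mul, ← map_add, ← map_add, x.inv_val, map_zero]⟩
  map_one' := ext_val (map_zero f)
  map_mul' x y := ext_val (by simp)

theorem map_injective {f : R →ₙ+* S} (hf : Function.Injective f) :
    Function.Injective (map f) := fun _ _ h =>
  ext_val (hf (congrArg QUnit.val h))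

/-- A quasi-unit whose components lie in the image of an injective homomorphism can be lifted. -/
theorem exists_lift {f : R →ₙ+* S} (hf : Function.Injective f) (x : QUnit S)
    (h1 : x.val ∈ Set.range f) (h2 : x.inv ∈ Set.range f) : ∃ y, map f y = x := by
  obtain ⟨a, ha⟩ := h1
  obtain ⟨b, hb⟩ := h2
  refine ⟨⟨a, b, hf ?_, hf ?_⟩, ext_val ha⟩
  · rw [map_add, map_add, map_mul, ha, hb, x.val_inv, map_zero]
  · rw [map_add, map_add, map_mul, ha, hb, x.inv_val, map_zero]

end QUnit

/-! ### Families of submultiplicative seminorms -/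

section seminorms

variable {D E C : Type*} [NonUnitalRing D] [Module ℂ D] [IsScalarTower ℂ D D]
  [SMulCommClass ℂ D D] [NonUnitalRing E] [Module ℂ E] [IsScalarTower ℂ E E]
  [SMulCommClass ℂ E E] [NonUnitalRing C] [Module ℂ C] [IsScalarTower ℂ C C]
  [SMulCommClass ℂ C C]

/-- An increasing separating complete sequence of submultiplicative seminorms. -/
structure IsFM (p : ℕ → Seminorm ℂ D) : Prop where
  mono : ∀ {k l}, k ≤ l → ∀ x, p k x ≤ p l x
  mul_le : ∀ k x y, p k (x * y) ≤ p k x * p k y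
  sep : ∀ x, (∀ k, p k x = 0) → x = 0
  -- Completeness is asked only for sequences with summable increments. All limits below are of this
  -- kind, and the condition passes easily to kernels, path algebras and matrices.
  complete : ∀ v : ℕ → D, (∀ k, Summable fun n => p k (v (n + 1) - v n)) →
    ∃ a, ∀ k, Tendsto (fun n => p k (v n - a)) atTop (𝓝 0)

theorem IsFM.eq_of_tendsto {p : ℕ → Seminorm ℂ D} (hp : IsFM p) {v : ℕ → D} {a b : D}
    (ha : ∀ k, Tendsto (fun n => p k (v n - a)) atTop (𝓝 0))
    (hb : ∀ k, Tendsto (fun n => p k (v n - b)) atTop (𝓝 0)) : a = b := by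
  rw [← sub_eq_zero]
  refine hp.sep _ fun k => le_antisymm ?_ (apply_nonneg _ _)
  have h : Tendsto (fun n => p k (v n - b) + p k (v n - a)) atTop (𝓝 (0 + 0)) := (hb k).add (ha k)
  rw [add_zero] at h
  refine ge_of_tendsto' h fun n => ?_
  calc p k (a - b) = p k ((v n - b) - (v n - a)) := by congr 1; abel
    _ ≤ _ := map_sub_le_add _ _ _

theorem IsFM.tendsto_mul {p : ℕ → Seminorm ℂ D} (hp : IsFM p) {v w : ℕ → D} {a b : D}
    (ha : ∀ k, Tendsto (fun n => p k (v n - a)) atTop (𝓝 0))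
    (hb : ∀ k, Tendsto (fun n => p k (w n - b)) atTop (𝓝 0)) (k : ℕ) :
    Tendsto (fun n => p k (v n * w n - a * b)) atTop (𝓝 0) := by
  have h : Tendsto (fun n => p k (v n - a) * p k (w n - b) + p k (v n - a) * p k b
      + p k a * p k (w n - b)) atTop (𝓝 (0 * 0 + 0 * p k b + p k a * 0)) :=
    (((ha k).mul (hb k)).add ((ha k).mul_const _)).add ((hb k).const_mul _)
  simp only [zero_mul, mul_zero, add_zero] at h
  refine squeeze_zero (fun _ => apply_nonneg _ _) (fun n => ?_) h
  calc p k (v n * w n - a * b)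
      = p k ((v n - a) * (w n - b) + (v n - a) * b + a * (w n - b)) := by
        congr 1; noncomm_ring
    _ ≤ p k ((v n - a) * (w n - b)) + p k ((v n - a) * b) + p k (a * (w n - b)) :=
        (map_add_le_add _ _ _).trans (add_le_add_left (map_add_le_add _ _ _) _)
    _ ≤ _ := by gcongr <;> exact hp.mul_le _ _ _

theorem tendsto_add_of_seminorm {q : Seminorm ℂ D} {v w : ℕ → D} {a b : D}
    (ha : Tendsto (fun n => q (v n - a)) atTop (𝓝 0))
    (hb : Tendsto (fun n => q (w n - b)) atTop (𝓝 0)) :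
    Tendsto (fun n => q (v n + w n - (a + b))) atTop (𝓝 0) := by
  have h := ha.add hb
  rw [add_zero] at h
  refine squeeze_zero (fun _ => apply_nonneg _ _) (fun n => ?_) h
  rw [add_sub_add_comm]
  exact map_add_le_add _ _ _

/-- Limits of sequences of quasi-units. -/
theorem IsFM.exists_qunit {p : ℕ → Seminorm ℂ D} (hp : IsFM p) (v w : ℕ → D)
    (hv : ∀ k, Summable fun n => p k (v (n + 1) - v n))
    (hw : ∀ k, Summable fun n => p k (w (n + 1) - w n))
    (h1 : ∀ k, Tendsto (fun n => p k (v n + w n + v n * w n)) atTop (𝓝 0))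
    (h2 : ∀ k, Tendsto (fun n => p k (w n + v n + w n * v n)) atTop (𝓝 0)) :
    ∃ x : QUnit D, (∀ k, Tendsto (fun n => p k (v n - x.val)) atTop (𝓝 0)) ∧
      ∀ k, Tendsto (fun n => p k (w n - x.inv)) atTop (𝓝 0) := by
  obtain ⟨a, ha⟩ := hp.complete v hv
  obtain ⟨b, hb⟩ := hp.complete w hw
  refine ⟨⟨a, b, ?_, ?_⟩, ha, hb⟩
  · exact hp.eq_of_tendsto (v := fun n => v n + w n + v n * w n)
      (fun k => tendsto_add_of_seminorm (tendsto_add_of_seminorm (ha k) (hb k))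
        (hp.tendsto_mul ha hb k)) (fun k => by simpa using h1 k)
  · exact hp.eq_of_tendsto (v := fun n => w n + v n + w n * v n)
      (fun k => tendsto_add_of_seminorm (tendsto_add_of_seminorm (hb k) (ha k))
        (hp.tendsto_mul hb ha k)) (fun k => by simpa using h2 k)

/-! ### The exponential -/

/-- The terms `z ^ (n + 1) / (n + 1)!` of the exponential series. -/
def expTerm (z : D) : ℕ → D
  | 0 => z
  | n + 1 => ((n + 2 : ℕ) : ℂ)⁻¹ • (z * expTerm z n)

/-- The partial sums of the series of `exp z - 1`. -/
def expSum (z : D) (N : ℕ) : D := ∑ n ∈ Finset.range N, expTerm z n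

theorem map_expTerm (f : D →ₙₐ[ℂ] E) (z : D) (n : ℕ) : f (expTerm z n) = expTerm (f z) n := by
  induction n with
  | zero => rfl
  | succ n ih => rw [expTerm, map_smul, map_mul, ih]; rfl

theorem map_expSum (f : D →ₙₐ[ℂ] E) (z : D) (n : ℕ) : f (expSum z n) = expSum (f z) n := by
  simp [expSum, map_sum, map_expTerm]

theorem seminorm_expTerm_le {q : Seminorm ℂ D} (hq : ∀ x y, q (x * y) ≤ q x * q y) (z : D)
    (n : ℕ) : q (expTerm z n) ≤ q z ^ (n + 1) / (n + 1).factorial := by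
  induction n with
  | zero => simp [expTerm]
  | succ n ih =>
    rw [expTerm, map_smul_eq_mul, norm_inv, Complex.norm_natCast, Nat.factorial_succ (n + 1)]
    have h : q (z * expTerm z n) ≤ q z * (q z ^ (n + 1) / (n + 1).factorial) :=
      (hq _ _).trans (mul_le_mul_of_nonneg_left ih (apply_nonneg _ _))
    refine (mul_le_mul_of_nonneg_left h (by positivity)).trans (le_of_eq ?_)
    push_cast
    field_simp
    ring

theorem inr_expTerm (z : D) (n : ℕ) : (Unitization.inr (expTerm z n) : Unitization ℂ D) =
    (((n + 1).factorial : ℕ) : ℂ)⁻¹ • (Unitization.inr z : Unitization ℂ D) ^ (n + 1) := by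
  induction n with
  | zero => simp [expTerm]
  | succ n ih =>
    rw [expTerm, Unitization.inr_smul, Unitization.inr_mul, ih, mul_smul_comm, smul_smul,
      ← pow_succ', Nat.factorial_succ (n + 1), Nat.cast_mul, mul_inv]

theorem one_add_inr_expSum (z : D) (N : ℕ) :
    (1 + Unitization.inr (expSum z N) : Unitization ℂ D) =
      ∑ n ∈ Finset.range (N + 1), ((n.factorial : ℕ) : ℂ)⁻¹ •
        (Unitization.inr z : Unitization ℂ D) ^ n := by
  rw [Finset.sum_range_succ', add_comm]
  congr 1
  · rw [expSum]
    induction N with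
    | zero => simp
    | succ N ih => rw [Finset.sum_range_succ, Unitization.inr_add, ih, Finset.sum_range_succ,
        inr_expTerm]
  · simp

/-- The square of indices `i, j < N` is cut along the diagonal: the pairs with `i + j < N` form the
partial sum for `z + w` by the binomial theorem, and the others form the remainder. -/
theorem expSum_mul_aux {𝕜 R : Type*} [Field 𝕜] [CharZero 𝕜] [Ring R] [Algebra 𝕜 R] {z w : R}
    (h : Commute z w) (N : ℕ) :
    (∑ n ∈ Finset.range N, ((n.factorial : ℕ) : 𝕜)⁻¹ • z ^ n) *
      (∑ n ∈ Finset.range N, ((n.factorial : ℕ) : 𝕜)⁻¹ • w ^ n) =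
    ∑ n ∈ Finset.range N, ((n.factorial : ℕ) : 𝕜)⁻¹ • (z + w) ^ n +
      ∑ i ∈ Finset.range N, ∑ j ∈ Finset.Ico (N - i) N,
        (((i.factorial : ℕ) : 𝕜)⁻¹ * ((j.factorial : ℕ) : 𝕜)⁻¹) • (z ^ i * w ^ j) := by
  have h1 : ∑ n ∈ Finset.range N, ((n.factorial : ℕ) : 𝕜)⁻¹ • (z + w) ^ n =
      ∑ i ∈ Finset.range N, ∑ j ∈ Finset.range (N - i),
        (((i.factorial : ℕ) : 𝕜)⁻¹ * ((j.factorial : ℕ) : 𝕜)⁻¹) • (z ^ i * w ^ j) := by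
    rw [← Finset.sum_range_diag_flip]
    refine Finset.sum_congr rfl fun n _ => ?_
    rw [h.add_pow, Finset.smul_sum]
    refine Finset.sum_congr rfl fun m hm => ?_
    have hm' : m ≤ n := by simpa [Nat.lt_succ_iff] using hm
    rw [← Nat.cast_comm, ← nsmul_eq_mul, ← Nat.cast_smul_eq_nsmul 𝕜, smul_smul]
    congr 1
    have := Nat.choose_mul_factorial_mul_factorial hm'
    have h' : ((n.choose m : ℕ) : 𝕜) * (m.factorial : ℕ) * ((n - m).factorial : ℕ) =
      (n.factorial : ℕ) := by exact_mod_cast this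
    have a1 : ((m.factorial : ℕ) : 𝕜) ≠ 0 := Nat.cast_ne_zero.2 m.factorial_ne_zero
    have a2 : (((n - m).factorial : ℕ) : 𝕜) ≠ 0 := Nat.cast_ne_zero.2 (n - m).factorial_ne_zero
    have a3 : ((n.factorial : ℕ) : 𝕜) ≠ 0 := Nat.cast_ne_zero.2 n.factorial_ne_zero
    field_simp
    rw [← h']
  rw [h1, ← Finset.sum_add_distrib, Finset.sum_mul]
  refine Finset.sum_congr rfl fun i _ => ?_
  rw [Finset.range_eq_Ico, Finset.range_eq_Ico, Finset.sum_Ico_consecutive _ (Nat.zero_le _)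
    (Nat.sub_le _ _), Finset.mul_sum]
  refine Finset.sum_congr rfl fun j _ => ?_
  rw [smul_mul_smul_comm]

theorem tendsto_expSum_real (x : ℝ) :
    Tendsto (fun N => ∑ n ∈ Finset.range N, ((n.factorial : ℕ) : ℝ)⁻¹ • x ^ n) atTop
      (𝓝 (Real.exp x)) := by
  have := (NormedSpace.expSeries_div_hasSum_exp (𝔸 := ℝ) x).tendsto_sum_nat
  rw [← Real.exp_eq_exp_ℝ] at this
  refine this.congr fun N => Finset.sum_congr rfl fun n _ => ?_
  rw [smul_eq_mul, div_eq_inv_mul]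

/-- The `ℓ¹`-extension of a seminorm to the unitization. -/
def unitSemi (q : Seminorm ℂ D) (x : Unitization ℂ D) : ℝ := ‖x.fst‖ + q x.snd

theorem unitSemi_sum_le (q : Seminorm ℂ D) {ι : Type*} (s : Finset ι)
    (f : ι → Unitization ℂ D) : unitSemi q (∑ i ∈ s, f i) ≤ ∑ i ∈ s, unitSemi q (f i) := by
  classical
  induction s using Finset.induction_on with
  | empty => simp [unitSemi]
  | insert a s ha ih =>
    rw [Finset.sum_insert ha, Finset.sum_insert ha]
    refine le_trans ?_ (add_le_add_right ih _)
    simp only [unitSemi, Unitization.fst_add, Unitization.snd_add]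
    have h1 := norm_add_le (f a).fst (∑ i ∈ s, f i).fst
    have h2 := map_add_le_add q (f a).snd (∑ i ∈ s, f i).snd
    linarith

theorem unitSemi_mul_le {q : Seminorm ℂ D} (hq : ∀ x y, q (x * y) ≤ q x * q y)
    (x y : Unitization ℂ D) : unitSemi q (x * y) ≤ unitSemi q x * unitSemi q y := by
  simp only [unitSemi, Unitization.fst_mul, Unitization.snd_mul, norm_mul]
  have h1 : q (x.fst • y.snd + y.fst • x.snd + x.snd * y.snd) ≤
      ‖x.fst‖ * q y.snd + ‖y.fst‖ * q x.snd + q x.snd * q y.snd := by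
    refine (map_add_le_add _ _ _).trans (add_le_add ((map_add_le_add _ _ _).trans ?_) (hq _ _))
    rw [map_smul_eq_mul, map_smul_eq_mul]
  nlinarith [h1]

theorem unitSemi_pow_le {q : Seminorm ℂ D} (hq : ∀ x y, q (x * y) ≤ q x * q y)
    (x : Unitization ℂ D) (n : ℕ) : unitSemi q (x ^ n) ≤ unitSemi q x ^ n := by
  induction n with
  | zero => simp [unitSemi]
  | succ n ih =>
    rw [pow_succ, pow_succ]
    refine (unitSemi_mul_le hq _ _).trans (mul_le_mul_of_nonneg_right ih ?_)
    exact add_nonneg (norm_nonneg _) (apply_nonneg _ _)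

/-- The remainder in the product of the partial sums for `z` and `-z` has nonnegative coefficients.
It is therefore bounded by the same remainder for the real number `a = q z` taken twice, which tends
to `e^a e^a - e^(2a) = 0`. -/
theorem tendsto_expSum_mul_neg {q : Seminorm ℂ D} (hq : ∀ x y, q (x * y) ≤ q x * q y) (z : D) :
    Tendsto (fun N => q (expSum z N + expSum (-z) N + expSum z N * expSum (-z) N)) atTop
      (𝓝 0) := by
  set a : ℝ := q z with ha
  have key : ∀ N, q (expSum z N + expSum (-z) N + expSum z N * expSum (-z) N) ≤
      (∑ n ∈ Finset.range (N + 1), ((n.factorial : ℕ) : ℝ)⁻¹ • a ^ n) *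
      (∑ n ∈ Finset.range (N + 1), ((n.factorial : ℕ) : ℝ)⁻¹ • a ^ n) -
      ∑ n ∈ Finset.range (N + 1), ((n.factorial : ℕ) : ℝ)⁻¹ • (a + a) ^ n := by
    intro N
    rw [expSum_mul_aux (Commute.refl a) (N + 1), add_sub_cancel_left]
    have hc : Commute (Unitization.inr z : Unitization ℂ D) (Unitization.inr (-z)) := by
      rw [Unitization.inr_neg]; exact (Commute.refl _).neg_right
    have e := expSum_mul_aux (𝕜 := ℂ) hc (N + 1)
    rw [← one_add_inr_expSum, ← one_add_inr_expSum] at e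
    have e1 : ∑ n ∈ Finset.range (N + 1), ((n.factorial : ℕ) : ℂ)⁻¹ •
        ((Unitization.inr z : Unitization ℂ D) + Unitization.inr (-z)) ^ n = 1 := by
      rw [← Unitization.inr_add, add_neg_cancel, Unitization.inr_zero, Finset.sum_range_succ']
      simp
    rw [e1] at e
    have e2 : (Unitization.inr (expSum z N + expSum (-z) N + expSum z N * expSum (-z) N) :
        Unitization ℂ D) = ∑ i ∈ Finset.range (N + 1), ∑ j ∈ Finset.Ico (N + 1 - i) (N + 1),
        (((i.factorial : ℕ) : ℂ)⁻¹ * ((j.factorial : ℕ) : ℂ)⁻¹) •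
        ((Unitization.inr z : Unitization ℂ D) ^ i * (Unitization.inr (-z)) ^ j) := by
      have : (1 + Unitization.inr (expSum z N) : Unitization ℂ D) *
          (1 + Unitization.inr (expSum (-z) N)) =
          1 + Unitization.inr (expSum z N + expSum (-z) N + expSum z N * expSum (-z) N) := by
        rw [Unitization.inr_add, Unitization.inr_add, Unitization.inr_mul]; noncomm_ring
      rw [this] at e
      exact add_left_cancel e
    have e3 : q (expSum z N + expSum (-z) N + expSum z N * expSum (-z) N) =
      unitSemi q (Unitization.inr (expSum z N + expSum (-z) N + expSum z N * expSum (-z) N)) := by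
      simp [unitSemi]
    rw [e3, e2]
    refine (unitSemi_sum_le q _ _).trans (Finset.sum_le_sum fun i _ => ?_)
    refine (unitSemi_sum_le q _ _).trans (Finset.sum_le_sum fun j _ => ?_)
    have hs : ∀ (c : ℂ) (x : Unitization ℂ D), unitSemi q (c • x) = ‖c‖ * unitSemi q x := by
      intro c x
      simp only [unitSemi, Unitization.fst_smul, Unitization.snd_smul, map_smul_eq_mul, norm_smul]
      ring
    rw [hs, smul_eq_mul, norm_mul, norm_inv, norm_inv, Complex.norm_natCast, Complex.norm_natCast]
    refine mul_le_mul_of_nonneg_left ?_ (by positivity)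
    refine (unitSemi_mul_le hq _ _).trans ?_
    have hz : unitSemi q (Unitization.inr z) = a := by simp [unitSemi, ha]
    have hz' : unitSemi q (Unitization.inr (-z)) = a := by
      simp [unitSemi, ha, -Unitization.inr_neg]
    have b1 := unitSemi_pow_le hq (Unitization.inr z) i
    have b2 := unitSemi_pow_le hq (Unitization.inr (-z)) j
    rw [hz] at b1
    rw [hz'] at b2
    exact mul_le_mul b1 b2 (add_nonneg (norm_nonneg _) (apply_nonneg _ _))
      (pow_nonneg (apply_nonneg _ _) _)
  refine squeeze_zero (fun _ => apply_nonneg _ _) key ?_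
  have t := fun x : ℝ => (tendsto_add_atTop_iff_nat 1).2 (tendsto_expSum_real x)
  have := ((t a).mul (t a)).sub (t (a + a))
  rwa [← Real.exp_add, sub_self] at this

theorem IsFM.summable_expSum {p : ℕ → Seminorm ℂ D} (hp : IsFM p) (z : D) (k : ℕ) :
    Summable fun n => p k (expSum z (n + 1) - expSum z n) := by
  refine Summable.of_nonneg_of_le (fun _ => apply_nonneg _ _) (fun n => ?_)
    ((summable_nat_add_iff 1).2 (Real.summable_pow_div_factorial (p k z)))
  rw [expSum, expSum, Finset.sum_range_succ, add_sub_cancel_left]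
  exact seminorm_expTerm_le (hp.mul_le k) z n

theorem IsFM.exists_exp {p : ℕ → Seminorm ℂ D} (hp : IsFM p) (z : D) :
    ∃ x : QUnit D, (∀ k, Tendsto (fun n => p k (expSum z n - x.val)) atTop (𝓝 0)) ∧
      ∀ k, Tendsto (fun n => p k (expSum (-z) n - x.inv)) atTop (𝓝 0) :=
  hp.exists_qunit _ _ (hp.summable_expSum z) (hp.summable_expSum (-z))
    (fun k => tendsto_expSum_mul_neg (hp.mul_le k) z)
    (fun k => by simpa using tendsto_expSum_mul_neg (hp.mul_le k) (-z))

/-- The quasi-unit `exp z - 1`. -/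
def IsFM.exp {p : ℕ → Seminorm ℂ D} (hp : IsFM p) (z : D) : QUnit D := (hp.exists_exp z).choose

theorem IsFM.tendsto_exp {p : ℕ → Seminorm ℂ D} (hp : IsFM p) (z : D) (k : ℕ) :
    Tendsto (fun n => p k (expSum z n - (hp.exp z).val)) atTop (𝓝 0) :=
  (hp.exists_exp z).choose_spec.1 k

theorem IsFM.exp_inv {p : ℕ → Seminorm ℂ D} (hp : IsFM p) (z : D) :
    (hp.exp z).inv = (hp.exp (-z)).val :=
  hp.eq_of_tendsto (hp.exists_exp z).choose_spec.2 (hp.tendsto_exp (-z))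

theorem IsFM.map_exp {p : ℕ → Seminorm ℂ D} {r : ℕ → Seminorm ℂ E} (hp : IsFM p) (hr : IsFM r)
    (f : D →ₙₐ[ℂ] E) (hf : ∀ k, ∃ l M, ∀ x, r k (f x) ≤ M * p l x) (z : D) :
    QUnit.map (f : D →ₙ+* E) (hp.exp z) = hr.exp (f z) := by
  refine QUnit.ext_val (hr.eq_of_tendsto (v := expSum (f z)) (fun k => ?_) (hr.tendsto_exp _))
  obtain ⟨l, M, h⟩ := hf k
  have := (hp.tendsto_exp z l).const_mul M
  rw [mul_zero] at this
  refine squeeze_zero (fun _ => apply_nonneg _ _) (fun n => ?_) this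
  refine le_trans (le_of_eq ?_) (h _)
  rw [map_sub f, map_expSum]; rfl

/-- A seminorm is dominated by a family of seminorms. -/
def Dominated (p : ℕ → Seminorm ℂ D) (q : Seminorm ℂ D) : Prop := ∃ l M, ∀ x, q x ≤ M * p l x

/-! ### Estimates for exponentials and factorization into exponentials -/

theorem Dominated.tendsto {p : ℕ → Seminorm ℂ D} {q : Seminorm ℂ D} (hq : Dominated p q)
    {v : ℕ → D} {a : D} (h : ∀ k, Tendsto (fun n => p k (v n - a)) atTop (𝓝 0)) :
    Tendsto (fun n => q (v n - a)) atTop (𝓝 0) := by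
  obtain ⟨l, M, hl⟩ := hq
  have := (h l).const_mul M
  rw [mul_zero] at this
  exact squeeze_zero (fun _ => apply_nonneg _ _) (fun n => hl _) this

/-- Lets an estimate pass to the limit for a seminorm outside the given family; this is needed for
the weighted seminorms, which vary with the element considered. -/
theorem Dominated.le_of_tendsto {p : ℕ → Seminorm ℂ D} {q : Seminorm ℂ D} (hq : Dominated p q)
    {v : ℕ → D} {a : D} (h : ∀ k, Tendsto (fun n => p k (v n - a)) atTop (𝓝 0)) {c : ℝ}
    (hc : ∀ᶠ n in atTop, q (v n) ≤ c) : q a ≤ c := by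
  have h' := (hq.tendsto h).const_add c
  rw [add_zero] at h'
  refine ge_of_tendsto h' (hc.mono fun n hn => ?_)
  calc q a = q (v n - (v n - a)) := by congr 1; abel
    _ ≤ q (v n) + q (v n - a) := map_sub_le_add _ _ _
    _ ≤ _ := by gcongr

/-- The terms of order at least two of the exponential series of `z` are compared with those of the
real series at `q z`. -/
theorem IsFM.exp_sub_le {p : ℕ → Seminorm ℂ D} (hp : IsFM p) {q : Seminorm ℂ D}
    (hq : ∀ x y, q (x * y) ≤ q x * q y) (hd : Dominated p q) (z : D) :
    q ((hp.exp z).val - z) ≤ Real.exp (q z) - 1 - q z := by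
  refine hd.le_of_tendsto (v := fun n => expSum z n - z) (fun k => ?_) ?_
  · simpa using hp.tendsto_exp z k
  · filter_upwards [eventually_ge_atTop 1] with N hN
    obtain ⟨N, rfl⟩ := Nat.exists_eq_add_of_le' hN
    have h1 : expSum z (N + 1) - z = ∑ n ∈ Finset.range N, expTerm z (n + 1) := by
      rw [expSum, Finset.sum_range_succ']; simp [expTerm]
    rw [h1]
    have h2 : ∑ n ∈ Finset.range (N + 2), q z ^ n / (n.factorial : ℝ) ≤ Real.exp (q z) :=
      Real.sum_le_exp_of_nonneg (apply_nonneg _ _) _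
    rw [Finset.sum_range_succ', Finset.sum_range_succ'] at h2
    simp only [zero_add, pow_one, Nat.factorial_one, Nat.cast_one, div_one, pow_zero,
      Nat.factorial_zero] at h2
    have h3 : q (∑ n ∈ Finset.range N, expTerm z (n + 1)) ≤
        ∑ n ∈ Finset.range N, q z ^ (n + 1 + 1) / ((n + 1 + 1).factorial : ℝ) := by
      refine (Finset.le_sum_of_subadditive q (map_zero q).le (map_add_le_add q) _ _).trans ?_
      exact Finset.sum_le_sum fun n _ => seminorm_expTerm_le hq z (n + 1)
    linarith

theorem IsFM.one_add_exp_le {p : ℕ → Seminorm ℂ D} (hp : IsFM p) {q : Seminorm ℂ D}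
    (hq : ∀ x y, q (x * y) ≤ q x * q y) (hd : Dominated p q) (z : D) :
    1 + q (hp.exp z).val ≤ Real.exp (q z) := by
  have h := hp.exp_sub_le hq hd z
  have h' : q (hp.exp z).val ≤ q ((hp.exp z).val - z) + q z := by
    calc q (hp.exp z).val = q (((hp.exp z).val - z) + z) := by congr 1; abel
      _ ≤ _ := map_add_le_add _ _ _
  linarith

/-- The error of the first order approximation of a small quasi-unit by an exponential. -/
theorem IsFM.exp_inv_mul_le {p : ℕ → Seminorm ℂ D} (hp : IsFM p) {q : Seminorm ℂ D}
    (hq : ∀ x y, q (x * y) ≤ q x * q y) (hd : Dominated p q) (x : QUnit D)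
    (hx : q x.val ≤ 1 / 6) : q ((hp.exp x.val)⁻¹ * x).val ≤ q x.val / 2 := by
  set a := q x.val with ha
  have a0 : 0 ≤ a := apply_nonneg _ _
  set r := (hp.exp (-x.val)).val + x.val with hr
  have hr' : q r ≤ a ^ 2 := by
    have h1 := hp.exp_sub_le hq hd (-x.val)
    rw [sub_neg_eq_add, map_neg_eq_map] at h1
    have h2 := Real.abs_exp_sub_one_sub_id_le (x := a) (by rw [abs_of_nonneg a0]; linarith)
    exact h1.trans ((le_abs_self _).trans h2)
  -- In the unitization this is `(1 - x + r)(1 + x) - 1`, where the linear terms cancel and `r` is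
  -- of second order.
  have e : ((hp.exp x.val)⁻¹ * x).val = r - x.val * x.val + r * x.val := by
    rw [QUnit.mul_val, QUnit.inv_val', hp.exp_inv, hr]; noncomm_ring
  rw [e]
  calc q (r - x.val * x.val + r * x.val) ≤ q r + q (x.val * x.val) + q (r * x.val) :=
        (map_add_le_add _ _ _).trans (add_le_add_left (map_sub_le_add _ _ _) _)
    _ ≤ a ^ 2 + a * a + a ^ 2 * a := by
        gcongr
        · exact hq _ _
        · exact (hq _ _).trans (mul_le_mul_of_nonneg_right hr' a0)
    -- For `a ≤ 1/6` one has `2 a + a ^ 2 ≤ 1/2`.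
    _ ≤ a / 2 := by nlinarith

/-- Finite products of exponentials. -/
def IsFM.expProd {p : ℕ → Seminorm ℂ D} (hp : IsFM p) (l : List D) : QUnit D :=
  (l.map hp.exp).prod

theorem IsFM.map_expProd {p : ℕ → Seminorm ℂ D} {r : ℕ → Seminorm ℂ E} (hp : IsFM p)
    (hr : IsFM r) (f : D →ₙₐ[ℂ] E) (hf : ∀ k, ∃ l M, ∀ x, r k (f x) ≤ M * p l x) (l : List D) :
    QUnit.map (f : D →ₙ+* E) (hp.expProd l) = hr.expProd (l.map f) := by
  simp only [IsFM.expProd, map_list_prod, List.map_map]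
  congr 1
  exact List.map_congr_left fun z _ => hp.map_exp hr f hf z

theorem one_add_mul_le {q : Seminorm ℂ D} (hq : ∀ x y, q (x * y) ≤ q x * q y) (x y : QUnit D) :
    1 + q (x * y).val ≤ (1 + q x.val) * (1 + q y.val) := by
  have h : q (x * y).val ≤ q x.val + q y.val + q x.val * q y.val :=
    (map_add_le_add _ _ _).trans (add_le_add (map_add_le_add _ _ _) (hq _ _))
  linarith

/-- From `inv = - val - val * inv`: the term `q val * q inv ≤ q inv / 2` is absorbed into the
left-hand side. -/
theorem inv_le_of_lt_one {q : Seminorm ℂ D} (hq : ∀ x y, q (x * y) ≤ q x * q y) (x : QUnit D)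
    (hx : q x.val ≤ 1 / 2) : q x.inv ≤ 2 * q x.val := by
  have e : x.inv = - x.val - x.val * x.inv := by
    have := x.val_inv
    rw [eq_sub_iff_add_eq, ← sub_eq_zero]
    rw [← this]; abel
  have h : q x.inv ≤ q x.val + q x.val * q x.inv := by
    conv_lhs => rw [e]
    refine (map_sub_le_add _ _ _).trans (add_le_add (by rw [map_neg_eq_map]) (hq _ _))
  have : q x.val * q x.inv ≤ 1 / 2 * q x.inv := mul_le_mul_of_nonneg_right hx (apply_nonneg _ _)
  linarith

theorem IsFM.one_add_expProd_le {p : ℕ → Seminorm ℂ D} (hp : IsFM p) {q : Seminorm ℂ D}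
    (hq : ∀ x y, q (x * y) ≤ q x * q y) (hd : Dominated p q) (l : List D) :
    1 + q (hp.expProd l).val ≤ Real.exp (l.map q).sum := by
  induction l with
  | nil => simp [IsFM.expProd]
  | cons z l ih =>
    have e : hp.expProd (z :: l) = hp.exp z * hp.expProd l := by simp [IsFM.expProd]
    rw [e, List.map_cons, List.sum_cons, Real.exp_add]
    refine (one_add_mul_le hq _ _).trans ?_
    exact mul_le_mul (hp.one_add_exp_le hq hd z) ih
      (add_nonneg zero_le_one (apply_nonneg _ _)) (Real.exp_nonneg _)

/-- Small quasi-units are approximated by finite products of exponentials. -/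
theorem IsFM.exists_expProd {p : ℕ → Seminorm ℂ D} (hp : IsFM p) {q r : Seminorm ℂ D}
    (hq : ∀ x y, q (x * y) ≤ q x * q y) (hqd : Dominated p q)
    (hr : ∀ x y, r (x * y) ≤ r x * r y) (hrd : Dominated p r) (N : ℕ) (x : QUnit D)
    (hqx : q x.val ≤ 1 / 6) (hrx : r x.val ≤ 1 / 6) :
    ∃ l : List D, q ((hp.expProd l)⁻¹ * x).val ≤ (1 / 2) ^ N ∧
      (l.map r).sum ≤ 2 * r x.val := by
  -- The error is kept proportional to `q x.val` for the induction. Dividing by `exp x.val` halves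
  -- both `q` and `r`, so the sum of the `r`-sizes of the exponents is at most the geometric series
  -- `r x.val * (1 + 1/2 + 1/4 + …)`.
  suffices H : ∀ (N : ℕ) (x : QUnit D), q x.val ≤ 1 / 6 → r x.val ≤ 1 / 6 →
      ∃ l : List D, q ((hp.expProd l)⁻¹ * x).val ≤ (1 / 2) ^ N * q x.val ∧
      (l.map r).sum ≤ 2 * r x.val by
    obtain ⟨l, h1, h2⟩ := H N x hqx hrx
    exact ⟨l, h1.trans (mul_le_of_le_one_right (by positivity) (by linarith)), h2⟩
  intro N
  induction N with
  | zero =>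
    intro x _ _
    exact ⟨[], by simp [IsFM.expProd], by simp⟩
  | succ N ih =>
    intro x hqx hrx
    have h1 := hp.exp_inv_mul_le hq hqd x hqx
    have h2 := hp.exp_inv_mul_le hr hrd x hrx
    have q0 : 0 ≤ q x.val := apply_nonneg _ _
    have r0 : 0 ≤ r x.val := apply_nonneg _ _
    obtain ⟨l, h3, h4⟩ := ih ((hp.exp x.val)⁻¹ * x) (by linarith) (by linarith)
    refine ⟨x.val :: l, ?_, ?_⟩
    · have e : hp.expProd (x.val :: l) = hp.exp x.val * hp.expProd l := by simp [IsFM.expProd]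
      rw [e, mul_inv_rev, mul_assoc]
      refine h3.trans ?_
      rw [pow_succ, mul_assoc]
      exact mul_le_mul_of_nonneg_left (by linarith) (by positivity)
    · rw [List.map_cons, List.sum_cons]
      linarith

end seminorms

section seminorms

variable {D E C : Type*} [NonUnitalRing D] [Module ℂ D] [IsScalarTower ℂ D D]
  [SMulCommClass ℂ D D] [NonUnitalRing E] [Module ℂ E] [IsScalarTower ℂ E E]
  [SMulCommClass ℂ E E] [NonUnitalRing C] [Module ℂ C] [IsScalarTower ℂ C C]
  [SMulCommClass ℂ C C]

/-! ### Continuity of the exponential -/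

/-- The factor `R ^ n / n!` is the derivative of `R ^ (n + 1) / (n + 1)!`, as the mean value theorem
would give. In the recursion the two summands contribute `1` and `n + 1` equal parts, which cancels
the denominator `n + 2`. -/
theorem seminorm_expTerm_sub_le {q : Seminorm ℂ D} (hq : ∀ x y, q (x * y) ≤ q x * q y) {z w : D}
    {R : ℝ} (hz : q z ≤ R) (hw : q w ≤ R) (n : ℕ) :
    q (expTerm z n - expTerm w n) ≤ q (z - w) * (R ^ n / n.factorial) := by
  have hR : 0 ≤ R := (apply_nonneg q z).trans hz
  induction n with
  | zero => simp [expTerm]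
  | succ n ih =>
    have e : expTerm z (n + 1) - expTerm w (n + 1) = ((n + 2 : ℕ) : ℂ)⁻¹ •
        ((z - w) * expTerm z n + w * (expTerm z n - expTerm w n)) := by
      rw [expTerm, expTerm, ← smul_sub]; congr 1; noncomm_ring
    rw [e, map_smul_eq_mul, norm_inv, Complex.norm_natCast]
    have h1 : q (expTerm z n) ≤ R ^ (n + 1) / (n + 1).factorial :=
      (seminorm_expTerm_le hq z n).trans (by gcongr)
    have h2 : q ((z - w) * expTerm z n + w * (expTerm z n - expTerm w n)) ≤
        q (z - w) * (R ^ (n + 1) / (n + 1).factorial) +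
          R * (q (z - w) * (R ^ n / n.factorial)) := by
      refine (map_add_le_add _ _ _).trans (add_le_add ((hq _ _).trans ?_) ((hq _ _).trans ?_))
      · exact mul_le_mul_of_nonneg_left h1 (apply_nonneg _ _)
      · exact mul_le_mul hw ih (apply_nonneg _ _) hR
    refine (mul_le_mul_of_nonneg_left h2 (by positivity)).trans (le_of_eq ?_)
    rw [Nat.factorial_succ]
    push_cast
    field_simp
    ring

theorem IsFM.exp_sub_exp_le {p : ℕ → Seminorm ℂ D} (hp : IsFM p) {q : Seminorm ℂ D}
    (hq : ∀ x y, q (x * y) ≤ q x * q y) (hd : Dominated p q) {z w : D} {R : ℝ}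
    (hz : q z ≤ R) (hw : q w ≤ R) :
    q ((hp.exp z).val - (hp.exp w).val) ≤ q (z - w) * Real.exp R := by
  have hR : 0 ≤ R := (apply_nonneg q z).trans hz
  refine hd.le_of_tendsto (v := fun n => expSum z n - expSum w n) (fun k => ?_)
    (Eventually.of_forall fun N => ?_)
  · have h := (hp.tendsto_exp z k).add (hp.tendsto_exp w k)
    rw [add_zero] at h
    refine squeeze_zero (fun _ => apply_nonneg _ _) (fun n => ?_) h
    rw [sub_sub_sub_comm]
    exact map_sub_le_add _ _ _
  · rw [expSum, expSum, ← Finset.sum_sub_distrib]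
    refine (Finset.le_sum_of_subadditive q (map_zero q).le (map_add_le_add q) _ _).trans ?_
    refine (Finset.sum_le_sum fun n _ => seminorm_expTerm_sub_le hq hz hw n).trans ?_
    rw [← Finset.mul_sum]
    exact mul_le_mul_of_nonneg_left (Real.sum_le_exp_of_nonneg hR N) (apply_nonneg _ _)

theorem seminorm_inv_mul_le {q : Seminorm ℂ D} (hq : ∀ x y, q (x * y) ≤ q x * q y)
    (x y : QUnit D) : q (x⁻¹ * y).val ≤ (1 + q x.inv) * q (y.val - x.val) := by
  rw [QUnit.inv_mul_val, add_mul, one_mul]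
  exact (map_add_le_add _ _ _).trans (add_le_add_right (hq _ _) _)

/-- In the unitization, `x⁻¹ y x - 1 = x⁻¹ (y - 1) x`. -/
theorem seminorm_conj_le {q : Seminorm ℂ D} (hq : ∀ x y, q (x * y) ≤ q x * q y)
    (x y : QUnit D) : q (x⁻¹ * y * x).val ≤ (1 + q x.inv) * q y.val * (1 + q x.val) := by
  have h : (x⁻¹ * y * x).val = (y.val + x.inv * y.val) + (y.val + x.inv * y.val) * x.val := by
    have h1 := x.inv_val
    have : (x⁻¹ * y * x).val = (y.val + x.inv * y.val) + (y.val + x.inv * y.val) * x.val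
        + (x.inv + x.val + x.inv * x.val) := by
      simp only [QUnit.mul_val, QUnit.inv_val']; noncomm_ring
    rw [this, h1, add_zero]
  have h2 : q (y.val + x.inv * y.val) ≤ (1 + q x.inv) * q y.val := by
    rw [add_mul, one_mul]
    exact (map_add_le_add _ _ _).trans (add_le_add_right (hq _ _) _)
  rw [h, mul_add, mul_one]
  refine (map_add_le_add _ _ _).trans (add_le_add h2 ((hq _ _).trans ?_))
  exact mul_le_mul_of_nonneg_right h2 (apply_nonneg _ _)

/-! ### Infinite products -/

/-- The product of the factors `1 + g n` is at most the exponential of the sum of the `g n`. -/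
theorem bounded_of_one_add_le {a g : ℕ → ℝ} (ha : ∀ n, 0 ≤ a n) (hg0 : ∀ n, 0 ≤ g n)
    (hg : Summable g) (h : ∀ n, 1 + a (n + 1) ≤ (1 + a n) * (1 + g n)) : ∃ B, ∀ n, 1 + a n ≤ B := by
  refine ⟨(1 + a 0) * Real.exp (∑' n, g n), fun n => ?_⟩
  have h1 : 1 + a n ≤ (1 + a 0) * Real.exp (∑ i ∈ Finset.range n, g i) := by
    induction n with
    | zero => simp
    | succ n ih =>
      rw [Finset.sum_range_succ, Real.exp_add, ← mul_assoc]
      refine (h n).trans (mul_le_mul ih ?_ (by linarith [hg0 n]) ?_)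
      · rw [add_comm]; exact Real.add_one_le_exp _
      · have := ha 0; positivity
  refine h1.trans (mul_le_mul_of_nonneg_left (Real.exp_le_exp.2 ?_) (by linarith [ha 0]))
  exact hg.sum_le_tsum _ fun i _ => hg0 i

/-- The partial products and their inverses are bounded for each seminorm, so the increments `Γ n *
G n` are summable along with `G n`. The inverses are treated in the same way, since the inverse of a
small factor is at most twice as large. -/
theorem IsFM.exists_limit_prod {p : ℕ → Seminorm ℂ D} (hp : IsFM p) (Γ G : ℕ → QUnit D)
    (hΓ : ∀ n, Γ (n + 1) = Γ n * G n) (hG : ∀ k, Summable fun n => p k (G n).val) :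
    ∃ x : QUnit D, ∀ k, Tendsto (fun n => p k ((Γ n).val - x.val)) atTop (𝓝 0) := by
  have hG' : ∀ k, Summable fun n => p k (G n).inv := by
    intro k
    refine Summable.of_norm_bounded_eventually_nat ((hG k).mul_left 2) ?_
    filter_upwards [(hG k).tendsto_atTop_zero.eventually_lt_const (by norm_num : (0 : ℝ) < 1 / 2)]
      with n hn
    rw [Real.norm_of_nonneg (apply_nonneg _ _)]
    exact inv_le_of_lt_one (hp.mul_le k) _ hn.le
  have b1 : ∀ k, ∃ B, ∀ n, 1 + p k (Γ n).val ≤ B := fun k =>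
    bounded_of_one_add_le (fun n => apply_nonneg _ _) (fun n => apply_nonneg _ _) (hG k)
      fun n => by rw [hΓ]; exact one_add_mul_le (hp.mul_le k) _ _
  have b2 : ∀ k, ∃ B, ∀ n, 1 + p k (Γ n).inv ≤ B := fun k =>
    bounded_of_one_add_le (fun n => apply_nonneg _ _) (fun n => apply_nonneg _ _) (hG' k)
      fun n => by
        rw [hΓ, mul_comm]
        exact one_add_mul_le (hp.mul_le k) (G n)⁻¹ (Γ n)⁻¹
  obtain ⟨x, hx, -⟩ := hp.exists_qunit (fun n => (Γ n).val) (fun n => (Γ n).inv) (fun k => by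
      obtain ⟨B, hB⟩ := b1 k
      refine Summable.of_nonneg_of_le (fun _ => apply_nonneg _ _) (fun n => ?_)
        ((hG k).mul_left B)
      have e : (Γ (n + 1)).val - (Γ n).val = (G n).val + (Γ n).val * (G n).val := by
        rw [hΓ, QUnit.mul_val]; abel
      rw [e]
      refine le_trans ?_ (mul_le_mul_of_nonneg_right (hB n) (apply_nonneg _ _))
      rw [add_mul, one_mul]
      exact (map_add_le_add _ _ _).trans (add_le_add_right (hp.mul_le k _ _) _)) (fun k => by
      obtain ⟨B, hB⟩ := b2 k
      refine Summable.of_nonneg_of_le (fun _ => apply_nonneg _ _) (fun n => ?_)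
        ((hG' k).mul_left B)
      have e : (Γ (n + 1)).inv - (Γ n).inv = (G n).inv + (G n).inv * (Γ n).inv := by
        rw [hΓ]
        change (G n).inv + (Γ n).inv + (G n).inv * (Γ n).inv - (Γ n).inv = _
        abel
      rw [e]
      refine le_trans ?_ (mul_le_mul_of_nonneg_right (hB n) (apply_nonneg _ _))
      rw [add_mul, one_mul]
      refine (map_add_le_add _ _ _).trans (add_le_add_right ((hp.mul_le k _ _).trans ?_) _)
      rw [mul_comm])
    (fun k => by simp [QUnit.val_inv]) (fun k => by simp [QUnit.inv_val])
  exact ⟨x, hx⟩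

/-! ### Comparison of endpoint maps -/

/-- Two path algebras `D → E` over `C`, of which `D` has finer seminorms. -/
structure PathComparison (d : ℕ → Seminorm ℂ D) (e : ℕ → Seminorm ℂ E) (c : ℕ → Seminorm ℂ C)
    (j : D →ₙₐ[ℂ] E) (ev : E →ₙₐ[ℂ] C) : Prop where
  fm_d : IsFM d
  fm_e : IsFM e
  fm_c : IsFM c
  j_le : ∀ k, ∃ l M, ∀ x, e k (j x) ≤ M * d l x
  ev_le : ∀ k x, c k (ev x) ≤ e k x
  dense : ∀ (y : E) (l : ℕ) (ε : ℝ), 0 < ε → ∃ x : D, e l (j x - y) < ε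
  -- For smooth paths `q` is obtained by giving the derivatives small weights. It depends on `x`,
  -- and the constant `M` is not controlled.
  scale : ∀ (k : ℕ) (x : D) (r : ℝ), e k (j x) < r → ∃ q : Seminorm ℂ D,
    (∀ x y, q (x * y) ≤ q x * q y) ∧ Dominated d q ∧ q x ≤ r ∧ ∃ M, 0 ≤ M ∧ ∀ y, d k y ≤ M * q y
  -- For paths `σ a` is the straight path `t ↦ t a`, whose `C^k`-seminorms are controlled by its
  -- endpoint.
  section_ : ∃ σ : C → D, (∀ a, ev (j (σ a)) = a) ∧ ∀ k, ∃ M, 0 ≤ M ∧ ∀ a, d k (σ a) ≤ M * c k a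
  -- A connectedness property: paths starting at `0` can be contracted.
  gen : ∀ (l : ℕ) (f : QUnit E), f ∈ Subgroup.closure {g : QUnit E | e l g.val < 1 / 6}

namespace PathComparison

variable {d : ℕ → Seminorm ℂ D} {e : ℕ → Seminorm ℂ E} {c : ℕ → Seminorm ℂ C}
  {j : D →ₙₐ[ℂ] E} {ev : E →ₙₐ[ℂ] C} (H : PathComparison d e c j ev)

/-! ### Approximation by quasi-units of the finer algebra -/

include H

/-- Density is applied to the exponent and not to the quasi-unit: an element of `D` close to a
quasi-unit need not, a priori, be a quasi-unit, whereas the exponential of an element of `D` always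
is one. -/
theorem exp_approx (l : ℕ) (z : E) (ε : ℝ) (hε : 0 < ε) :
    ∃ γ : QUnit D, e l ((QUnit.map (j : D →ₙ+* E) γ)⁻¹ * H.fm_e.exp z).val < ε := by
  set R := e l z + 1 with hR
  have hR0 : 0 < R := by have := apply_nonneg (e l) z; linarith
  -- One factor `exp R` bounds the inverse of `exp (j x)`, the other is the Lipschitz constant of
  -- the exponential; the minimum with `1` keeps `j x` in the ball of radius `R`.
  obtain ⟨x, hx⟩ := H.dense z l (min 1 (ε / (2 * (Real.exp R * Real.exp R))))
    (lt_min one_pos (by positivity))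
  have hdom : Dominated e (e l) := ⟨l, 1, fun x => by rw [one_mul]⟩
  have hjx : e l (j x) ≤ R := by
    calc e l (j x) = e l ((j x - z) + z) := by congr 1; abel
      _ ≤ e l (j x - z) + e l z := map_add_le_add _ _ _
      _ ≤ R := by linarith [min_le_left 1 (ε / (2 * (Real.exp R * Real.exp R)))]
  refine ⟨H.fm_d.exp x, ?_⟩
  rw [H.fm_d.map_exp H.fm_e j H.j_le]
  refine (seminorm_inv_mul_le (H.fm_e.mul_le l) _ _).trans_lt ?_
  have h1 : 1 + e l (H.fm_e.exp (j x)).inv ≤ Real.exp R := by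
    rw [H.fm_e.exp_inv]
    refine (H.fm_e.one_add_exp_le (H.fm_e.mul_le l) hdom _).trans (Real.exp_le_exp.2 ?_)
    rwa [map_neg_eq_map]
  have h2 := H.fm_e.exp_sub_exp_le (H.fm_e.mul_le l) hdom (z := z) (w := j x) (R := R)
    (by linarith) hjx
  have h3 : e l (z - j x) ≤ ε / (2 * (Real.exp R * Real.exp R)) := by
    rw [map_sub_rev]; exact hx.le.trans (min_le_right _ _)
  calc (1 + e l (H.fm_e.exp (j x)).inv) * e l ((H.fm_e.exp z).val - (H.fm_e.exp (j x)).val)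
      ≤ Real.exp R * (ε / (2 * (Real.exp R * Real.exp R)) * Real.exp R) := by
        refine mul_le_mul h1 (h2.trans ?_) (apply_nonneg _ _) (Real.exp_nonneg _)
        exact mul_le_mul_of_nonneg_right h3 (Real.exp_nonneg _)
    _ = ε / 2 := by field_simp
    _ < ε := half_lt_self hε

/-- The factor `g` is approximated first. The error of `f` gets conjugated by the approximant `h` of
`g`, so the precision required for `f` depends on `h`. -/
theorem approx_mul {l : ℕ} {f g : QUnit E}
    (hf : ∀ ε : ℝ, 0 < ε → ∃ γ : QUnit D, e l ((QUnit.map (j : D →ₙ+* E) γ)⁻¹ * f).val < ε)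
    (hg : ∀ ε : ℝ, 0 < ε → ∃ γ : QUnit D, e l ((QUnit.map (j : D →ₙ+* E) γ)⁻¹ * g).val < ε)
    (ε : ℝ) (hε : 0 < ε) :
    ∃ γ : QUnit D, e l ((QUnit.map (j : D →ₙ+* E) γ)⁻¹ * (f * g)).val < ε := by
  obtain ⟨η, hη⟩ := hg (min 1 (ε / 4)) (lt_min one_pos (by linarith))
  set h := QUnit.map (j : D →ₙ+* E) η with hh
  have hpos : 0 < (1 + e l h.inv) * (1 + e l h.val) := by
    have h1 := apply_nonneg (e l) h.inv
    have h2 := apply_nonneg (e l) h.val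
    positivity
  obtain ⟨γ, hγ⟩ := hf (ε / (4 * ((1 + e l h.inv) * (1 + e l h.val)))) (by positivity)
  set a := (QUnit.map (j : D →ₙ+* E) γ)⁻¹ * f with ha
  refine ⟨γ * η, ?_⟩
  have e1 : (QUnit.map (j : D →ₙ+* E) (γ * η))⁻¹ * (f * g) = (h⁻¹ * a * h) * (h⁻¹ * g) := by
    rw [map_mul, ha, hh]; group
  have h1 := seminorm_conj_le (H.fm_e.mul_le l) h a
  have h2 : e l (h⁻¹ * a * h).val ≤ ε / 4 := by
    refine h1.trans ?_
    calc (1 + e l h.inv) * e l a.val * (1 + e l h.val)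
        = e l a.val * ((1 + e l h.inv) * (1 + e l h.val)) := by ring
      _ ≤ ε / (4 * ((1 + e l h.inv) * (1 + e l h.val))) * ((1 + e l h.inv) * (1 + e l h.val)) :=
          mul_le_mul_of_nonneg_right hγ.le hpos.le
      _ = ε / 4 := by field_simp
  have h3 := one_add_mul_le (H.fm_e.mul_le l) (h⁻¹ * a * h) (h⁻¹ * g)
  rw [e1]
  have h4 : e l (h⁻¹ * g).val < 1 := hη.trans_le (min_le_left _ _)
  have h5 : e l (h⁻¹ * g).val < ε / 4 := hη.trans_le (min_le_right _ _)
  have h6 := apply_nonneg (e l) (h⁻¹ * a * h).val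
  nlinarith

/-- If `a` is the error of `f`, then the error of `f⁻¹` is the conjugate `f a⁻¹ f⁻¹`. -/
theorem approx_inv {l : ℕ} {f : QUnit E}
    (hf : ∀ ε : ℝ, 0 < ε → ∃ γ : QUnit D, e l ((QUnit.map (j : D →ₙ+* E) γ)⁻¹ * f).val < ε)
    (ε : ℝ) (hε : 0 < ε) :
    ∃ γ : QUnit D, e l ((QUnit.map (j : D →ₙ+* E) γ)⁻¹ * f⁻¹).val < ε := by
  have hpos : 0 < (1 + e l f.val) * (1 + e l f.inv) := by
    have h1 := apply_nonneg (e l) f.inv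
    have h2 := apply_nonneg (e l) f.val
    positivity
  obtain ⟨γ, hγ⟩ := hf (min (1 / 2) (ε / (4 * ((1 + e l f.val) * (1 + e l f.inv)))))
    (lt_min (by norm_num) (by positivity))
  set a := (QUnit.map (j : D →ₙ+* E) γ)⁻¹ * f with ha
  refine ⟨γ⁻¹, ?_⟩
  have e1 : (QUnit.map (j : D →ₙ+* E) γ⁻¹)⁻¹ * f⁻¹ = (f⁻¹)⁻¹ * a⁻¹ * f⁻¹ := by
    rw [map_inv, ha]; group
  rw [e1]
  have h1 : e l (a⁻¹).val ≤ 2 * e l a.val :=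
    inv_le_of_lt_one (H.fm_e.mul_le l) a (hγ.le.trans (min_le_left _ _))
  have h2 : e l a.val < ε / (4 * ((1 + e l f.val) * (1 + e l f.inv))) :=
    hγ.trans_le (min_le_right _ _)
  refine (seminorm_conj_le (H.fm_e.mul_le l) f⁻¹ a⁻¹).trans_lt ?_
  rw [QUnit.inv_inv', QUnit.inv_val' f]
  calc (1 + e l f.val) * e l (a⁻¹).val * (1 + e l f.inv)
      = e l (a⁻¹).val * ((1 + e l f.val) * (1 + e l f.inv)) := by ring
    _ ≤ 2 * (ε / (4 * ((1 + e l f.val) * (1 + e l f.inv)))) *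
        ((1 + e l f.val) * (1 + e l f.inv)) :=
        mul_le_mul_of_nonneg_right (h1.trans (by linarith)) hpos.le
    _ = ε / 2 := by field_simp; norm_num
    _ < ε := half_lt_self hε

/-- Every quasi-unit of `E` is approximated by quasi-units of `D`. -/
theorem approx (l : ℕ) (f : QUnit E) : ∀ ε : ℝ, 0 < ε →
    ∃ γ : QUnit D, e l ((QUnit.map (j : D →ₙ+* E) γ)⁻¹ * f).val < ε := by
  have hdom : Dominated e (e l) := ⟨l, 1, fun x => by rw [one_mul]⟩
  have h1 : ∀ ε : ℝ, 0 < ε →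
      ∃ γ : QUnit D, e l ((QUnit.map (j : D →ₙ+* E) γ)⁻¹ * 1).val < ε :=
    fun ε hε => ⟨1, by simpa using hε⟩
  -- The approximable quasi-units form a subgroup, so by `gen` only a quasi-unit near the identity
  -- has to be treated; it is nearly a finite product of exponentials.
  refine Subgroup.closure_induction (fun g hg ε hε => ?_) h1
    (fun f g _ _ hf hg => H.approx_mul hf hg) (fun f _ hf => H.approx_inv hf) (H.gen l f)
  obtain ⟨N, hN⟩ := exists_pow_lt_of_lt_one (half_pos hε) (by norm_num : (1 / 2 : ℝ) < 1)
  obtain ⟨L, hL, -⟩ := H.fm_e.exists_expProd (H.fm_e.mul_le l) hdom (H.fm_e.mul_le l) hdom N g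
    (le_of_lt hg) (le_of_lt hg)
  have hP : ∀ ε : ℝ, 0 < ε →
      ∃ γ : QUnit D, e l ((QUnit.map (j : D →ₙ+* E) γ)⁻¹ * H.fm_e.expProd L).val < ε := by
    clear hL
    induction L with
    | nil => exact h1
    | cons z L ih =>
      have : H.fm_e.expProd (z :: L) = H.fm_e.exp z * H.fm_e.expProd L := by simp [IsFM.expProd]
      rw [this]
      exact H.approx_mul (H.exp_approx l z) ih
  obtain ⟨γ, hγ⟩ := hP (min 1 (ε / 4)) (lt_min one_pos (by linarith))
  refine ⟨γ, ?_⟩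
  have e1 : (QUnit.map (j : D →ₙ+* E) γ)⁻¹ * g =
    ((QUnit.map (j : D →ₙ+* E) γ)⁻¹ * H.fm_e.expProd L) * ((H.fm_e.expProd L)⁻¹ * g) := by group
  rw [e1]
  have h3 := one_add_mul_le (H.fm_e.mul_le l)
    ((QUnit.map (j : D →ₙ+* E) γ)⁻¹ * H.fm_e.expProd L) ((H.fm_e.expProd L)⁻¹ * g)
  have h4 := hγ.trans_le (min_le_left _ _)
  have h5 := hγ.trans_le (min_le_right _ _)
  have h6 : e l ((H.fm_e.expProd L)⁻¹ * g).val < ε / 2 := hL.trans_lt hN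
  have h7 := apply_nonneg (e l) ((H.fm_e.expProd L)⁻¹ * g).val
  have h8 := hL.trans (pow_le_one₀ (by norm_num) (by norm_num))
  nlinarith

/-- Near the identity the endpoint map is almost open. -/
theorem almost_open (k : ℕ) (δ : ℝ) (hδ : 0 < δ) (hδ1 : δ ≤ 1) : ∃ ε : ℝ, 0 < ε ∧
    ∀ f : QUnit E, e k f.val < ε → ∀ (l : ℕ) (ε' : ℝ), 0 < ε' → ∃ (γ : QUnit D) (f' : QUnit E),
      d k γ.val < δ ∧ e l f'.val < ε' ∧ QUnit.map (ev : E →ₙ+* C) f =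
        QUnit.map (ev : E →ₙ+* C) (QUnit.map (j : D →ₙ+* E) γ) *
          QUnit.map (ev : E →ₙ+* C) f' := by
  obtain ⟨σ, hσ, hσM⟩ := H.section_
  obtain ⟨M, hM0, hM⟩ := hσM k
  -- The exponents found below have total size at most `2 * η` for `e k`, hence at most `M * (2 *
  -- η)` for `d k` after being straightened. The denominator `M + 1` allows for `M = 0`.
  obtain ⟨η, hη0, hη1, hη⟩ : ∃ η : ℝ, 0 < η ∧ η ≤ 1 / 6 ∧ Real.exp (M * (2 * η)) ≤ 1 + δ / 3 := by
    refine ⟨min (1 / 6) (Real.log (1 + δ / 3) / (2 * (M + 1))), lt_min (by norm_num) ?_,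
      min_le_left _ _, ?_⟩
    · exact div_pos (Real.log_pos (by linarith)) (by linarith)
    · rw [← Real.le_log_iff_exp_le (by linarith)]
      have h1 : 0 < Real.log (1 + δ / 3) := Real.log_pos (by linarith)
      calc M * (2 * min (1 / 6) (Real.log (1 + δ / 3) / (2 * (M + 1))))
          ≤ M * (2 * (Real.log (1 + δ / 3) / (2 * (M + 1)))) := by
            gcongr; exact min_le_right _ _
        _ = Real.log (1 + δ / 3) * (M / (M + 1)) := by field_simp
        _ ≤ Real.log (1 + δ / 3) * 1 := by
            gcongr; rw [div_le_one (by linarith)]; linarith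
        _ = _ := mul_one _
  -- With `f` and `g` both below `η / 8`, the product `f * g⁻¹` stays below `η`.
  refine ⟨η / 8, by linarith, fun f hf l ε' hε' => ?_⟩
  -- One approximation at level `max k l` serves two purposes: the remainder `g` is small at the
  -- prescribed level `l`, and `γ₀` is small for `e k`.
  obtain ⟨γ₀, hγ₀⟩ := H.approx (max k l) f (min ε' (η / 8)) (lt_min hε' (by linarith))
  set g := (QUnit.map (j : D →ₙ+* E) γ₀)⁻¹ * f with hg
  have hgk : e k g.val < η / 8 :=
    (H.fm_e.mono (le_max_left k l) _).trans_lt (hγ₀.trans_le (min_le_right _ _))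
  have hgl : e l g.val < ε' :=
    (H.fm_e.mono (le_max_right k l) _).trans_lt (hγ₀.trans_le (min_le_left _ _))
  have hjk : e k (j γ₀.val) < η := by
    have e1 : QUnit.map (j : D →ₙ+* E) γ₀ = f * g⁻¹ := by rw [hg]; group
    have h1 := one_add_mul_le (H.fm_e.mul_le k) f g⁻¹
    rw [← e1] at h1
    have h2 : e k (g⁻¹).val ≤ 2 * e k g.val :=
      inv_le_of_lt_one (H.fm_e.mul_le k) g (by linarith)
    have h3 : e k (QUnit.map (j : D →ₙ+* E) γ₀).val = e k (j γ₀.val) := rfl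
    have h4 := apply_nonneg (e k) f.val
    have h5 := apply_nonneg (e k) g.val
    rw [h3] at h1
    nlinarith
  -- So far `γ₀` is small only for the coarse seminorm `e k`; its size for `d k` is unknown. It is
  -- nevertheless small for the rescaled seminorm `q`, which dominates `d k` up to the constant
  -- `M₁`.
  obtain ⟨q, hqm, hqd, hqx, M₁, hM₁0, hM₁⟩ := H.scale k γ₀.val η hjk
  set r : Seminorm ℂ D := (e k).comp (j : D →ₗ[ℂ] E) with hr
  have hr' : ∀ x, r x = e k (j x) := fun x => rfl
  have hrm : ∀ x y, r (x * y) ≤ r x * r y := fun x y => by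
    rw [hr', map_mul]; exact H.fm_e.mul_le k _ _
  -- Chosen after `M₁`, which is the price for passing from `q` to `d k`.
  obtain ⟨N, hN⟩ : ∃ N : ℕ, M₁ * (1 / 2) ^ N < δ / 3 := by
    have : Tendsto (fun N : ℕ => M₁ * (1 / 2 : ℝ) ^ N) atTop (𝓝 (M₁ * 0)) :=
      (tendsto_pow_atTop_nhds_zero_of_lt_one (by norm_num) (by norm_num)).const_mul M₁
    rw [mul_zero] at this
    exact (this.eventually_lt_const (by linarith)).exists
  -- Here `q` measures the error of the factorization, and `r`, the pullback of `e k`, measures the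
  -- exponents.
  obtain ⟨L, hL, hLr⟩ := H.fm_d.exists_expProd hqm hqd hrm (H.j_le k) N γ₀ (hqx.trans hη1)
    (hjk.le.trans hη1)
  set w := H.fm_d.expProd L with hw
  -- Each exponent is replaced by the section applied to its endpoint. Thus `w'` and `w` have the
  -- same endpoint, but `w'` is small for `d k`, because the endpoints are bounded by the `r`-sizes
  -- of the exponents.
  set w' := H.fm_d.expProd (L.map fun z => σ (ev (j z))) with hw'
  have hdom : Dominated d (d k) := ⟨k, 1, fun x => by rw [one_mul]⟩
  have hevj : ∀ m, ∃ l M, ∀ x, c m ((ev.comp j) x) ≤ M * d l x := fun m => by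
    obtain ⟨l, M, h⟩ := H.j_le m
    exact ⟨l, M, fun x => (H.ev_le m _).trans (h x)⟩
  have hww : QUnit.map ((ev.comp j : D →ₙₐ[ℂ] C) : D →ₙ+* C) w' =
      QUnit.map ((ev.comp j : D →ₙₐ[ℂ] C) : D →ₙ+* C) w := by
    rw [hw, hw', H.fm_d.map_expProd H.fm_c _ hevj, H.fm_d.map_expProd H.fm_c _ hevj, List.map_map]
    congr 1
    exact List.map_congr_left fun z _ => hσ _
  have hmap : ∀ x : QUnit D, QUnit.map (ev : E →ₙ+* C) (QUnit.map (j : D →ₙ+* E) x) =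
    QUnit.map ((ev.comp j : D →ₙₐ[ℂ] C) : D →ₙ+* C) x := fun x => rfl
  refine ⟨w' * (w⁻¹ * γ₀), g, ?_, hgl, ?_⟩
  · have h1 := one_add_mul_le (H.fm_d.mul_le k) w' (w⁻¹ * γ₀)
    have h2 : 1 + d k w'.val ≤ 1 + δ / 3 := by
      refine (H.fm_d.one_add_expProd_le (H.fm_d.mul_le k) hdom _).trans (le_trans ?_ hη)
      rw [Real.exp_le_exp, List.map_map]
      have h3 : (L.map (d k ∘ fun z => σ (ev (j z)))).sum ≤ (L.map fun z => M * r z).sum := by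
        refine List.sum_le_sum fun z _ => ?_
        exact (hM _).trans (mul_le_mul_of_nonneg_left (H.ev_le k _) hM0)
      refine h3.trans ?_
      rw [List.sum_map_mul_left]
      refine mul_le_mul_of_nonneg_left (hLr.trans ?_) hM0
      rw [hr']; linarith
    have h3 : d k (w⁻¹ * γ₀).val < δ / 3 := by
      refine (hM₁ _).trans_lt (lt_of_le_of_lt ?_ hN)
      exact mul_le_mul_of_nonneg_left hL hM₁0
    have h4 := apply_nonneg (d k) (w⁻¹ * γ₀).val
    nlinarith
  · rw [hmap, map_mul, map_mul, map_inv, hww, mul_inv_cancel_left, ← hmap, ← map_mul]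
    congr 1
    rw [hg]; group

/-- The endpoint maps of `D` and of `E` have the same image on quasi-units. -/
theorem exists_lift (f : QUnit E) : ∃ γ : QUnit D,
    QUnit.map (ev : E →ₙ+* C) (QUnit.map (j : D →ₙ+* E) γ) = QUnit.map (ev : E →ₙ+* C) f := by
  have hδ : ∀ k : ℕ, (0 : ℝ) < (1 / 2) ^ k := fun k => by positivity
  have hδ1 : ∀ k : ℕ, ((1 / 2) ^ k : ℝ) ≤ 1 := fun k => pow_le_one₀ (by norm_num) (by norm_num)
  choose ε hε0 hε using fun k : ℕ => H.almost_open k ((1 / 2) ^ k) (hδ k) (hδ1 k)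
  -- The remainder is made small at the next level, so that the next stage applies to it; the bound
  -- `(1 / 2) ^ n` forces the endpoints of the remainders to tend to `1`.
  have step : ∀ (n : ℕ) (f : QUnit E), e n f.val < ε n → ∃ (γ : QUnit D) (f' : QUnit E),
      d n γ.val < (1 / 2) ^ n ∧ e (n + 1) f'.val < min (ε (n + 1)) ((1 / 2) ^ n) ∧
      QUnit.map (ev : E →ₙ+* C) f = QUnit.map (ev : E →ₙ+* C) (QUnit.map (j : D →ₙ+* E) γ) *
          QUnit.map (ev : E →ₙ+* C) f' := fun n f hf =>
    hε n f hf (n + 1) _ (lt_min (hε0 _) (hδ _))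
  choose! γ f' h1 h2 h3 using step
  obtain ⟨γ₀, hγ₀⟩ := H.approx 0 f (ε 0) (hε0 0)
  let F : ℕ → QUnit E := fun n =>
    Nat.rec ((QUnit.map (j : D →ₙ+* E) γ₀)⁻¹ * f) (fun n g => f' n g) n
  have hF : ∀ n, e n (F n).val < ε n := by
    intro n
    induction n with
    | zero => exact hγ₀
    | succ n ih => exact (h2 n _ ih).trans_le (min_le_left _ _)
  let G : ℕ → QUnit D := fun n => γ n (F n)
  let Γ : ℕ → QUnit D := fun n => Nat.rec γ₀ (fun n x => x * G n) n
  -- For fixed `k` the bound at level `n` also holds at level `k` as soon as `n ≥ k`.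
  have hG : ∀ k, Summable fun n => d k (G n).val := by
    intro k
    refine Summable.of_norm_bounded_eventually_nat summable_geometric_two ?_
    filter_upwards [eventually_ge_atTop k] with n hn
    rw [Real.norm_of_nonneg (apply_nonneg _ _)]
    exact (H.fm_d.mono hn _).trans (h1 n _ (hF n)).le
  obtain ⟨x, hx⟩ := H.fm_d.exists_limit_prod Γ G (fun n => rfl) hG
  refine ⟨x, QUnit.ext_val (Eq.symm ?_)⟩
  -- The invariant of the construction: the endpoint of `f` is that of `Γ n` times that of the
  -- remainder `F n`. Letting `n` tend to infinity identifies it with the endpoint of the infinite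
  -- product.
  have hprod : ∀ n, QUnit.map (ev : E →ₙ+* C) f =
      QUnit.map (ev : E →ₙ+* C) (QUnit.map (j : D →ₙ+* E) (Γ n)) *
        QUnit.map (ev : E →ₙ+* C) (F n) := by
    intro n
    induction n with
    | zero =>
      change _ = QUnit.map _ (QUnit.map _ γ₀) *
        QUnit.map _ ((QUnit.map (j : D →ₙ+* E) γ₀)⁻¹ * f)
      rw [← map_mul]; congr 1; group
    | succ n ih =>
      change _ = QUnit.map _ (QUnit.map _ (Γ n * G n)) * _
      rw [ih, h3 n (F n) (hF n), map_mul, map_mul, mul_assoc]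
  have hb : ∀ k, Tendsto (fun n => c k (ev (F n).val - 0)) atTop (𝓝 0) := by
    intro k
    rw [← tendsto_add_atTop_iff_nat 1]
    refine squeeze_zero' (Eventually.of_forall fun _ => apply_nonneg _ _) ?_
      (tendsto_pow_atTop_nhds_zero_of_lt_one (by norm_num) (by norm_num : (1 / 2 : ℝ) < 1))
    filter_upwards [eventually_ge_atTop k] with n hn
    rw [sub_zero]
    exact ((H.ev_le k _).trans (H.fm_e.mono (hn.trans (Nat.le_succ n)) _)).trans
      ((h2 n _ (hF n)).le.trans (min_le_right _ _))
  have ha : ∀ k, Tendsto (fun n => c k (ev (j (Γ n).val) - ev (j x.val))) atTop (𝓝 0) := by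
    intro k
    obtain ⟨l, M, hM⟩ := H.j_le k
    have := (hx l).const_mul M
    rw [mul_zero] at this
    refine squeeze_zero (fun _ => apply_nonneg _ _) (fun n => ?_) this
    rw [← map_sub ev, ← map_sub j]
    exact (H.ev_le k _).trans (hM _)
  have hc : ∀ k, Tendsto (fun n => c k ((ev (j (Γ n).val) + ev (F n).val +
      ev (j (Γ n).val) * ev (F n).val) - (ev (j x.val) + 0 + ev (j x.val) * 0))) atTop (𝓝 0) :=
    fun k => tendsto_add_of_seminorm (tendsto_add_of_seminorm (ha k) (hb k))
      (H.fm_c.tendsto_mul ha hb k)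
  have : ev f.val = ev (j x.val) + 0 + ev (j x.val) * 0 := by
    refine H.fm_c.eq_of_tendsto (fun k => ?_) hc
    refine tendsto_const_nhds.congr fun n => ?_
    have := congrArg QUnit.val (hprod n)
    change ev f.val = ev (j (Γ n).val) + ev (F n).val + ev (j (Γ n).val) * ev (F n).val at this
    rw [← this, sub_self, map_zero]
  have h : ev f.val = ev (j x.val) := by rw [this, mul_zero, add_zero, add_zero]
  exact h

end PathComparison

end seminorms

namespace LCAlg

/-! ### Algebras whose topology is given by a complete sequence of submultiplicative seminorms -/

/-- The topology of `A` is given by the complete increasing sequence `p` of submultiplicative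
seminorms. -/
structure FMWith (A : LCAlg.{u}) (p : ℕ → Seminorm ℂ A) : Prop extends IsFM p where
  nhds_eq : 𝓝 (0 : A) = ⨅ k, comap (p k) (𝓝 0)

variable {A B : LCAlg.{u}} {p : ℕ → Seminorm ℂ A} {q : ℕ → Seminorm ℂ B}

theorem tendsto_iff_of_nhds_eq (hp : 𝓝 (0 : A) = ⨅ k, comap (p k) (𝓝 0)) {X : Type*}
    {l : Filter X} {f : X → A} {a : A} :
    Tendsto f l (𝓝 a) ↔ ∀ k, Tendsto (fun x => p k (f x - a)) l (𝓝 0) := by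
  rw [← tendsto_sub_nhds_zero_iff, hp, tendsto_iInf]
  simp only [tendsto_comap_iff]
  rfl

theorem FMWith.tendsto_iff (hp : FMWith A p) {X : Type*} {l : Filter X} {f : X → A} {a : A} :
    Tendsto f l (𝓝 a) ↔ ∀ k, Tendsto (fun x => p k (f x - a)) l (𝓝 0) :=
  tendsto_iff_of_nhds_eq hp.nhds_eq

theorem continuous_of_nhds_eq (hp : 𝓝 (0 : A) = ⨅ k, comap (p k) (𝓝 0)) (k : ℕ) :
    Continuous (p k) := by
  refine Seminorm.continuous_of_continuousAt_zero ?_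
  rw [ContinuousAt, map_zero, hp]
  exact tendsto_comap.mono_left (iInf_le _ k)

theorem FMWith.continuous (hp : FMWith A p) (k : ℕ) : Continuous (p k) :=
  continuous_of_nhds_eq hp.nhds_eq k

/-- As the sequence is increasing, a finite supremum of its members is dominated by a single one. -/
theorem FMWith.exists_ball (hp : FMWith A p) {U : Set A} (hU : U ∈ 𝓝 (0 : A)) :
    ∃ k, ∃ ε : ℝ, 0 < ε ∧ {a | p k a < ε} ⊆ U := by
  have hw : WithSeminorms p := (SeminormFamily.withSeminorms_iff_nhds_eq_iInf p).2 hp.nhds_eq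
  obtain ⟨s, r, hr, h⟩ := (hw.mem_nhds_iff 0 U).1 hU
  refine ⟨s.sup id, r, hr, fun a ha => h ?_⟩
  rw [Seminorm.mem_ball, sub_zero]
  exact Seminorm.finset_sup_apply_lt hr fun i hi =>
    (hp.mono (Finset.le_sup (f := id) hi) a).trans_lt ha

/-- The suprema of initial segments of the family define the same topology, are increasing and
remain submultiplicative. Summable increments make a sequence Cauchy, since `P k (v n - v m)` is
bounded by the distance of partial sums of a convergent series. -/
theorem IsFrechetMichael.exists_fmWith (hA : A.IsFrechetMichael) :
    ∃ p : ℕ → Seminorm ℂ A, FMWith A p := by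
  obtain ⟨hcomp, p, hp, hmul⟩ := hA
  have hP := hp.partial_sups
  set P : SeminormFamily ℂ A ℕ := fun i => (Finset.Iic i).sup p with hPdef
  have hnhds : 𝓝 (0 : A) = ⨅ k, comap (P k) (𝓝 0) :=
    (SeminormFamily.withSeminorms_iff_nhds_eq_iInf P).1 hP
  have hle : ∀ {i k}, i ≤ k → p i ≤ P k := fun h => Finset.le_sup (f := p) (Finset.mem_Iic.2 h)
  have hmono : ∀ {k l}, k ≤ l → ∀ x, P k x ≤ P l x := fun h x =>
    Seminorm.finset_sup_apply_le (apply_nonneg _ _) fun i hi =>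
      hle ((Finset.mem_Iic.1 hi).trans h) x
  refine ⟨P, ⟨hmono, fun k x y => ?_, fun x hx => ?_, fun v hv => ?_⟩, hnhds⟩
  · refine Seminorm.finset_sup_apply_le (mul_nonneg (apply_nonneg _ _) (apply_nonneg _ _))
      fun i hi => (hmul i x y).trans ?_
    have h := Finset.mem_Iic.1 hi
    exact mul_le_mul (hle h x) (hle h y) (apply_nonneg _ _) (apply_nonneg _ _)
  · by_contra hne
    obtain ⟨i, hi⟩ := hP.separating_of_T1 x hne
    exact hi (hx i)
  · let _ : UniformSpace A := IsTopologicalAddGroup.rightUniformSpace A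
    have : IsUniformAddGroup A := isUniformAddGroup_of_addCommGroup
    have hc : CauchySeq v := by
      rw [CauchySeq, cauchy_map_iff]
      refine ⟨atTop_neBot, ?_⟩
      rw [uniformity_eq_comap_nhds_zero, tendsto_comap_iff, hnhds, tendsto_iInf]
      intro k
      rw [tendsto_comap_iff]
      have hs := cauchySeq_of_summable_dist (f := fun n : ℕ => ∑ i ∈ Finset.range n,
        P k (v (i + 1) - v i)) (by
          simp only [Real.dist_eq, Finset.sum_range_succ]
          refine (hv k).congr fun n => ?_
          rw [sub_add_cancel_left, abs_neg, abs_of_nonneg (apply_nonneg _ _)])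
      have hkey : ∀ m n : ℕ, P k (v n - v m) ≤ dist (∑ i ∈ Finset.range m,
          P k (v (i + 1) - v i)) (∑ i ∈ Finset.range n, P k (v (i + 1) - v i)) := by
        have aux : ∀ m n : ℕ, m ≤ n → P k (v n - v m) ≤ (∑ i ∈ Finset.range n,
            P k (v (i + 1) - v i)) - ∑ i ∈ Finset.range m, P k (v (i + 1) - v i) := by
          intro m n hmn
          induction n, hmn using Nat.le_induction with
          | base => simp
          | succ n hmn ih =>
            rw [Finset.sum_range_succ]
            calc P k (v (n + 1) - v m) = P k ((v (n + 1) - v n) + (v n - v m)) := by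
                  congr 1; abel
              _ ≤ _ := map_add_le_add _ _ _
              _ ≤ _ := by linarith
        intro m n
        rw [Real.dist_eq]
        rcases le_total m n with h | h
        · rw [abs_sub_comm]; exact (aux m n h).trans (le_abs_self _)
        · rw [map_sub_rev]; exact (aux n m h).trans (le_abs_self _)
      have ht : Tendsto (fun x : ℕ × ℕ => dist (∑ i ∈ Finset.range x.1,
          P k (v (i + 1) - v i)) (∑ i ∈ Finset.range x.2, P k (v (i + 1) - v i)))
          (atTop ×ˢ atTop) (𝓝 0) := by
        have := (cauchySeq_iff_tendsto_dist_atTop_0).1 hs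
        rwa [← prod_atTop_atTop_eq] at this
      exact squeeze_zero (fun _ => apply_nonneg _ _) (fun x => hkey x.1 x.2) ht
    obtain ⟨a, ha⟩ := cauchySeq_tendsto_of_complete hc
    exact ⟨a, (tendsto_iff_of_nhds_eq hnhds).1 ha⟩

/-- The restrictions of seminorms to the kernel of a homomorphism. -/
def kerSemi (f : Hom A B) (p : ℕ → Seminorm ℂ A) (k : ℕ) : Seminorm ℂ (ker f) :=
  (p k).comp ((kerIncl f).toNonUnitalAlgHom : ker f →ₗ[ℂ] A)

theorem kerSemi_apply (f : Hom A B) (p : ℕ → Seminorm ℂ A) (k : ℕ) (x : ker f) :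
    kerSemi f p k x = p k (kerIncl f x) := rfl

/-- The kernel of a continuous homomorphism is closed, so limits taken in `A` remain in it. -/
theorem FMWith.ker (hp : FMWith A p) (f : Hom A B) : FMWith (ker f) (kerSemi f p) where
  mono h _ := hp.mono h _
  mul_le k x y := by
    rw [kerSemi_apply, map_mul]; exact hp.mul_le k _ _
  sep x hx := kerIncl_injective f (by rw [map_zero]; exact hp.sep _ hx)
  complete v hv := by
    obtain ⟨a, ha⟩ := hp.complete (fun n => kerIncl f (v n)) fun k => by
      refine (hv k).congr fun n => ?_
      rw [kerSemi_apply, map_sub]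
    have ht : Tendsto (fun n => kerIncl f (v n)) atTop (𝓝 a) := hp.tendsto_iff.2 ha
    have h0 : f a = 0 := by
      refine tendsto_nhds_unique ((f.continuous.tendsto a).comp ht) ?_
      refine tendsto_const_nhds.congr fun n => ?_
      exact (apply_kerIncl f (v n)).symm
    exact ⟨kerMk f a h0, ha⟩
  nhds_eq := by
    have h1 : 𝓝 (0 : LCAlg.ker f) = comap (kerIncl f) (𝓝 (kerIncl f 0)) := nhds_induced _ _
    rw [h1, map_zero, hp.nhds_eq, comap_iInf]
    simp only [comap_comap]
    rfl

/-! ### The mean value inequality -/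

/-- The function `z ↦ p (f z - f a)` need not be differentiable, but its right slopes are eventually
below any bound exceeding `p (g z)`. It is compared with a line of slope `c + ε`, since a strict
inequality of slopes is required, and then `ε` tends to `0`. The projection onto `[0,1]` extends the
path to the real line. -/
theorem HasPathDeriv.seminorm_sub_le {f g : C(unitInterval, A)} (h : HasPathDeriv f g)
    {p : Seminorm ℂ A} (hp : Continuous p) {a b : unitInterval} (hab : a ≤ b) {c : ℝ}
    (hc : ∀ x, a ≤ x → x ≤ b → p (g x) ≤ c) : p (f b - f a) ≤ c * ((b : ℝ) - a) := by
  have h01 : (0 : ℝ) ≤ 1 := zero_le_one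
  let π : ℝ → unitInterval := Set.projIcc 0 1 h01
  have hπ : Continuous π := continuous_projIcc
  have hπx : ∀ x : unitInterval, π x = x := fun x => Set.projIcc_val h01 x
  refine le_of_forall_pos_le_add fun ε hε => ?_
  have key := image_le_of_liminf_slope_right_lt_deriv_boundary (a := (a : ℝ)) (b := (b : ℝ))
    (f := fun z => p (f (π z) - f a)) (f' := fun z => p (g (π z)))
    (B := fun z => (c + ε) * (z - a)) (B' := fun _ => c + ε) ?_ ?_ ?_ ?_ ?_
  · have h1 := key (Set.right_mem_Icc.2 hab)
    simp only [hπx] at h1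
    have hb1 : (b : ℝ) - a ≤ 1 := by linarith [b.2.2, a.2.1]
    nlinarith
  · exact (hp.comp ((f.continuous.comp hπ).sub continuous_const)).continuousOn
  · intro x hx r hr
    set x' : unitInterval := ⟨x, a.2.1.trans hx.1, hx.2.le.trans b.2.2⟩ with hx'
    have hxx : π x = x' := hπx x'
    have hx1 : x < 1 := hx.2.trans_le b.2.2
    have ht : Tendsto π (𝓝[>] x) (𝓝[≠] x') := by
      refine tendsto_nhdsWithin_iff.2 ⟨?_, ?_⟩
      · rw [← hxx]; exact (hπ.tendsto x).mono_left nhdsWithin_le_nhds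
      · filter_upwards [Ioo_mem_nhdsGT hx1] with z hz heq
        have e : (π z : ℝ) = z :=
          congrArg Subtype.val (Set.projIcc_of_mem h01 ⟨x'.2.1.trans hz.1.le, hz.2.le⟩)
        have : z = x := by rw [← e, heq]
        exact hz.1.ne' this
    have hlim := (hp.tendsto _).comp ((h x').comp ht)
    have hr' : p (g x') < r := by rw [← hxx]; exact hr
    refine Eventually.frequently ?_
    filter_upwards [hlim.eventually_lt_const hr', Ioo_mem_nhdsGT hx1] with z hz hz'
    have e : (π z : ℝ) = z :=
      congrArg Subtype.val (Set.projIcc_of_mem h01 ⟨x'.2.1.trans hz'.1.le, hz'.2.le⟩)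
    refine lt_of_le_of_lt ?_ hz
    have hpos : 0 < z - x := sub_pos.2 hz'.1
    simp only [Function.comp, e, slope_def_module, smul_eq_mul, hxx]
    rw [map_smul_eq_mul, norm_inv, Complex.norm_real, Real.norm_of_nonneg hpos.le]
    refine mul_le_mul_of_nonneg_left ?_ (inv_nonneg.2 hpos.le)
    have := map_add_le_add p (f (π z) - f x') (f x' - f a)
    rw [sub_add_sub_cancel] at this
    linarith
  · simp [hπx]
  · intro x
    simpa using ((hasDerivAt_id x).sub_const (a : ℝ)).const_mul (c + ε)
  · intro x hx _
    have := hc ⟨x, a.2.1.trans hx.1, hx.2.le.trans b.2.2⟩ hx.1 hx.2.le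
    have e := hπx ⟨x, a.2.1.trans hx.1, hx.2.le.trans b.2.2⟩
    simp only at e
    rw [e]; linarith

theorem HasPathDeriv.linear (a : A) : HasPathDeriv (A := A)
    ⟨fun t : unitInterval => ((t : ℝ) : ℂ) • a, by fun_prop⟩ (ContinuousMap.const unitInterval a) :=
  fun t => by
    refine tendsto_const_nhds.congr' ?_
    filter_upwards [self_mem_nhdsWithin] with s hs
    have hne : (((s : ℝ) - t : ℝ) : ℂ) ≠ 0 := by
      rw [Complex.ofReal_ne_zero, sub_ne_zero]
      exact fun h => hs (Subtype.ext h)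
    change a = _ • (((s : ℝ) : ℂ) • a - ((t : ℝ) : ℂ) • a)
    rw [← sub_smul, ← Complex.ofReal_sub, smul_smul, inv_mul_cancel₀ hne, one_smul]

theorem HasPathDeriv.neg {f g : C(unitInterval, A)} (h : HasPathDeriv f g) :
    HasPathDeriv (-f) (-g) := by
  simpa using h.smul (-1)

/-- Taylor's formula of first order. -/
theorem HasPathDeriv.taylor {f g h : C(unitInterval, A)} (hf : HasPathDeriv f g)
    (hg : HasPathDeriv g h) {p : Seminorm ℂ A} (hp : Continuous p) {c : ℝ}
    (hc : ∀ x, p (h x) ≤ c) (s t : unitInterval) :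
    p (f s - f t - (((s : ℝ) - t : ℝ) : ℂ) • g t) ≤ c * ((s : ℝ) - t) ^ 2 := by
  have hc0 : 0 ≤ c := (apply_nonneg p _).trans (hc 0)
  have hg' : ∀ x y : unitInterval, p (g x - g y) ≤ c * |(x : ℝ) - y| := by
    intro x y
    rcases le_total y x with hxy | hxy
    · rw [abs_of_nonneg (sub_nonneg.2 (Subtype.coe_le_coe.2 hxy))]
      exact hg.seminorm_sub_le hp hxy fun z _ _ => hc z
    · rw [map_sub_rev, abs_sub_comm, abs_of_nonneg (sub_nonneg.2 (Subtype.coe_le_coe.2 hxy))]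
      exact hg.seminorm_sub_le hp hxy fun z _ _ => hc z
  -- Subtracting `x ↦ x • g t` leaves a path with derivative `g - g t`, which is of first order near
  -- `t` by the mean value inequality for `g`.
  have hF := hf.add (HasPathDeriv.linear (g t)).neg
  set F : C(unitInterval, A) := f + -⟨fun x : unitInterval => ((x : ℝ) : ℂ) • g t, by fun_prop⟩
    with hFdef
  have e : ∀ x y, F x - F y = f x - f y - (((x : ℝ) - y : ℝ) : ℂ) • g t := by
    intro x y
    change f x + -(((x : ℝ) : ℂ) • g t) - (f y + -(((y : ℝ) : ℂ) • g t)) = _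
    rw [Complex.ofReal_sub, sub_smul]; abel
  -- Having `t` at either end of the interval covers both `t ≤ s` and `s ≤ t`.
  have key : ∀ a b : unitInterval, a ≤ b → (t = a ∨ t = b) →
      p (F b - F a) ≤ c * ((b : ℝ) - a) ^ 2 := by
    intro a b hab htab
    have := hF.seminorm_sub_le hp hab (c := c * ((b : ℝ) - a)) fun x hax hxb => by
      change p (g x + -(g t)) ≤ _
      rw [← sub_eq_add_neg]
      refine (hg' x t).trans (mul_le_mul_of_nonneg_left ?_ hc0)
      have h1 : (a : ℝ) ≤ x := hax
      have h2 : (x : ℝ) ≤ b := hxb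
      rcases htab with rfl | rfl
      · rw [abs_of_nonneg (by linarith)]; linarith
      · rw [abs_of_nonpos (by linarith)]; linarith
    rwa [mul_assoc, ← sq] at this
  rw [← e]
  rcases le_total t s with hts | hts
  · exact key t s hts (Or.inl rfl)
  · rw [map_sub_rev]
    refine (key s t hts (Or.inr rfl)).trans (le_of_eq ?_)
    ring

/-- A converse to Taylor's formula. Unlike a limit of difference quotients, a quadratic bound
survives limits of sequences and suprema over a parameter. This is how derivatives are verified for
limits of smooth paths and for paths in algebras of paths. -/
theorem hasPathDeriv_of_quadratic (hp : FMWith A p) {f g : C(unitInterval, A)}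
    (h : ∀ k, ∃ c, ∀ s t : unitInterval,
      p k (f s - f t - (((s : ℝ) - t : ℝ) : ℂ) • g t) ≤ c * ((s : ℝ) - t) ^ 2) :
    HasPathDeriv f g := fun t => by
  rw [hp.tendsto_iff]
  intro k
  obtain ⟨c, hc⟩ := h k
  have ht : Tendsto (fun s : unitInterval => c * |(s : ℝ) - t|) (𝓝[≠] t) (𝓝 0) := by
    have : Continuous fun s : unitInterval => c * |(s : ℝ) - t| := by fun_prop
    have := this.tendsto t
    simp only [sub_self, abs_zero, mul_zero] at this
    exact this.mono_left nhdsWithin_le_nhds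
  refine squeeze_zero' (Eventually.of_forall fun _ => apply_nonneg _ _) ?_ ht
  filter_upwards [self_mem_nhdsWithin] with s hs
  have hne : (s : ℝ) - t ≠ 0 := by
    rw [sub_ne_zero]
    exact fun h => hs (Subtype.ext h)
  have hne' : (((s : ℝ) - t : ℝ) : ℂ) ≠ 0 := Complex.ofReal_ne_zero.2 hne
  have e : (((s : ℝ) - t : ℝ) : ℂ)⁻¹ • (f s - f t) - g t =
      (((s : ℝ) - t : ℝ) : ℂ)⁻¹ • (f s - f t - (((s : ℝ) - t : ℝ) : ℂ) • g t) := by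
    rw [smul_sub _ (f s - f t), smul_smul, inv_mul_cancel₀ hne', one_smul]
  rw [e, map_smul_eq_mul, norm_inv, Complex.norm_real, Real.norm_eq_abs]
  have hpos : 0 < |(s : ℝ) - t| := abs_pos.2 hne
  rw [inv_mul_le_iff₀ hpos]
  refine (hc s t).trans (le_of_eq ?_)
  rw [← sq_abs]; ring

end LCAlg

/-- Telescoping. The bound depends only on the majorant `s`, so it makes pointwise convergence of
paths uniform. -/
theorem seminorm_sub_le_tail {D : Type*} [AddCommGroup D] [Module ℂ D] (p : Seminorm ℂ D)
    {v : ℕ → D} {a : D} {s : ℕ → ℝ} (hs : Summable s) (h : ∀ n, p (v (n + 1) - v n) ≤ s n)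
    (ha : Tendsto (fun n => p (v n - a)) atTop (𝓝 0)) (n : ℕ) :
    p (v n - a) ≤ ∑' i, s (i + n) := by
  have hs0 : ∀ i, 0 ≤ s i := fun i => (apply_nonneg _ _).trans (h i)
  have hsn : Summable fun i => s (i + n) := (summable_nat_add_iff n).2 hs
  have h1 : ∀ m, p (v n - v (m + n)) ≤ ∑ i ∈ Finset.range m, s (i + n) := by
    intro m
    induction m with
    | zero => simp
    | succ m ih =>
      rw [Finset.sum_range_succ]
      calc p (v n - v (m + 1 + n)) = p ((v n - v (m + n)) - (v (m + n + 1) - v (m + n))) := by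
            rw [Nat.add_right_comm]; congr 1; abel
        _ ≤ _ := map_sub_le_add _ _ _
        _ ≤ _ := add_le_add ih (h _)
  have h2 : Tendsto (fun m => (∑' i, s (i + n)) + p (v (m + n) - a)) atTop
      (𝓝 ((∑' i, s (i + n)) + 0)) := ((tendsto_add_atTop_iff_nat n).2 ha).const_add _
  rw [add_zero] at h2
  refine ge_of_tendsto' h2 fun m => ?_
  calc p (v n - a) = p ((v n - v (m + n)) + (v (m + n) - a)) := by congr 1; abel
    _ ≤ _ := map_add_le_add _ _ _
    _ ≤ _ := by
      gcongr
      exact (h1 m).trans (hsn.sum_le_tsum _ fun i _ => hs0 _)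

namespace LCAlg

variable {A B : LCAlg.{u}} {p : ℕ → Seminorm ℂ A} {q : ℕ → Seminorm ℂ B}

/-! ### Continuous paths -/

theorem bddAbove_seminorm {p : Seminorm ℂ A} (hp : Continuous p) (f : C(unitInterval, A)) :
    BddAbove (Set.range fun t => p (f t)) :=
  isCompact_range (hp.comp f.continuous) |>.bddAbove

/-- The supremum seminorm on continuous paths. -/
def supSemi (p : Seminorm ℂ A) (hp : Continuous p) : Seminorm ℂ C(unitInterval, A) :=
  Seminorm.of (fun f => ⨆ t, p (f t))
    (fun f g => ciSup_le fun t => (map_add_le_add p (f t) (g t)).trans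
      (add_le_add (le_ciSup (bddAbove_seminorm hp f) t) (le_ciSup (bddAbove_seminorm hp g) t)))
    (fun c f => by
      rw [Real.mul_iSup_of_nonneg (norm_nonneg _)]
      exact iSup_congr fun t => map_smul_eq_mul p c (f t))

theorem le_supSemi {p : Seminorm ℂ A} (hp : Continuous p) (f : C(unitInterval, A))
    (t : unitInterval) : p (f t) ≤ supSemi p hp f := le_ciSup (bddAbove_seminorm hp f) t

theorem supSemi_le {p : Seminorm ℂ A} (hp : Continuous p) (f : C(unitInterval, A)) {c : ℝ}
    (h : ∀ t, p (f t) ≤ c) : supSemi p hp f ≤ c := ciSup_le h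

theorem exists_eq_supSemi {p : Seminorm ℂ A} (hp : Continuous p) (f : C(unitInterval, A)) :
    ∃ t, supSemi p hp f = p (f t) := by
  obtain ⟨t, -, ht⟩ := isCompact_univ.exists_isMaxOn Set.univ_nonempty
    (hp.comp f.continuous).continuousOn
  exact ⟨t, le_antisymm (supSemi_le hp f fun s => ht (Set.mem_univ s)) (le_supSemi hp f t)⟩

/-- The supremum seminorms on `C([0,1], A)`. -/
def contSemi (hp : FMWith A p) (k : ℕ) : Seminorm ℂ C(unitInterval, A) :=
  supSemi (p k) (hp.continuous k)

theorem le_contSemi (hp : FMWith A p) (k : ℕ) (f : C(unitInterval, A)) (t : unitInterval) :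
    p k (f t) ≤ contSemi hp k f := le_supSemi _ f t

theorem contSemi_le (hp : FMWith A p) (k : ℕ) (f : C(unitInterval, A)) {c : ℝ}
    (h : ∀ t, p k (f t) ≤ c) : contSemi hp k f ≤ c := supSemi_le _ f h

/-- The supremum over the compact interval is attained, so a strict bound on it is a basic open
condition of the compact-open topology. Conversely that topology is uniform convergence, and one
seminorm ball fits into any neighbourhood of `0` in `A`. -/
theorem contSemi_nhds (hp : FMWith A p) :
    𝓝 (0 : C(unitInterval, A)) = ⨅ k, comap (contSemi hp k) (𝓝 0) := by
  refine le_antisymm (le_iInf fun k => ?_) ?_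
  · rw [← tendsto_iff_comap]
    refine tendsto_order.2 ⟨fun a ha => Eventually.of_forall fun f =>
      ha.trans_le (apply_nonneg _ _), fun ε hε => ?_⟩
    have ho : IsOpen {f : C(unitInterval, A) | Set.MapsTo f Set.univ {a | p k a < ε}} :=
      ContinuousMap.isOpen_setOfPred_mapsTo isCompact_univ
        (isOpen_lt (hp.continuous k) continuous_const)
    refine mem_of_superset (ho.mem_nhds fun t _ => ?_) fun f hf => ?_
    · change p k 0 < ε
      rwa [map_zero]
    · obtain ⟨t, ht⟩ := exists_eq_supSemi (hp.continuous k) f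
      change supSemi (p k) _ f < ε
      rw [ht]
      exact hf (Set.mem_univ t)
  · let _ : UniformSpace A := IsTopologicalAddGroup.rightUniformSpace A
    have : IsUniformAddGroup A := isUniformAddGroup_of_addCommGroup
    intro U hU
    obtain ⟨V, hV, hVU⟩ := ((basis_sets (𝓝 (0 : A))).uniformity_of_nhds_zero_swapped
      |>.compactConvergenceUniformity_of_compact (α := unitInterval)
      |> nhds_basis_uniformity).mem_iff.1 hU
    obtain ⟨k, ε, hε, hk⟩ := hp.exists_ball hV
    refine mem_of_superset (mem_iInf_of_mem k (preimage_mem_comap (Iio_mem_nhds hε))) ?_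
    intro f hf
    refine hVU fun t => ?_
    have h2 : f t ∈ V := hk ((le_contSemi hp k f t).trans_lt hf)
    simpa using h2

/-- Pointwise limits exist by completeness of `A`, with tail bounds independent of the point. The
limit is continuous by the usual `ε / 3` argument. -/
theorem contSemi_complete (hp : FMWith A p) (v : ℕ → C(unitInterval, A))
    (hv : ∀ k, Summable fun n => contSemi hp k (v (n + 1) - v n)) :
    ∃ a, ∀ k, Tendsto (fun n => contSemi hp k (v n - a)) atTop (𝓝 0) := by
  have h1 : ∀ t : unitInterval, ∃ a, ∀ k, Tendsto (fun n => p k (v n t - a)) atTop (𝓝 0) :=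
    fun t => hp.complete (fun n => v n t) fun k =>
      Summable.of_nonneg_of_le (fun _ => apply_nonneg _ _)
        (fun n => le_contSemi hp k (v (n + 1) - v n) t) (hv k)
  choose a ha using h1
  have h2 : ∀ k n t, p k (v n t - a t) ≤ ∑' i, contSemi hp k (v (i + n + 1) - v (i + n)) :=
    fun k n t => seminorm_sub_le_tail (p k) (v := fun n => v n t) (hv k)
      (fun n => le_contSemi hp k (v (n + 1) - v n) t) (ha t k) n
  have h3 : ∀ k, Tendsto (fun n => ∑' i, contSemi hp k (v (i + n + 1) - v (i + n))) atTop (𝓝 0) :=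
    fun k => tendsto_sum_nat_add fun n => contSemi hp k (v (n + 1) - v n)
  have hcont : Continuous a := by
    rw [continuous_iff_continuousAt]
    intro t
    rw [ContinuousAt, hp.tendsto_iff]
    intro k
    refine tendsto_order.2 ⟨fun c hc => Eventually.of_forall fun f =>
      hc.trans_le (apply_nonneg _ _), fun ε hε => ?_⟩
    obtain ⟨n, hn⟩ := ((h3 k).eventually_lt_const (show (0 : ℝ) < ε / 3 by linarith)).exists
    have h4 := (hp.tendsto_iff.1 ((v n).continuous.tendsto t) k).eventually_lt_const
      (show (0 : ℝ) < ε / 3 by linarith)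
    filter_upwards [h4] with s hs
    have e : a s - a t = (v n s - v n t) - (v n s - a s) + (v n t - a t) := by abel
    rw [e]
    have i1 := map_add_le_add (p k) ((v n s - v n t) - (v n s - a s)) (v n t - a t)
    have i2 := map_sub_le_add (p k) (v n s - v n t) (v n s - a s)
    have i3 := h2 k n s
    have i4 := h2 k n t
    linarith
  refine ⟨⟨a, hcont⟩, fun k => squeeze_zero (fun _ => apply_nonneg _ _) (fun n => ?_) (h3 k)⟩
  exact contSemi_le hp k _ fun t => h2 k n t

theorem FMWith.contPath (hp : FMWith A p) : FMWith (contPath A) (contSemi hp) where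
  mono h f := contSemi_le hp _ f fun t => (hp.mono h _).trans (le_contSemi hp _ f t)
  mul_le k f g := contSemi_le hp k _ fun t => (hp.mul_le k _ _).trans
    (mul_le_mul (le_contSemi hp k f t) (le_contSemi hp k g t) (apply_nonneg _ _)
      (apply_nonneg _ _))
  sep f hf := ContinuousMap.ext fun t => hp.sep _ fun k =>
    le_antisymm ((le_contSemi hp k f t).trans (hf k).le) (apply_nonneg _ _)
  complete := contSemi_complete hp
  nhds_eq := contSemi_nhds hp

/-- The supremum seminorms on continuous paths starting at `0`. -/
def contConeSemi (hp : FMWith A p) : ℕ → Seminorm ℂ (PathFunctor.cont.cone A) :=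
  kerSemi (PathFunctor.cont.ev0 A) (contSemi hp)

theorem FMWith.contCone (hp : FMWith A p) :
    FMWith (PathFunctor.cont.cone A) (contConeSemi hp) :=
  hp.contPath.ker (PathFunctor.cont.ev0 A)

/-! ### Smooth paths -/

/-- The weighted `C^k`-seminorms on smooth paths. -/
def smoothSemi (hp : FMWith A p) (w : NNReal) (k : ℕ) : Seminorm ℂ (smoothMaps A) :=
  Seminorm.of (fun F => ∑ j ∈ Finset.range (k + 1), (w : ℝ) ^ j / j.factorial *
      contSemi hp k (F.1 j))
    (fun F G => by
      rw [← Finset.sum_add_distrib]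
      refine Finset.sum_le_sum fun j _ => ?_
      rw [← mul_add]
      exact mul_le_mul_of_nonneg_left (map_add_le_add _ _ _) (by positivity))
    (fun c F => by
      rw [Finset.mul_sum]
      refine Finset.sum_congr rfl fun j _ => ?_
      have : contSemi hp k ((c • F).1 j) = ‖c‖ * contSemi hp k (F.1 j) :=
        map_smul_eq_mul (contSemi hp k) c (F.1 j)
      rw [this]; ring)

theorem smoothSemi_apply (hp : FMWith A p) (w : NNReal) (k : ℕ) (F : smoothMaps A) :
    smoothSemi hp w k F = ∑ j ∈ Finset.range (k + 1), (w : ℝ) ^ j / j.factorial *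
      contSemi hp k (F.1 j) := rfl

theorem sum_antidiagonal_le {a b : ℕ → ℝ} (ha : ∀ i, 0 ≤ a i) (hb : ∀ i, 0 ≤ b i) (K : ℕ) :
    ∑ n ∈ Finset.range K, ∑ x ∈ Finset.HasAntidiagonal.antidiagonal n, a x.1 * b x.2 ≤
      (∑ i ∈ Finset.range K, a i) * ∑ i ∈ Finset.range K, b i := by
  simp only [Finset.Nat.sum_antidiagonal_eq_sum_range_succ fun i j => a i * b j]
  rw [Finset.sum_range_diag_flip K fun i j => a i * b j, Finset.sum_mul]
  refine Finset.sum_le_sum fun i _ => ?_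
  rw [Finset.mul_sum]
  exact Finset.sum_le_sum_of_subset_of_nonneg (Finset.range_mono (Nat.sub_le _ _))
    fun j _ _ => mul_nonneg (ha i) (hb j)

/-- The weights `w ^ j / j!` turn the binomial coefficients of the Leibniz rule into those of a
Cauchy product of two finite sequences; its truncation is at most the product of the two sums. -/
theorem smoothSemi_mul_le (hp : FMWith A p) (w : NNReal) (k : ℕ) (F G : smoothMaps A) :
    smoothSemi hp w k (F * G) ≤ smoothSemi hp w k F * smoothSemi hp w k G := by
  rw [smoothSemi_apply, smoothSemi_apply, smoothSemi_apply]
  refine le_trans (Finset.sum_le_sum fun n _ => ?_)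
    (sum_antidiagonal_le (fun i => by positivity) (fun i => by positivity) (k + 1))
  have h1 : contSemi hp k ((F * G).1 n) ≤ ∑ x ∈ Finset.HasAntidiagonal.antidiagonal n,
      (n.choose x.1 : ℝ) * (contSemi hp k (F.1 x.1) * contSemi hp k (G.1 x.2)) := by
    change contSemi hp k (∑ x ∈ Finset.HasAntidiagonal.antidiagonal n,
      n.choose x.1 • (F.1 x.1 * G.1 x.2)) ≤ _
    refine (Finset.le_sum_of_subadditive _ (map_zero _).le (map_add_le_add _) _ _).trans ?_
    refine Finset.sum_le_sum fun x _ => ?_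
    rw [← Nat.cast_smul_eq_nsmul ℂ, map_smul_eq_mul, Complex.norm_natCast]
    exact mul_le_mul_of_nonneg_left (hp.contPath.mul_le k _ _) (Nat.cast_nonneg _)
  refine (mul_le_mul_of_nonneg_left h1 (by positivity)).trans (le_of_eq ?_)
  rw [Finset.mul_sum]
  refine Finset.sum_congr rfl fun x hx => ?_
  have hx' := Finset.HasAntidiagonal.mem_antidiagonal.1 hx
  have h2 : ((n.choose x.1 : ℕ) : ℝ) * x.1.factorial * x.2.factorial = n.factorial := by
    rw [← hx', Nat.choose_symm_add]
    exact_mod_cast Nat.add_choose_mul_factorial_mul_factorial x.1 x.2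
  have f1 : ((x.1.factorial : ℕ) : ℝ) ≠ 0 := Nat.cast_ne_zero.2 (Nat.factorial_ne_zero _)
  have f2 : ((x.2.factorial : ℕ) : ℝ) ≠ 0 := Nat.cast_ne_zero.2 (Nat.factorial_ne_zero _)
  have f3 : ((n.factorial : ℕ) : ℝ) ≠ 0 := Nat.cast_ne_zero.2 (Nat.factorial_ne_zero _)
  have h3 : (w : ℝ) ^ n = (w : ℝ) ^ x.1 * (w : ℝ) ^ x.2 := by rw [← pow_add, hx']
  rw [h3]
  field_simp
  rw [← h2]
  ring

theorem contSemi_le_smoothSemi (hp : FMWith A p) {w : NNReal} (hw : w ≠ 0) {j k l : ℕ}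
    (hk : k ≤ l) (hj : j ≤ l) (F : smoothMaps A) :
    contSemi hp k (F.1 j) ≤ j.factorial / (w : ℝ) ^ j * smoothSemi hp w l F := by
  have h1 : contSemi hp k (F.1 j) ≤ contSemi hp l (F.1 j) := hp.contPath.mono hk _
  have h2 : (w : ℝ) ^ j / j.factorial * contSemi hp l (F.1 j) ≤ smoothSemi hp w l F :=
    Finset.single_le_sum (f := fun j => (w : ℝ) ^ j / j.factorial * contSemi hp l (F.1 j))
      (fun j _ => by positivity) (Finset.mem_range.2 (Nat.lt_succ_of_le hj))
  have hw' : (0 : ℝ) < (w : ℝ) ^ j := by positivity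
  have hf : (0 : ℝ) < j.factorial := by positivity
  refine (h1.trans (le_of_eq ?_)).trans (mul_le_mul_of_nonneg_left h2 (by positivity))
  field_simp

/-- The `C^k`-seminorms of smooth paths as functions of the zeroth derivative and the weight. -/
theorem exists_smoothSemi_lt (hp : FMWith A p) (k : ℕ) {ι : Type*} (s : Finset ι)
    (F : ι → smoothMaps A) {r : ℝ} (h : ∑ i ∈ s, contSemi hp k ((F i).1 0) < r) :
    ∃ w : NNReal, w ≠ 0 ∧ ∑ i ∈ s, smoothSemi hp w k (F i) < r := by
  -- As `w` tends to `0` only the term `j = 0`, the sup seminorm, survives. A strict bound for it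
  -- therefore persists for some nonzero weight.
  have hc : Continuous fun w : NNReal => ∑ i ∈ s, smoothSemi hp w k (F i) := by
    simp only [smoothSemi_apply]
    fun_prop
  have h0 : ∑ i ∈ s, smoothSemi hp 0 k (F i) = ∑ i ∈ s, contSemi hp k ((F i).1 0) := by
    refine Finset.sum_congr rfl fun i _ => ?_
    rw [smoothSemi_apply, Finset.sum_range_succ']
    simp
  have h1 : ∀ᶠ w in 𝓝 (0 : NNReal), ∑ i ∈ s, smoothSemi hp w k (F i) < r := by
    refine (hc.tendsto 0).eventually_lt_const ?_
    rwa [h0]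
  obtain ⟨ε, hε, hlt⟩ := NNReal.nhds_zero_basis.eventually_iff.1 h1
  exact ⟨ε / 2, (half_pos hε).ne', hlt (NNReal.half_lt_self hε.ne')⟩

theorem smoothSemi_nhds (hp : FMWith A p) :
    𝓝 (0 : smoothMaps A) = ⨅ k, comap (smoothSemi hp 1 k) (𝓝 0) := by
  have h1 : 𝓝 (0 : smoothMaps A) =
      ⨅ j, ⨅ k, comap (fun F : smoothMaps A => contSemi hp k (F.1 j)) (𝓝 0) := by
    have h2 : 𝓝 (0 : smoothMaps A) = comap (Subtype.val : smoothMaps A → _)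
      (𝓝 (0 : ℕ → C(unitInterval, A))) := nhds_induced _ _
    rw [h2, nhds_pi, Filter.pi, comap_iInf]
    refine iInf_congr fun j => ?_
    have h3 : 𝓝 ((0 : ℕ → C(unitInterval, A)) j) = ⨅ k, comap (contSemi hp k) (𝓝 0) :=
      contSemi_nhds hp
    rw [h3, comap_comap, comap_iInf]
    simp only [comap_comap]
    rfl
  rw [h1]
  refine le_antisymm (le_iInf fun k => ?_) (le_iInf fun j => le_iInf fun k => ?_)
  · rw [← tendsto_iff_comap]
    have : Tendsto (fun F : smoothMaps A => ∑ j ∈ Finset.range (k + 1),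
        (((1 : NNReal) : ℝ) ^ j / j.factorial * contSemi hp k (F.1 j)))
        (⨅ j, ⨅ k, comap (fun F : smoothMaps A => contSemi hp k (F.1 j)) (𝓝 0))
        (𝓝 (∑ j ∈ Finset.range (k + 1), ((1 : NNReal) : ℝ) ^ j / j.factorial * 0)) := by
      refine tendsto_finsetSum _ fun j _ => Tendsto.const_mul _ ?_
      exact tendsto_comap.mono_left ((iInf_le _ j).trans (iInf_le _ k))
    simp only [mul_zero, Finset.sum_const_zero] at this
    exact this
  · rw [← tendsto_iff_comap]
    have h4 : Tendsto (fun F : smoothMaps A => j.factorial / (((1 : NNReal) : ℝ) ^ j) *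
        smoothSemi hp 1 (max k j) F) (⨅ k, comap (smoothSemi hp 1 k) (𝓝 0))
        (𝓝 (j.factorial / (((1 : NNReal) : ℝ) ^ j) * 0)) :=
      Tendsto.const_mul _ (tendsto_comap.mono_left (iInf_le _ _))
    rw [mul_zero] at h4
    exact squeeze_zero (fun _ => apply_nonneg _ _)
      (fun F => contSemi_le_smoothSemi hp one_ne_zero (le_max_left _ _) (le_max_right _ _) F) h4

theorem smoothMaps_taylor (hp : FMWith A p) (F : smoothMaps A) (j k : ℕ) (s t : unitInterval) :
    p k (F.1 j s - F.1 j t - (((s : ℝ) - t : ℝ) : ℂ) • F.1 (j + 1) t) ≤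
      contSemi hp k (F.1 (j + 2)) * ((s : ℝ) - t) ^ 2 :=
  (F.2 j).taylor (F.2 (j + 1)) (hp.continuous k) (fun x => le_contSemi hp k _ x) s t

/-- Every derivative converges uniformly. That the limits are derivatives of one another follows by
passing to the limit in Taylor's inequality, where the second derivatives stay bounded. -/
theorem smoothSemi_complete (hp : FMWith A p) (v : ℕ → smoothMaps A)
    (hv : ∀ k, Summable fun n => smoothSemi hp 1 k (v (n + 1) - v n)) :
    ∃ a, ∀ k, Tendsto (fun n => smoothSemi hp 1 k (v n - a)) atTop (𝓝 0) := by
  have h1 : ∀ j, ∃ a, ∀ k, Tendsto (fun n => contSemi hp k ((v n).1 j - a)) atTop (𝓝 0) :=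
    fun j => contSemi_complete hp (fun n => (v n).1 j) fun k =>
      Summable.of_nonneg_of_le (fun _ => apply_nonneg _ _)
        (fun n => contSemi_le_smoothSemi hp one_ne_zero (le_max_left k j) (le_max_right k j)
          (v (n + 1) - v n)) ((hv (max k j)).mul_left _)
  choose G hG using h1
  have hpt : ∀ j t, Tendsto (fun n => (v n).1 j t) atTop (𝓝 (G j t)) := by
    intro j t
    rw [hp.tendsto_iff]
    exact fun k => squeeze_zero (fun _ => apply_nonneg _ _)
      (fun n => le_contSemi hp k ((v n).1 j - G j) t) (hG j k)
  refine ⟨⟨G, fun j => hasPathDeriv_of_quadratic hp fun k =>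
    -- The summand `1` absorbs the distance of `(v n).1 (j + 2)` from its limit for large `n`.
    ⟨contSemi hp k (G (j + 2)) + 1, fun s t => ?_⟩⟩, fun k => ?_⟩
  · have hlim : Tendsto (fun n => p k ((v n).1 j s - (v n).1 j t -
        (((s : ℝ) - t : ℝ) : ℂ) • (v n).1 (j + 1) t)) atTop
        (𝓝 (p k (G j s - G j t - (((s : ℝ) - t : ℝ) : ℂ) • G (j + 1) t))) :=
      ((hp.continuous k).tendsto _).comp
        (((hpt j s).sub (hpt j t)).sub ((hpt (j + 1) t).const_smul _))
    refine le_of_tendsto hlim ?_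
    filter_upwards [(hG (j + 2) k).eventually_lt_const one_pos] with n hn
    refine (smoothMaps_taylor hp (v n) j k s t).trans
      (mul_le_mul_of_nonneg_right ?_ (sq_nonneg _))
    have : (v n).1 (j + 2) = G (j + 2) + ((v n).1 (j + 2) - G (j + 2)) := by abel
    rw [this]
    exact (map_add_le_add _ _ _).trans (add_le_add_right hn.le _)
  · have : Tendsto (fun n => ∑ j ∈ Finset.range (k + 1), (((1 : NNReal) : ℝ) ^ j / j.factorial *
        contSemi hp k ((v n).1 j - G j))) atTop
        (𝓝 (∑ j ∈ Finset.range (k + 1), ((1 : NNReal) : ℝ) ^ j / j.factorial * 0)) :=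
      tendsto_finsetSum _ fun j _ => (hG j k).const_mul _
    simp only [mul_zero, Finset.sum_const_zero] at this
    exact this

theorem smoothSemi_mono (hp : FMWith A p) {k l : ℕ} (h : k ≤ l) (F : smoothMaps A) :
    smoothSemi hp 1 k F ≤ smoothSemi hp 1 l F := by
  rw [smoothSemi_apply, smoothSemi_apply]
  refine le_trans (Finset.sum_le_sum fun j _ => ?_) (Finset.sum_le_sum_of_subset_of_nonneg
    (Finset.range_mono (Nat.succ_le_succ h)) fun j _ _ => by positivity)
  exact mul_le_mul_of_nonneg_left (hp.contPath.mono h _) (by positivity)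

theorem smoothSemi_sep (hp : FMWith A p) (F : smoothMaps A)
    (hF : ∀ k, smoothSemi hp 1 k F = 0) : F = 0 :=
  smoothMaps_ext (A := A) (hp.contPath.sep _ fun k => le_antisymm (by
    have := contSemi_le_smoothSemi hp one_ne_zero le_rfl (Nat.zero_le k) F
    rwa [hF k, mul_zero] at this) (apply_nonneg _ _))

theorem FMWith.smoothPath (hp : FMWith A p) : FMWith (smoothPath A) (smoothSemi hp 1) where
  mono h F := smoothSemi_mono hp h F
  mul_le k F G := smoothSemi_mul_le hp 1 k F G
  sep F hF := smoothSemi_sep hp F hF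
  complete := smoothSemi_complete hp
  nhds_eq := smoothSemi_nhds hp

/-- The `C^k`-seminorms on smooth paths starting at `0`. -/
def smoothConeSemi (hp : FMWith A p) : ℕ → Seminorm ℂ (PathFunctor.smooth.cone A) :=
  kerSemi (PathFunctor.smooth.ev0 A) (smoothSemi hp 1)

theorem FMWith.smoothCone (hp : FMWith A p) :
    FMWith (PathFunctor.smooth.cone A) (smoothConeSemi hp) :=
  hp.smoothPath.ker (PathFunctor.smooth.ev0 A)

end LCAlg

/-! ### Matrices -/

section matrices

variable {D E C : Type*} [NonUnitalRing D] [Module ℂ D] [NonUnitalRing E] [Module ℂ E]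
  [NonUnitalRing C] [Module ℂ C] {m : ℕ}

/-- The homomorphism of matrix rings induced by a homomorphism. -/
def matMap (m : ℕ) (f : D →ₙ+* E) :
    Matrix (Fin m) (Fin m) D →ₙ+* Matrix (Fin m) (Fin m) E where
  toFun X := X.map f
  map_zero' := Matrix.map_zero _ (map_zero f)
  map_add' _ _ := Matrix.map_add f (map_add f) _ _
  map_mul' _ _ := Matrix.map_mul

theorem matMap_injective {f : D →ₙ+* E} (hf : Function.Injective f) :
    Function.Injective (matMap m f) := fun _ _ h =>
  Matrix.ext fun i j => hf (congrFun (congrFun h i) j)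

/-- The homomorphism of matrix algebras induced by a homomorphism of algebras. -/
def matAlgMap (m : ℕ) (f : D →ₙₐ[ℂ] E) :
    Matrix (Fin m) (Fin m) D →ₙₐ[ℂ] Matrix (Fin m) (Fin m) E :=
  { matMap m (f : D →ₙ+* E) with
    map_smul' := fun c X => Matrix.ext fun i j => map_smul f c (X i j) }

/-- The sum of the seminorms of the entries of a matrix. -/
def matSemi (m : ℕ) (p : Seminorm ℂ D) : Seminorm ℂ (Matrix (Fin m) (Fin m) D) :=
  Seminorm.of (fun X => ∑ i, ∑ j, p (X i j))
    (fun X Y => by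
      rw [← Finset.sum_add_distrib]
      refine Finset.sum_le_sum fun i _ => ?_
      rw [← Finset.sum_add_distrib]
      exact Finset.sum_le_sum fun j _ => map_add_le_add p _ _)
    (fun c X => by
      rw [Finset.mul_sum]
      refine Finset.sum_congr rfl fun i _ => ?_
      rw [Finset.mul_sum]
      exact Finset.sum_congr rfl fun j _ => map_smul_eq_mul p c _)

theorem matSemi_apply (p : Seminorm ℂ D) (X : Matrix (Fin m) (Fin m) D) :
    matSemi m p X = ∑ i, ∑ j, p (X i j) := rfl

theorem le_matSemi (p : Seminorm ℂ D) (X : Matrix (Fin m) (Fin m) D) (i j : Fin m) :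
    p (X i j) ≤ matSemi m p X :=
  (Finset.single_le_sum (f := fun j => p (X i j)) (fun _ _ => apply_nonneg _ _)
    (Finset.mem_univ j)).trans (Finset.single_le_sum (f := fun i => ∑ j, p (X i j))
    (fun _ _ => Finset.sum_nonneg fun _ _ => apply_nonneg _ _) (Finset.mem_univ i))

theorem matSemi_le_mul {p : Seminorm ℂ D} {q : Seminorm ℂ E} {X : Matrix (Fin m) (Fin m) D}
    {Y : Matrix (Fin m) (Fin m) E} {M : ℝ} (h : ∀ i j, p (X i j) ≤ M * q (Y i j)) :
    matSemi m p X ≤ M * matSemi m q Y := by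
  rw [matSemi_apply, matSemi_apply, Finset.mul_sum]
  refine Finset.sum_le_sum fun i _ => ?_
  rw [Finset.mul_sum]
  exact Finset.sum_le_sum fun j _ => h i j

theorem matSemi_mul_le {p : Seminorm ℂ D} (hp : ∀ x y, p (x * y) ≤ p x * p y)
    (X Y : Matrix (Fin m) (Fin m) D) : matSemi m p (X * Y) ≤ matSemi m p X * matSemi m p Y := by
  calc matSemi m p (X * Y) ≤ ∑ i, ∑ j, ∑ l, p (X i l) * p (Y l j) := by
        rw [matSemi_apply]
        refine Finset.sum_le_sum fun i _ => Finset.sum_le_sum fun j _ => ?_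
        rw [Matrix.mul_apply]
        exact (Finset.le_sum_of_subadditive p (map_zero p).le (map_add_le_add p) Finset.univ
          fun l => X i l * Y l j).trans (Finset.sum_le_sum fun l _ => hp _ _)
    _ = ∑ i, ∑ l, p (X i l) * ∑ j, p (Y l j) := by
        refine Finset.sum_congr rfl fun i _ => ?_
        rw [Finset.sum_comm]
        exact Finset.sum_congr rfl fun l _ => (Finset.mul_sum _ _ _).symm
    _ ≤ ∑ i, ∑ l, p (X i l) * matSemi m p Y := by
        refine Finset.sum_le_sum fun i _ => Finset.sum_le_sum fun l _ => ?_
        refine mul_le_mul_of_nonneg_left ?_ (apply_nonneg _ _)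
        exact Finset.single_le_sum (f := fun l => ∑ j, p (Y l j))
          (fun _ _ => Finset.sum_nonneg fun _ _ => apply_nonneg _ _) (Finset.mem_univ l)
    _ = _ := by
        rw [matSemi_apply p X, Finset.sum_mul]
        exact Finset.sum_congr rfl fun i _ => (Finset.sum_mul _ _ _).symm

theorem IsFM.matrix {p : ℕ → Seminorm ℂ D} (hp : IsFM p) (m : ℕ) :
    IsFM fun k => matSemi m (p k) where
  mono h X := by
    rw [matSemi_apply, matSemi_apply]
    exact Finset.sum_le_sum fun i _ => Finset.sum_le_sum fun j _ => hp.mono h (X i j)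
  mul_le k := matSemi_mul_le (hp.mul_le k)
  sep X hX := Matrix.ext fun i j => hp.sep _ fun k =>
    le_antisymm ((le_matSemi (p k) X i j).trans (hX k).le) (apply_nonneg _ _)
  complete v hv := by
    have h : ∀ i j, ∃ a, ∀ k, Tendsto (fun n => p k (v n i j - a)) atTop (𝓝 0) := fun i j =>
      hp.complete (fun n => v n i j) fun k => Summable.of_nonneg_of_le
        (fun _ => apply_nonneg _ _) (fun n => le_matSemi (p k) (v (n + 1) - v n) i j) (hv k)
    choose a ha using h
    refine ⟨Matrix.of a, fun k => ?_⟩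
    have : Tendsto (fun n => ∑ i, ∑ j, p k (v n i j - a i j)) atTop
        (𝓝 (∑ _i : Fin m, ∑ _j : Fin m, (0 : ℝ))) :=
      tendsto_finsetSum _ fun i _ => tendsto_finsetSum _ fun j _ => ha i j k
    simpa using! this

end matrices

namespace LCAlg

variable {A B : LCAlg.{u}} {p : ℕ → Seminorm ℂ A}

/-! ### Polynomial paths -/

open Polynomial in
/-- The path `t ↦ P(t) a` for a real polynomial `P`, as a smooth map. -/
def polyPath (P : ℝ[X]) (a : A) : smoothMaps A :=
  ⟨fun n => ⟨fun t => (((derivative^[n] P).eval (t : ℝ) : ℝ) : ℂ) • a, by fun_prop⟩, fun n t => by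
    have h := ((derivative^[n] P).hasDerivAt (t : ℝ)).tendsto_slope
    rw [← Function.iterate_succ_apply' (f := derivative)] at h
    have hc : Tendsto ((↑) : unitInterval → ℝ) (𝓝[≠] t) (𝓝[≠] (t : ℝ)) :=
      tendsto_nhdsWithin_iff.2 ⟨continuous_subtype_val.continuousAt.mono_left nhdsWithin_le_nhds,
        eventually_mem_nhdsWithin.mono fun s hs h => hs (Subtype.ext h)⟩
    have h2 := ((Complex.continuous_ofReal.tendsto _).comp (h.comp hc)).smul_const a
    refine h2.congr fun s => ?_
    simp only [Function.comp, slope_def_field, ContinuousMap.coe_mk]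
    rw [← sub_smul, smul_smul, div_eq_inv_mul]
    push_cast
    rfl⟩

open Polynomial in
theorem polyPath_apply (P : ℝ[X]) (a : A) (t : unitInterval) :
    (polyPath P a).1 0 t = ((P.eval (t : ℝ) : ℝ) : ℂ) • a := rfl

open Polynomial in
theorem exists_smoothSemi_polyPath_le (hp : FMWith A p) (P : ℝ[X]) (k : ℕ) :
    ∃ M, 0 ≤ M ∧ ∀ a, smoothSemi hp 1 k (polyPath P a) ≤ M * p k a := by
  have h : ∀ n, ∃ c, ∀ t : unitInterval, |(derivative^[n] P).eval (t : ℝ)| ≤ c := by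
    intro n
    have hc : Continuous fun t : unitInterval => |(derivative^[n] P).eval (t : ℝ)| := by fun_prop
    obtain ⟨c, hc⟩ := (isCompact_range hc).bddAbove
    exact ⟨c, fun t => hc ⟨t, rfl⟩⟩
  choose c hc using h
  have hc0 : ∀ n, 0 ≤ c n := fun n => (abs_nonneg _).trans (hc n 0)
  refine ⟨∑ j ∈ Finset.range (k + 1), ((1 : NNReal) : ℝ) ^ j / j.factorial * c j,
    Finset.sum_nonneg fun j _ => mul_nonneg (by positivity) (hc0 j), fun a => ?_⟩
  rw [smoothSemi_apply, Finset.sum_mul]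
  refine Finset.sum_le_sum fun j _ => ?_
  rw [mul_assoc]
  refine mul_le_mul_of_nonneg_left (contSemi_le hp k _ fun t => ?_) (by positivity)
  change p k ((((derivative^[j] P).eval (t : ℝ) : ℝ) : ℂ) • a) ≤ _
  rw [map_smul_eq_mul, Complex.norm_real]
  exact mul_le_mul_of_nonneg_right (hc j t) (apply_nonneg _ _)

/-- The smooth path `t ↦ t a`. -/
def linearCone (a : A) : PathFunctor.smooth.cone A :=
  kerMk (PathFunctor.smooth.ev0 A) (polyPath Polynomial.X a : smoothMaps A) (by
    change (polyPath Polynomial.X a).1 0 0 = 0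
    rw [polyPath_apply]; simp)

theorem tau_linearCone (a : A) : PathFunctor.smooth.tau A (linearCone a) = a := by
  change (polyPath Polynomial.X a).1 0 1 = a
  rw [polyPath_apply]; simp

/-- Smooth paths are dense in the continuous ones. -/
theorem exists_coneIncl_near (hp : FMWith A p) (f : PathFunctor.cont.cone A) (k : ℕ) {ε : ℝ}
    (hε : 0 < ε) : ∃ x : PathFunctor.smooth.cone A, contConeSemi hp k (coneIncl A x - f) < ε := by
  let f' : C(unitInterval, A) := PathFunctor.cont.incl A f
  have hf0 : f' 0 = 0 := apply_kerIncl (PathFunctor.cont.ev0 A) f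
  have hlim := (tendsto_iff_of_nhds_eq (A := contPath A) (contSemi_nhds hp)).1
    (bernsteinApproximation_uniform f') k
  obtain ⟨n, hn⟩ := (hlim.eventually_lt_const hε).exists
  -- The Bernstein approximation is a finite sum of scalar polynomials times values of the path,
  -- hence smooth. It agrees with the path at `0`, so the starting point is kept.
  let x : smoothMaps A := ∑ i : Fin (n + 1), polyPath (bernsteinPolynomial ℝ n i)
    (f' (bernstein.z i))
  have hx : x.1 0 = bernsteinApproximation n f' := by
    refine ContinuousMap.ext fun t => ?_
    rw [bernsteinApproximation.apply]
    have : x.1 0 t = ∑ i : Fin (n + 1), (polyPath (bernsteinPolynomial ℝ n i)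
        (f' (bernstein.z i))).1 0 t := by
      have h1 : x.1 0 = ∑ i : Fin (n + 1), (polyPath (bernsteinPolynomial ℝ n i)
          (f' (bernstein.z i))).1 0 := by
        simp [x, Finset.sum_apply]
      rw [h1, ContinuousMap.sum_apply]
    rw [this]
    refine Finset.sum_congr rfl fun i _ => ?_
    rw [polyPath_apply, Complex.coe_smul]
    rfl
  have hx0 : PathFunctor.smooth.ev0 A (x : smoothMaps A) = 0 := by
    change x.1 0 0 = 0
    rw [hx, bernsteinApproximation.apply_zero, hf0]
  refine ⟨kerMk (PathFunctor.smooth.ev0 A) x hx0, ?_⟩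
  change contSemi hp k (x.1 0 - f') < ε
  rw [hx]
  exact hn

/-- Only finitely many derivatives enter for fixed `k`, so changing the weight costs a constant, as
long as the new weight is nonzero. -/
theorem exists_smoothSemi_le (hp : FMWith A p) (w : NNReal) {w' : NNReal} (hw' : w' ≠ 0) (k : ℕ) :
    ∃ M, 0 ≤ M ∧ ∀ F, smoothSemi hp w k F ≤ M * smoothSemi hp w' k F := by
  refine ⟨∑ j ∈ Finset.range (k + 1), ((w : ℝ) / w') ^ j,
    Finset.sum_nonneg fun j _ => by positivity, fun F => ?_⟩
  rw [smoothSemi_apply, smoothSemi_apply, Finset.mul_sum]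
  refine Finset.sum_le_sum fun j hj => ?_
  have h1 : ((w : ℝ) / w') ^ j ≤ ∑ j ∈ Finset.range (k + 1), ((w : ℝ) / w') ^ j :=
    Finset.single_le_sum (f := fun j => ((w : ℝ) / w') ^ j) (fun j _ => by positivity) hj
  have hw0 : (w' : ℝ) ≠ 0 := NNReal.coe_ne_zero.2 hw'
  have h2 : (w : ℝ) ^ j / j.factorial * contSemi hp k (F.1 j) =
      ((w : ℝ) / w') ^ j * ((w' : ℝ) ^ j / j.factorial * contSemi hp k (F.1 j)) := by
    rw [div_pow]; field_simp
  rw [h2]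
  exact mul_le_mul_of_nonneg_right h1 (by positivity)

/-- The underlying continuous map of a continuous path starting at `0`. -/
def conePath (x : PathFunctor.cont.cone A) : C(unitInterval, A) := PathFunctor.cont.incl A x

theorem conePath_zero (x : PathFunctor.cont.cone A) : conePath x 0 = 0 :=
  apply_kerIncl (PathFunctor.cont.ev0 A) x

theorem conePath_injective : Function.Injective (conePath (A := A)) :=
  kerIncl_injective (PathFunctor.cont.ev0 A)

/-- A continuous path starting at `0`. -/
def mkCone (f : C(unitInterval, A)) (h : f 0 = 0) : PathFunctor.cont.cone A :=
  kerMk (PathFunctor.cont.ev0 A) f h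

theorem cone_ext {x y : PathFunctor.cont.cone A} (h : ∀ t, conePath x t = conePath y t) : x = y :=
  conePath_injective (ContinuousMap.ext h)

/-! ### Contraction of the cone -/

/-- Contraction of continuous paths, `x ↦ (t ↦ x (s t))`. -/
def contract (A : LCAlg.{u}) (s : unitInterval) :
    PathFunctor.cont.cone A →ₙ+* PathFunctor.cont.cone A where
  toFun x := mkCone ((conePath x).comp ⟨fun t => s * t, by fun_prop⟩) (by
    change conePath x (s * 0) = 0
    rw [mul_zero, conePath_zero])
  map_zero' := rfl
  map_add' _ _ := rfl
  map_mul' _ _ := rfl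

theorem conePath_contract (s : unitInterval) (x : PathFunctor.cont.cone A) (t : unitInterval) :
    conePath (contract A s x) t = conePath x (s * t) := rfl

theorem contract_one (x : PathFunctor.cont.cone A) : contract A 1 x = x :=
  cone_ext fun t => by rw [conePath_contract, one_mul]

theorem contract_zero (x : PathFunctor.cont.cone A) : contract A 0 x = 0 :=
  cone_ext fun t => by rw [conePath_contract, zero_mul, conePath_zero]; rfl

theorem continuous_contConeSemi_contract (hp : FMWith A p) (k : ℕ)
    (x : PathFunctor.cont.cone A) (s : unitInterval) :
    Tendsto (fun s' => contConeSemi hp k (contract A s' x - contract A s x)) (𝓝 s) (𝓝 0) := by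
  let F : C(unitInterval × unitInterval, A) := (conePath x).comp ⟨fun z => z.1 * z.2, by fun_prop⟩
  have h := F.curry.continuous.tendsto s
  exact (tendsto_iff_of_nhds_eq (A := contPath A) (contSemi_nhds hp)).1 h k

/-- The contraction `s ↦ f (s ·)` joins the identity to `f` continuously for the given seminorm, so
`f` is a finite product of quotients of nearby members of this family. -/
theorem mem_closure_small (hp : FMWith A p) (m l : ℕ)
    (f : QUnit (Matrix (Fin m) (Fin m) (PathFunctor.cont.cone A))) :
    f ∈ Subgroup.closure {g : QUnit (Matrix (Fin m) (Fin m) (PathFunctor.cont.cone A)) |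
      matSemi m (contConeSemi hp l) g.val < 1 / 6} := by
  set S := Subgroup.closure {g : QUnit (Matrix (Fin m) (Fin m) (PathFunctor.cont.cone A)) |
      matSemi m (contConeSemi hp l) g.val < 1 / 6} with hS
  let g : unitInterval → QUnit (Matrix (Fin m) (Fin m) (PathFunctor.cont.cone A)) :=
    fun s => QUnit.map (matMap m (contract A s)) f
  have h1 : g 1 = f := QUnit.ext_val (Matrix.ext fun i j => contract_one _)
  have h0 : g 0 = 1 := QUnit.ext_val (Matrix.ext fun i j => contract_zero _)
  -- The relation "the quotient lies in `S`" is transitive and symmetric and holds for nearby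
  -- parameters, so it holds on the whole connected interval.
  have key := (isPreconnected_univ (α := unitInterval)).induction₂
    (fun s s' => (g s)⁻¹ * g s' ∈ S) (fun s _ => ?_) (fun x y z _ _ _ hxy hyz => ?_)
    (fun x y _ _ hxy => ?_) (Set.mem_univ 0) (Set.mem_univ 1)
  · simpa [h1, h0] using key
  · rw [nhdsWithin_univ]
    have ht : Tendsto (fun s' => (1 + matSemi m (contConeSemi hp l) (g s).inv) *
        ∑ i, ∑ j, contConeSemi hp l (contract A s' (f.val i j) - contract A s (f.val i j)))
        (𝓝 s) (𝓝 ((1 + matSemi m (contConeSemi hp l) (g s).inv) *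
          ∑ _i : Fin m, ∑ _j : Fin m, 0)) :=
      (tendsto_finsetSum _ fun i _ => tendsto_finsetSum _ fun j _ =>
        continuous_contConeSemi_contract hp l _ s).const_mul _
    simp only [Finset.sum_const_zero, mul_zero] at ht
    filter_upwards [ht.eventually_lt_const (show (0 : ℝ) < 1 / 6 by norm_num)] with s' hs'
    refine Subgroup.subset_closure ?_
    exact (seminorm_inv_mul_le (matSemi_mul_le (hp.contCone.mul_le l)) (g s) (g s')).trans_lt hs'
  · have := S.mul_mem hxy hyz
    rwa [mul_assoc, mul_inv_cancel_left] at this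
  · have := S.inv_mem hxy
    rwa [mul_inv_rev, inv_inv] at this

theorem pathComparison (hp : FMWith A p) (m : ℕ) :
    PathComparison (fun k => matSemi m (smoothConeSemi hp k))
      (fun k => matSemi m (contConeSemi hp k)) (fun k => matSemi m (p k))
      (matAlgMap m (coneIncl A).toNonUnitalAlgHom)
      (matAlgMap m (PathFunctor.cont.tau A).toNonUnitalAlgHom) where
  fm_d := hp.smoothCone.matrix m
  fm_e := hp.contCone.matrix m
  fm_c := hp.matrix m
  j_le k := ⟨k, 1, fun X => matSemi_le_mul fun i j => by
    have := contSemi_le_smoothSemi hp one_ne_zero le_rfl (Nat.zero_le k)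
      (PathFunctor.smooth.incl A (X i j) : smoothMaps A)
    simpa using! this⟩
  ev_le k X := by
    have := matSemi_le_mul (p := p k) (q := contConeSemi hp k)
      (X := matAlgMap m (PathFunctor.cont.tau A).toNonUnitalAlgHom X) (Y := X) (M := 1)
      fun i j => by
        rw [one_mul]
        exact le_contSemi hp k (PathFunctor.cont.incl A (X i j) : C(unitInterval, A)) 1
    rwa [one_mul] at this
  dense Y l ε hε := by
    -- The summand `1` covers `m = 0` and makes the final inequality strict.
    have hδ : 0 < ε / ((m : ℝ) * m + 1) := by positivity
    choose x hx using fun i j => exists_coneIncl_near hp (Y i j) l hδ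
    refine ⟨Matrix.of x, ?_⟩
    have h1 : matSemi m (contConeSemi hp l)
        (matAlgMap m (coneIncl A).toNonUnitalAlgHom (Matrix.of x) - Y) ≤
        ∑ _i : Fin m, ∑ _j : Fin m, ε / ((m : ℝ) * m + 1) := by
      rw [matSemi_apply]
      exact Finset.sum_le_sum fun i _ => Finset.sum_le_sum fun j _ => (hx i j).le
    refine h1.trans_lt ?_
    simp only [Finset.sum_const, Finset.card_univ, Fintype.card_fin, nsmul_eq_mul]
    have : (m : ℝ) * (m * (ε / (m * m + 1))) = ε * ((m * m) / (m * m + 1)) := by ring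
    rw [this]
    refine mul_lt_of_lt_one_right hε ?_
    rw [div_lt_one (by positivity)]
    linarith
  scale k X r hr := by
    -- A single weight has to serve all entries of the matrix, whence the estimate for the sum over
    -- the entries.
    obtain ⟨w, hw, hlt⟩ := exists_smoothSemi_lt hp k (Finset.univ : Finset (Fin m × Fin m))
      (fun z => (PathFunctor.smooth.incl A (X z.1 z.2) : smoothMaps A)) (r := r) (by
        rw [Fintype.sum_prod_type]; exact hr)
    rw [Fintype.sum_prod_type] at hlt
    let q : Seminorm ℂ (PathFunctor.smooth.cone A) := kerSemi (PathFunctor.smooth.ev0 A)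
      (smoothSemi hp w) k
    obtain ⟨M, hM0, hM⟩ := exists_smoothSemi_le hp 1 hw k
    obtain ⟨M', -, hM'⟩ := exists_smoothSemi_le hp w (one_ne_zero) k
    refine ⟨matSemi m q, matSemi_mul_le fun x y => ?_, ⟨k, M', fun Y => ?_⟩, hlt.le, M, hM0,
      fun Y => ?_⟩
    · exact smoothSemi_mul_le hp w k _ _
    · exact matSemi_le_mul fun i j => hM' _
    · exact matSemi_le_mul fun i j => hM _
  section_ := by
    refine ⟨fun a => a.map linearCone, fun a => Matrix.ext fun i j => tau_linearCone _,
      fun k => ?_⟩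
    obtain ⟨M, hM0, hM⟩ := exists_smoothSemi_polyPath_le hp Polynomial.X k
    exact ⟨M, hM0, fun a => matSemi_le_mul fun i j => hM _⟩
  gen l f := mem_closure_small hp m l f

/-! ### Invertible matrices as quasi-units -/

/-- The group of quasi-units of the algebra of `m × m` matrices over `A`. -/
abbrev QM (m : ℕ) (A : LCAlg.{u}) : Type u := QUnit (Matrix (Fin m) (Fin m) A)

/-- Functoriality of quasi-units of matrices. -/
def QM.map (m : ℕ) (f : A →ₙ+* B) : QM m A →* QM m B := QUnit.map (matMap m f)

/-- A homomorphism as a homomorphism of non-unital rings. -/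
abbrev Hom.toRing (f : Hom A B) : A →ₙ+* B := (f.toNonUnitalAlgHom : A →ₙ+* B)

theorem exists_smooth_lift (hp : FMWith A p) {m : ℕ} (f : QM m (PathFunctor.cont.cone A)) :
    ∃ γ : QM m (PathFunctor.smooth.cone A),
      QM.map m (PathFunctor.smooth.tau A).toRing γ = QM.map m (PathFunctor.cont.tau A).toRing f := by
  obtain ⟨γ, hγ⟩ := (pathComparison hp m).exists_lift f
  exact ⟨γ, hγ⟩

end LCAlg

namespace LCAlg

variable {A B C : LCAlg.{u}} {p : ℕ → Seminorm ℂ A}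

/-! ### Loops -/

/-- The algebra of loops based at `0`. -/
def PathFunctor.loops (P : PathFunctor.{u}) (A : LCAlg.{u}) : LCAlg.{u} := ker (P.tau A)

/-- The inclusion of loops into paths starting at `0`. -/
abbrev PathFunctor.loopIncl (P : PathFunctor.{u}) (A : LCAlg.{u}) : Hom (P.loops A) (P.cone A) :=
  kerIncl (P.tau A)

/-- Functoriality of loop algebras. -/
def PathFunctor.loopMap (P : PathFunctor.{u}) (f : Hom A B) : Hom (P.loops A) (P.loops B) :=
  kerLift (P.tau B) ((P.coneMap f).comp (P.loopIncl A)) fun c =>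
    (P.tau_coneMap f _).trans ((congrArg f (apply_kerIncl (P.tau A) c)).trans (map_zero f))

/-- The inclusion of smooth loops into continuous loops. -/
def loopCmp (A : LCAlg.{u}) : Hom (PathFunctor.smooth.loops A) (PathFunctor.cont.loops A) :=
  kerLift (PathFunctor.cont.tau A) ((coneIncl A).comp (PathFunctor.smooth.loopIncl A))
    fun c => (tau_coneIncl A _).trans (apply_kerIncl (PathFunctor.smooth.tau A) c)

/-- The underlying continuous map of a loop. -/
def loopPath (x : PathFunctor.cont.loops A) : C(unitInterval, A) :=
  conePath (PathFunctor.cont.loopIncl A x)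

theorem loopPath_zero (x : PathFunctor.cont.loops A) : loopPath x 0 = 0 := conePath_zero _

theorem loopPath_one (x : PathFunctor.cont.loops A) : loopPath x 1 = 0 :=
  apply_kerIncl (PathFunctor.cont.tau A) x

/-- A continuous loop. -/
def mkLoop (f : C(unitInterval, A)) (h0 : f 0 = 0) (h1 : f 1 = 0) : PathFunctor.cont.loops A :=
  kerMk (PathFunctor.cont.tau A) (mkCone f h0) h1

theorem loop_ext {x y : PathFunctor.cont.loops A} (h : ∀ t, loopPath x t = loopPath y t) :
    x = y :=
  kerIncl_injective _ (cone_ext h)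

theorem continuous_conePath : Continuous (conePath (A := A)) := continuous_subtype_val

theorem continuous_mkCone {X : Type*} [TopologicalSpace X] {f : X → C(unitInterval, A)}
    (hf : Continuous f) (h0 : ∀ x, f x 0 = 0) : Continuous fun x => mkCone (f x) (h0 x) :=
  hf.subtype_mk _

theorem continuous_loopPath : Continuous (loopPath (A := A)) :=
  continuous_conePath.comp continuous_subtype_val

theorem continuous_mkLoop {X : Type*} [TopologicalSpace X] {f : X → C(unitInterval, A)}
    (hf : Continuous f) (h0 : ∀ x, f x 0 = 0) (h1 : ∀ x, f x 1 = 0) :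
    Continuous fun x => mkLoop (f x) (h0 x) (h1 x) :=
  (continuous_mkCone hf h0).subtype_mk _

/-- The sequence of derivatives of a smooth path starting at `0`. -/
def coneSeq (x : PathFunctor.smooth.cone A) : smoothMaps A := PathFunctor.smooth.incl A x

theorem coneSeq_zero (x : PathFunctor.smooth.cone A) : (coneSeq x).1 0 0 = 0 :=
  apply_kerIncl (PathFunctor.smooth.ev0 A) x

/-- A smooth path starting at `0`. -/
def mkSmoothCone (F : smoothMaps A) (h0 : F.1 0 0 = 0) : PathFunctor.smooth.cone A :=
  kerMk (PathFunctor.smooth.ev0 A) F h0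

theorem smoothCone_ext {x y : PathFunctor.smooth.cone A}
    (h : ∀ t, (coneSeq x).1 0 t = (coneSeq y).1 0 t) : x = y :=
  kerIncl_injective _ (smoothMaps_ext (A := A) (ContinuousMap.ext h))

theorem coneSeq_mul (x y : PathFunctor.smooth.cone A) (t : unitInterval) :
    (coneSeq (x * y)).1 0 t = (coneSeq x).1 0 t * (coneSeq y).1 0 t := by
  have : (coneSeq (x * y)).1 0 = (coneSeq x).1 0 * (coneSeq y).1 0 :=
    smoothMaps_mul_zero (coneSeq x) (coneSeq y)
  rw [this]; rfl

/-- The sequence of derivatives of a smooth loop. -/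
def loopSeq (x : PathFunctor.smooth.loops A) : smoothMaps A :=
  coneSeq (PathFunctor.smooth.loopIncl A x)

theorem loopSeq_zero (x : PathFunctor.smooth.loops A) : (loopSeq x).1 0 0 = 0 := coneSeq_zero _

theorem loopSeq_one (x : PathFunctor.smooth.loops A) : (loopSeq x).1 0 1 = 0 :=
  apply_kerIncl (PathFunctor.smooth.tau A) x

/-- A smooth loop. -/
def mkSmoothLoop (F : smoothMaps A) (h0 : F.1 0 0 = 0) (h1 : F.1 0 1 = 0) :
    PathFunctor.smooth.loops A :=
  kerMk (PathFunctor.smooth.tau A) (mkSmoothCone F h0) h1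

theorem smoothLoop_ext {x y : PathFunctor.smooth.loops A}
    (h : ∀ t, (loopSeq x).1 0 t = (loopSeq y).1 0 t) : x = y :=
  kerIncl_injective _ (smoothCone_ext h)

theorem loopSeq_mul (x y : PathFunctor.smooth.loops A) (t : unitInterval) :
    (loopSeq (x * y)).1 0 t = (loopSeq x).1 0 t * (loopSeq y).1 0 t :=
  coneSeq_mul _ _ t

theorem continuous_loopSeq (n : ℕ) :
    Continuous fun x : PathFunctor.smooth.loops A => (loopSeq x).1 n := by
  have h : Continuous fun F : smoothMaps A => F.1 n :=
    (continuous_apply n).comp continuous_subtype_val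
  exact h.comp ((PathFunctor.smooth.incl A).continuous.comp
    (PathFunctor.smooth.loopIncl A).continuous)

theorem continuous_mkSmoothCone {X : Type*} [TopologicalSpace X] {F : X → smoothMaps A}
    (hF : ∀ n, Continuous fun x => (F x).1 n) (h0 : ∀ x, (F x).1 0 0 = 0) :
    Continuous fun x => mkSmoothCone (F x) (h0 x) := by
  have h : Continuous F := continuous_induced_rng.2 (continuous_pi hF)
  exact h.subtype_mk _

theorem continuous_mkSmoothLoop {X : Type*} [TopologicalSpace X] {F : X → smoothMaps A}
    (hF : ∀ n, Continuous fun x => (F x).1 n) (h0 : ∀ x, (F x).1 0 0 = 0)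
    (h1 : ∀ x, (F x).1 0 1 = 0) : Continuous fun x => mkSmoothLoop (F x) (h0 x) (h1 x) :=
  (continuous_mkSmoothCone hF h0).subtype_mk _

theorem FMWith.contLoops (hp : FMWith A p) : FMWith (PathFunctor.cont.loops A)
    (kerSemi (PathFunctor.cont.tau A) (contConeSemi hp)) :=
  hp.contCone.ker _

theorem FMWith.smoothLoops (hp : FMWith A p) : FMWith (PathFunctor.smooth.loops A)
    (kerSemi (PathFunctor.smooth.tau A) (smoothConeSemi hp)) :=
  hp.smoothCone.ker _

/-- Evaluation of continuous paths. -/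
def evalCone (A : LCAlg.{u}) (u : unitInterval) : Hom (PathFunctor.cont.cone A) A where
  toFun x := conePath x u
  map_smul' _ _ := rfl
  map_zero' := rfl
  map_add' _ _ := rfl
  map_mul' _ _ := rfl
  cont := (continuous_eval_const (F := C(unitInterval, A)) u).comp continuous_conePath

/-- The smooth map induced by a homomorphism. -/
def mapSeq (f : Hom A B) (F : smoothMaps A) : smoothMaps B := PathFunctor.smooth.map f F

theorem mapSeq_apply (f : Hom A B) (F : smoothMaps A) (n : ℕ) (t : unitInterval) :
    (mapSeq f F).1 n t = f (F.1 n t) := rfl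

/-! ### Interchanging two path variables -/

theorem continuous_swap_aux (n : ℕ) : Continuous fun z : (PathFunctor.smooth.loops
    (PathFunctor.cont.cone A) × unitInterval) × unitInterval =>
      conePath ((loopSeq z.1.1).1 n z.2) z.1.2 := by
  have h1 : Continuous fun z : (PathFunctor.smooth.loops
      (PathFunctor.cont.cone A) × unitInterval) × unitInterval => (loopSeq z.1.1).1 n :=
    (continuous_loopSeq n).comp (continuous_fst.comp continuous_fst)
  exact (continuous_conePath.comp (h1.eval continuous_snd)).eval
    (continuous_snd.comp continuous_fst)

theorem continuous_swap_aux' : Continuous fun z : PathFunctor.smooth.loops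
    (PathFunctor.cont.cone A) × unitInterval =>
      mkSmoothLoop (mapSeq (evalCone A z.2) (loopSeq z.1))
        (by rw [mapSeq_apply, loopSeq_zero, map_zero])
        (by rw [mapSeq_apply, loopSeq_one, map_zero]) :=
  continuous_mkSmoothLoop (fun n => ContinuousMap.continuous_of_continuous_uncurry _
    (continuous_swap_aux n)) _ _

/-- Smooth loops of continuous paths as continuous paths of smooth loops. -/
def swapSmoothCont (A : LCAlg.{u}) : Hom (PathFunctor.smooth.loops (PathFunctor.cont.cone A))
    (PathFunctor.cont.cone (PathFunctor.smooth.loops A)) where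
  toFun Y := mkCone ⟨fun u => mkSmoothLoop (mapSeq (evalCone A u) (loopSeq Y))
      (by rw [mapSeq_apply, loopSeq_zero, map_zero])
      (by rw [mapSeq_apply, loopSeq_one, map_zero]),
      continuous_swap_aux'.comp (Continuous.prodMk_right Y)⟩
    (smoothLoop_ext fun t => conePath_zero _)
  map_smul' _ _ := cone_ext fun _ => smoothLoop_ext fun _ => rfl
  map_zero' := cone_ext fun _ => smoothLoop_ext fun _ => rfl
  map_add' _ _ := cone_ext fun _ => smoothLoop_ext fun _ => rfl
  map_mul' X Y := cone_ext fun u => smoothLoop_ext fun t => by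
    change conePath ((loopSeq (X * Y)).1 0 t) u = (loopSeq (mkSmoothLoop _ _ _ *
      mkSmoothLoop _ _ _)).1 0 t
    rw [loopSeq_mul, loopSeq_mul]
    rfl
  cont := continuous_mkCone (ContinuousMap.continuous_of_continuous_uncurry _
    continuous_swap_aux') _

/-- Smooth loops of continuous loops as continuous loops of smooth loops. -/
def swapLoops (A : LCAlg.{u}) : Hom (PathFunctor.smooth.loops (PathFunctor.cont.loops A))
    (PathFunctor.cont.loops (PathFunctor.smooth.loops A)) :=
  kerLift _ ((swapSmoothCont A).comp
    (PathFunctor.smooth.loopMap (PathFunctor.cont.loopIncl A))) fun Y =>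
      smoothLoop_ext fun t => loopPath_one ((loopSeq Y).1 0 t)

theorem continuous_swap_inv (n : ℕ) : Continuous fun z : (PathFunctor.cont.loops
    (PathFunctor.smooth.loops A) × unitInterval) × unitInterval =>
      (loopSeq (loopPath z.1.1 z.2)).1 n z.1.2 := by
  have h1 : Continuous fun z : (PathFunctor.cont.loops
      (PathFunctor.smooth.loops A) × unitInterval) × unitInterval => loopPath z.1.1 z.2 :=
    (continuous_loopPath.comp (continuous_fst.comp continuous_fst)).eval continuous_snd
  exact ((continuous_loopSeq n).comp h1).eval (continuous_snd.comp continuous_fst)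

theorem continuous_swap_inv' (n : ℕ) : Continuous fun z : PathFunctor.cont.loops
    (PathFunctor.smooth.loops A) × unitInterval =>
      mkLoop ⟨fun u => (loopSeq (loopPath z.1 u)).1 n z.2,
        (continuous_swap_inv n).comp (Continuous.prodMk_right z)⟩
        (by change (loopSeq (loopPath z.1 0)).1 n z.2 = 0; rw [loopPath_zero]; rfl)
        (by change (loopSeq (loopPath z.1 1)).1 n z.2 = 0; rw [loopPath_one]; rfl) :=
  continuous_mkLoop (ContinuousMap.continuous_of_continuous_uncurry _ (continuous_swap_inv n)) _ _

/-- The sequence of derivatives of a continuous loop of smooth loops with respect to the smooth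
variable. -/
def swapSeq (hp : FMWith A p) (X : PathFunctor.cont.loops (PathFunctor.smooth.loops A)) :
    smoothMaps (PathFunctor.cont.loops A) :=
  ⟨fun n => ⟨fun t => mkLoop ⟨fun u => (loopSeq (loopPath X u)).1 n t,
      (continuous_swap_inv n).comp (Continuous.prodMk_right (X, t))⟩
        (by change (loopSeq (loopPath X 0)).1 n t = 0; rw [loopPath_zero]; rfl)
        (by change (loopSeq (loopPath X 1)).1 n t = 0; rw [loopPath_one]; rfl),
      (continuous_swap_inv' n).comp (Continuous.prodMk_right X)⟩,
    fun n => hasPathDeriv_of_quadratic hp.contLoops fun k => by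
      -- The second derivatives for all `u` form a compact family, so the Taylor bound is uniform in
      -- `u`; this gives differentiability in the sup seminorm over `u`.
      let c : C(unitInterval, contPath A) := ⟨fun u => (loopSeq (loopPath X u)).1 (n + 2),
        (continuous_loopSeq (n + 2)).comp (loopPath X).continuous⟩
      refine ⟨contSemi hp.contPath k c, fun s t => contSemi_le hp k _ fun u => ?_⟩
      refine (smoothMaps_taylor hp (loopSeq (loopPath X u)) n k s t).trans ?_
      exact mul_le_mul_of_nonneg_right (le_contSemi hp.contPath k c u) (sq_nonneg _)⟩

/-- Continuous loops of smooth loops as smooth loops of continuous loops. -/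
def swapLoopsInv (hp : FMWith A p) :
    Hom (PathFunctor.cont.loops (PathFunctor.smooth.loops A))
      (PathFunctor.smooth.loops (PathFunctor.cont.loops A)) where
  toFun X := mkSmoothLoop (swapSeq hp X)
    (loop_ext fun u => loopSeq_zero (loopPath X u))
    (loop_ext fun u => loopSeq_one (loopPath X u))
  map_smul' _ _ := smoothLoop_ext fun _ => loop_ext fun _ => rfl
  map_zero' := smoothLoop_ext fun _ => loop_ext fun _ => rfl
  map_add' _ _ := smoothLoop_ext fun _ => loop_ext fun _ => rfl
  map_mul' X Y := smoothLoop_ext fun t => loop_ext fun u => by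
    change (loopSeq (loopPath X u * loopPath Y u)).1 0 t = loopPath ((loopSeq (mkSmoothLoop _ _ _ *
      mkSmoothLoop _ _ _)).1 0 t) u
    rw [loopSeq_mul, loopSeq_mul]
    rfl
  cont := continuous_mkSmoothLoop
    (fun n => ContinuousMap.continuous_of_continuous_uncurry _ (continuous_swap_inv' n)) _ _

theorem continuous_swapCont : Continuous fun z : (PathFunctor.cont.loops
    (PathFunctor.cont.loops A) × unitInterval) × unitInterval =>
      loopPath (loopPath z.1.1 z.2) z.1.2 := by
  have h1 : Continuous fun z : (PathFunctor.cont.loops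
      (PathFunctor.cont.loops A) × unitInterval) × unitInterval => loopPath z.1.1 z.2 :=
    (continuous_loopPath.comp (continuous_fst.comp continuous_fst)).eval continuous_snd
  exact (continuous_loopPath.comp h1).eval (continuous_snd.comp continuous_fst)

/-- The continuous loop `u ↦ X(u)(t)`. -/
def swapContAt (X : PathFunctor.cont.loops (PathFunctor.cont.loops A)) (t : unitInterval) :
    PathFunctor.cont.loops A :=
  mkLoop ⟨fun u => loopPath (loopPath X u) t,
      continuous_swapCont.comp (Continuous.prodMk_right (X, t))⟩
    (by change loopPath (loopPath X 0) t = 0; rw [loopPath_zero]; rfl)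
    (by change loopPath (loopPath X 1) t = 0; rw [loopPath_one]; rfl)

theorem continuous_swapContAt : Continuous fun z : PathFunctor.cont.loops
    (PathFunctor.cont.loops A) × unitInterval => swapContAt z.1 z.2 :=
  continuous_mkLoop (ContinuousMap.continuous_of_continuous_uncurry _ continuous_swapCont) _ _

/-- The loop of loops with interchanged variables. -/
def swapContFun (X : PathFunctor.cont.loops (PathFunctor.cont.loops A)) :
    PathFunctor.cont.loops (PathFunctor.cont.loops A) :=
  mkLoop ⟨swapContAt X, continuous_swapContAt.comp (Continuous.prodMk_right X)⟩
    (loop_ext fun u => loopPath_zero (loopPath X u))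
    (loop_ext fun u => loopPath_one (loopPath X u))

theorem continuous_swapContFun : Continuous (swapContFun (A := A)) :=
  continuous_mkLoop (ContinuousMap.continuous_of_continuous_uncurry
    (fun X => ⟨swapContAt X, continuous_swapContAt.comp (Continuous.prodMk_right X)⟩)
    continuous_swapContAt) _ _

/-- Interchange of the two variables of a continuous loop of continuous loops. -/
def swapCont (A : LCAlg.{u}) : Hom (PathFunctor.cont.loops (PathFunctor.cont.loops A))
    (PathFunctor.cont.loops (PathFunctor.cont.loops A)) where
  toFun := swapContFun
  map_smul' _ _ := loop_ext fun _ => loop_ext fun _ => rfl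
  map_zero' := loop_ext fun _ => loop_ext fun _ => rfl
  map_add' _ _ := loop_ext fun _ => loop_ext fun _ => rfl
  map_mul' _ _ := loop_ext fun _ => loop_ext fun _ => rfl
  cont := continuous_swapContFun

/-! ### Rescaling of smooth paths -/

theorem continuous_rescale_aux (F : smoothMaps A) (n : ℕ) :
    Continuous fun z : unitInterval × unitInterval =>
      (((z.2 : ℝ) ^ n : ℝ) : ℂ) • F.1 n (z.1 * z.2) := by
  have h1 : Continuous fun z : unitInterval × unitInterval => (((z.2 : ℝ) ^ n : ℝ) : ℂ) := by
    fun_prop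
  exact h1.smul ((F.1 n).continuous.comp (continuous_fst.mul continuous_snd))

/-- The smooth path `t ↦ (u ↦ F (t u))` of continuous paths. -/
def rescaleSeq (hp : FMWith A p) (F : smoothMaps A) (h0 : F.1 0 0 = 0) :
    smoothMaps (PathFunctor.cont.cone A) :=
  have hz : ∀ (n : ℕ) (t : unitInterval), ((((0 : unitInterval) : ℝ) ^ n : ℝ) : ℂ) •
      F.1 n (t * 0) = 0 := fun n t => by
    cases n with
    | zero => rw [mul_zero, h0, smul_zero]
    | succ n => simp
  ⟨fun n => ⟨fun t => mkCone ⟨fun u => (((u : ℝ) ^ n : ℝ) : ℂ) • F.1 n (t * u),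
      (continuous_rescale_aux F n).comp (Continuous.prodMk_right t)⟩ (hz n t),
      continuous_mkCone (ContinuousMap.continuous_of_continuous_uncurry _
        (continuous_rescale_aux F n)) (hz n)⟩,
    fun n => hasPathDeriv_of_quadratic hp.contCone fun k => by
      refine ⟨contSemi hp k (F.1 (n + 2)), fun s t => contSemi_le hp k _ fun u => ?_⟩
      -- By the chain rule the `n`-th derivative in `t` is `u ^ n` times `F.1 n (t * u)`. Taylor's
      -- remainder at the points `s u` and `t u` carries a factor `u ^ 2`, and both powers of `u`
      -- are at most `1`, which gives a bound uniform in `u`.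
      have h := smoothMaps_taylor hp F n k (s * u) (t * u)
      change p k ((((u : ℝ) ^ n : ℝ) : ℂ) • F.1 n (s * u) - (((u : ℝ) ^ n : ℝ) : ℂ) • F.1 n (t * u)
        - (((s : ℝ) - t : ℝ) : ℂ) • (((u : ℝ) ^ (n + 1) : ℝ) : ℂ) • F.1 (n + 1) (t * u)) ≤ _
      have e : (((u : ℝ) ^ n : ℝ) : ℂ) • F.1 n (s * u) - (((u : ℝ) ^ n : ℝ) : ℂ) • F.1 n (t * u)
        - (((s : ℝ) - t : ℝ) : ℂ) • (((u : ℝ) ^ (n + 1) : ℝ) : ℂ) • F.1 (n + 1) (t * u) =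
        (((u : ℝ) ^ n : ℝ) : ℂ) • (F.1 n (s * u) - F.1 n (t * u) -
          ((((s * u : unitInterval) : ℝ) - (t * u : unitInterval) : ℝ) : ℂ) •
            F.1 (n + 1) (t * u)) := by
        rw [smul_sub, smul_sub, smul_smul, smul_smul]
        congr 2
        push_cast
        ring
      rw [e, map_smul_eq_mul, Complex.norm_real, Real.norm_of_nonneg (pow_nonneg u.2.1 n)]
      have hu0 : (0 : ℝ) ≤ u := u.2.1
      have hu1 : (u : ℝ) ≤ 1 := u.2.2
      have h1 : (u : ℝ) ^ n ≤ 1 := pow_le_one₀ hu0 hu1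
      have h2 : (u : ℝ) ^ 2 ≤ 1 := pow_le_one₀ hu0 hu1
      refine (mul_le_of_le_one_left (apply_nonneg _ _) h1).trans (h.trans ?_)
      refine mul_le_mul_of_nonneg_left ?_ (apply_nonneg _ _)
      have e2 : (((s * u : unitInterval) : ℝ) - (t * u : unitInterval)) ^ 2 =
        ((s : ℝ) - t) ^ 2 * (u : ℝ) ^ 2 := by push_cast; ring
      rw [e2]
      exact mul_le_of_le_one_right (sq_nonneg _) h2⟩

theorem rescaleSeq_apply (hp : FMWith A p) (F : smoothMaps A) (h0 : F.1 0 0 = 0)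
    (t u : unitInterval) : conePath ((rescaleSeq hp F h0).1 0 t) u = F.1 0 (t * u) := by
  change ((((u : ℝ) ^ 0 : ℝ) : ℂ)) • F.1 0 (t * u) = _
  simp

/-- The path `t ↦ (u ↦ x (t u))`. -/
def rescaleFun (hp : FMWith A p) (x : PathFunctor.smooth.cone A) :
    PathFunctor.smooth.cone (PathFunctor.cont.cone A) :=
  mkSmoothCone (rescaleSeq hp (coneSeq x) (coneSeq_zero x)) (cone_ext fun u =>
    (rescaleSeq_apply hp (coneSeq x) (coneSeq_zero x) 0 u).trans (by
      rw [zero_mul]; exact coneSeq_zero x))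

theorem rescaleFun_apply (hp : FMWith A p) (x : PathFunctor.smooth.cone A) (t u : unitInterval) :
    conePath ((coneSeq (rescaleFun hp x)).1 0 t) u = (coneSeq x).1 0 (t * u) :=
  rescaleSeq_apply hp (coneSeq x) (coneSeq_zero x) t u

/-- The homomorphism `x ↦ (t ↦ (u ↦ x (t u)))` from smooth paths to smooth paths of continuous
paths. -/
def rescale (hp : FMWith A p) : PathFunctor.smooth.cone A →ₙ+*
    PathFunctor.smooth.cone (PathFunctor.cont.cone A) where
  toFun := rescaleFun hp
  map_zero' := smoothCone_ext fun t => cone_ext fun u => rescaleFun_apply hp 0 t u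
  map_add' x y := smoothCone_ext fun t => cone_ext fun u =>
    (rescaleFun_apply hp (x + y) t u).trans (congrArg₂ (· + ·) (rescaleFun_apply hp x t u)
      (rescaleFun_apply hp y t u)).symm
  map_mul' x y := smoothCone_ext fun t => cone_ext fun u => by
    rw [coneSeq_mul]
    exact ((rescaleFun_apply hp (x * y) t u).trans (coneSeq_mul x y _)).trans
      (congrArg₂ (· * ·) (rescaleFun_apply hp x t u) (rescaleFun_apply hp y t u)).symm

theorem rescale_apply (hp : FMWith A p) (x : PathFunctor.smooth.cone A) (t u : unitInterval) :
    conePath ((coneSeq (rescale hp x)).1 0 t) u = (coneSeq x).1 0 (t * u) :=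
  rescaleFun_apply hp x t u

end LCAlg

namespace LCAlg

variable {A B C : LCAlg.{u}} {p : ℕ → Seminorm ℂ A} {m : ℕ}

/-! ### Quasi-units of matrices -/

theorem QM.ext {x y : QM m A} (h : ∀ i j, x.val i j = y.val i j) : x = y :=
  QUnit.ext_val (Matrix.ext h)

theorem QM.val_congr {x y : QM m A} (h : x = y) (i j : Fin m) : x.val i j = y.val i j := by
  rw [h]

theorem QM.map_injective {f : A →ₙ+* B} (hf : Function.Injective f) :
    Function.Injective (QM.map m f) := QUnit.map_injective (matMap_injective hf)

theorem QM.exists_of_map_eq_one (f : Hom A B) (x : QM m A) (h : QM.map m f.toRing x = 1) :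
    ∃ y : QM m (ker f), QM.map m (kerIncl f).toRing y = x := by
  have h' : QM.map m f.toRing x⁻¹ = 1 := by rw [map_inv, h, inv_one]
  exact QUnit.exists_lift (matMap_injective (kerIncl_injective f)) x
    ⟨Matrix.of fun i j => kerMk f (x.val i j) (QM.val_congr h i j), rfl⟩
    ⟨Matrix.of fun i j => kerMk f (x.inv i j) (QM.val_congr h' i j), rfl⟩

/-- The matrices which are connected to the identity by a continuous path. -/
def nullSub (m : ℕ) (B : LCAlg.{u}) : Subgroup (QM m B) :=
  (QM.map m (PathFunctor.cont.tau B).toRing).range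

theorem map_mem_nullSub (f : Hom A B) {x : QM m A} (hx : x ∈ nullSub m A) :
    QM.map m f.toRing x ∈ nullSub m B := by
  obtain ⟨F, rfl⟩ := hx
  exact ⟨QM.map m (PathFunctor.cont.coneMap f).toRing F,
    QM.ext fun i j => PathFunctor.cont.tau_coneMap f (F.val i j)⟩

/-- A free path is divided by the constant path at its starting point, which makes it start at the
identity. -/
theorem inv_mul_mem_nullSub_of_path (H : QM m (PathFunctor.cont.obj B)) :
    (QM.map m (PathFunctor.cont.ev0 B).toRing H)⁻¹ * QM.map m (PathFunctor.cont.ev1 B).toRing H ∈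
      nullSub m B := by
  set g := QM.map m (PathFunctor.cont.ev0 B).toRing H with hg
  have h0 : QM.map m (PathFunctor.cont.ev0 B).toRing
      ((QM.map m (PathFunctor.cont.const B).toRing g)⁻¹ * H) = 1 := by
    rw [map_mul, map_inv, ← hg]
    exact inv_mul_cancel g
  obtain ⟨y, hy⟩ := QM.exists_of_map_eq_one (PathFunctor.cont.ev0 B) _ h0
  refine ⟨y, ?_⟩
  have h1 : QM.map m (PathFunctor.cont.tau B).toRing y = QM.map m (PathFunctor.cont.ev1 B).toRing
      (QM.map m (kerIncl (PathFunctor.cont.ev0 B)).toRing y) := rfl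
  rw [h1, hy, map_mul, map_inv]
  rfl

/-! ### Bijectivity modulo null-homotopic matrices -/

/-- The map induced by `φ` on invertible matrices modulo null-homotopic ones is bijective. -/
def KBij (φ : Hom A B) : Prop := ∀ m : ℕ,
  (∀ y : QM m B, ∃ x : QM m A, (QM.map m φ.toRing x)⁻¹ * y ∈ nullSub m B) ∧
    ∀ x : QM m A, QM.map m φ.toRing x ∈ nullSub m B → x ∈ nullSub m A

theorem KBij.comp {g : Hom B C} {f : Hom A B} (hg : KBij g) (hf : KBij f) : KBij (g.comp f) := by
  refine fun m => ⟨fun z => ?_, fun x hx => (hf m).2 x ((hg m).2 _ hx)⟩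
  obtain ⟨y, hy⟩ := (hg m).1 z
  obtain ⟨x, hx⟩ := (hf m).1 y
  refine ⟨x, ?_⟩
  have := (nullSub m C).mul_mem (map_mem_nullSub g hx) hy
  rwa [map_mul, map_inv, mul_assoc, mul_inv_cancel_left] at this

theorem KBij.of_inverse {f : Hom A B} {g : Hom B A} (hgf : ∀ a, g (f a) = a)
    (hfg : ∀ b, f (g b) = b) : KBij f := by
  refine fun m => ⟨fun y => ⟨QM.map m g.toRing y, ?_⟩, fun x hx => ?_⟩
  · have : QM.map m f.toRing (QM.map m g.toRing y) = y := QM.ext fun i j => hfg _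
    rw [this, inv_mul_cancel]
    exact one_mem _
  · have : QM.map m g.toRing (QM.map m f.toRing x) = x := QM.ext fun i j => hgf _
    rw [← this]
    exact map_mem_nullSub g hx

/-- Bijectivity modulo null-homotopic matrices after applying the loop functor `j` times. -/
def KBijLoops : ∀ (_ : ℕ) {A B : LCAlg.{u}}, Hom A B → Prop
  | 0, _, _, φ => KBij φ
  | j + 1, _, _, φ => KBijLoops j (PathFunctor.cont.loopMap φ)

theorem KBijLoops.comp {j : ℕ} : ∀ {A B C : LCAlg.{u}} {g : Hom B C} {f : Hom A B},
    KBijLoops j g → KBijLoops j f → KBijLoops j (g.comp f) := by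
  induction j with
  | zero => exact fun hg hf => KBij.comp hg hf
  | succ j ih => exact fun hg hf => ih (A := PathFunctor.cont.loops _) hg hf

theorem KBijLoops.of_inverse {j : ℕ} : ∀ {A B : LCAlg.{u}} {f : Hom A B} {g : Hom B A},
    (∀ a, g (f a) = a) → (∀ b, f (g b) = b) → KBijLoops j f := by
  induction j with
  | zero => exact fun hgf hfg => KBij.of_inverse hgf hfg
  | succ j ih =>
    intro A B f g hgf hfg
    exact ih (f := PathFunctor.cont.loopMap f) (g := PathFunctor.cont.loopMap g)
      (fun a => loop_ext fun t => hgf (loopPath a t)) fun b => loop_ext fun t => hfg (loopPath b t)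

/-! ### Smooth loops versus continuous loops -/

/-- The homomorphism `x ↦ (s ↦ (t ↦ x (s t)))`. -/
def contractPath (A : LCAlg.{u}) :
    PathFunctor.cont.cone A →ₙ+* PathFunctor.cont.cone (PathFunctor.cont.cone A) where
  toFun x := mkCone ⟨fun s => contract A s x, continuous_mkCone
    (ContinuousMap.continuous_of_continuous_uncurry
      (fun s : unitInterval => (conePath x).comp ⟨fun t => s * t, by fun_prop⟩)
      ((conePath x).continuous.comp continuous_mul)) _⟩ (contract_zero x)
  map_zero' := rfl
  map_add' _ _ := rfl
  map_mul' _ _ := rfl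

theorem tau_contractPath (x : PathFunctor.cont.cone A) :
    PathFunctor.cont.tau _ (contractPath A x) = x := contract_one x

/-- The function `u ↦ max (2 u - 1) 0`. -/
def lateRamp (u : unitInterval) : unitInterval := Set.projIcc 0 1 zero_le_one (2 * (u : ℝ) - 1)

/-- The function `u ↦ max (1 - 2 u) 0`. -/
def earlyRamp (u : unitInterval) : unitInterval := Set.projIcc 0 1 zero_le_one (1 - 2 * (u : ℝ))

theorem continuous_lateRamp : Continuous lateRamp :=
  continuous_projIcc.comp (by fun_prop)

theorem continuous_earlyRamp : Continuous earlyRamp :=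
  continuous_projIcc.comp (by fun_prop)

/-- Ensures that the initial point of each loop in the deformation of the square lies on one of the
two sides where the map vanishes. -/
theorem ramp_eq_zero (u : unitInterval) : lateRamp u = 0 ∨ earlyRamp u = 0 := by
  rcases le_total (2 * (u : ℝ)) 1 with h | h
  · exact Or.inl (Set.projIcc_of_le_left _ (by linarith))
  · exact Or.inr (Set.projIcc_of_le_left _ (by linarith))

theorem lateRamp_zero : lateRamp 0 = 0 := Set.projIcc_of_le_left _ (by simp)
theorem lateRamp_one : lateRamp 1 = 1 := Set.projIcc_of_right_le _ (by norm_num)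
theorem earlyRamp_zero : earlyRamp 0 = 1 := Set.projIcc_of_right_le _ (by simp)
theorem earlyRamp_one : earlyRamp 1 = 0 := Set.projIcc_of_le_left _ (by norm_num)

/-- The value of a map on the square at a corner. -/
abbrev tauTau (A : LCAlg.{u}) : Hom (PathFunctor.cont.cone (PathFunctor.cont.cone A)) A :=
  (PathFunctor.cont.tau A).comp (PathFunctor.cont.tau (PathFunctor.cont.cone A))

/-- The underlying function on the square. -/
def squareVal (G : ker (tauTau A)) (s t : unitInterval) : A :=
  conePath (conePath (kerIncl (tauTau A) G) s) t

theorem continuous_squareVal (G : ker (tauTau A)) :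
    Continuous fun z : unitInterval × unitInterval => squareVal G z.1 z.2 :=
  (continuous_conePath.comp ((conePath (kerIncl (tauTau A) G)).continuous.comp
    continuous_fst)).eval continuous_snd

theorem squareVal_zero_left (G : ker (tauTau A)) (t : unitInterval) : squareVal G 0 t = 0 := by
  have h : conePath (kerIncl (tauTau A) G) 0 = 0 := conePath_zero _
  have h2 : squareVal G 0 t = conePath (0 : PathFunctor.cont.cone A) t :=
    congrArg (fun y => conePath y t) h
  exact h2

theorem squareVal_zero_right (G : ker (tauTau A)) (s : unitInterval) : squareVal G s 0 = 0 :=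
  conePath_zero _

theorem squareVal_one_one (G : ker (tauTau A)) : squareVal G 1 1 = 0 :=
  apply_kerIncl (tauTau A) G

theorem continuous_squareHomotopy (G : ker (tauTau A)) :
    Continuous fun z : unitInterval × unitInterval =>
      squareVal G (max z.2 (lateRamp z.1)) (max z.2 (earlyRamp z.1)) :=
  (continuous_squareVal G).comp
    ((continuous_snd.max (continuous_lateRamp.comp continuous_fst)).prodMk
      (continuous_snd.max (continuous_earlyRamp.comp continuous_fst)))

/-- The deformation of one pair of sides of the square into the other one. -/
def squareLoop (G : ker (tauTau A)) (u : unitInterval) : PathFunctor.cont.loops A :=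
  mkLoop ⟨fun s => squareVal G (max s (lateRamp u)) (max s (earlyRamp u)),
    (continuous_squareHomotopy G).comp (Continuous.prodMk_right u)⟩
    (by
      -- At `s = 0` the point of the square is `(lateRamp u, earlyRamp u)`, which lies on an axis;
      -- at `s = 1` it is the corner `(1, 1)`.
      change squareVal G (max 0 _) (max 0 _) = 0
      rcases ramp_eq_zero u with h | h
      · rw [h, max_self, squareVal_zero_left]
      · rw [h, max_self, squareVal_zero_right])
    (by
      change squareVal G (max 1 _) (max 1 _) = 0
      rw [max_eq_left unitInterval.le_one', max_eq_left unitInterval.le_one', squareVal_one_one])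

theorem continuous_squareLoop (G : ker (tauTau A)) : Continuous (squareLoop G) :=
  continuous_mkLoop (ContinuousMap.continuous_of_continuous_uncurry
    (fun u => ⟨fun s => squareVal G (max s (lateRamp u)) (max s (earlyRamp u)),
      (continuous_squareHomotopy G).comp (Continuous.prodMk_right u)⟩)
    (continuous_squareHomotopy G)) _ _

/-- The homomorphism taking a map on the square to the path of loops given by deforming one pair
of sides of the square into the other one. -/
def squareHomotopy (A : LCAlg.{u}) : ker (tauTau A) →ₙ+* contPath (PathFunctor.cont.loops A) where
  toFun G := (⟨squareLoop G, continuous_squareLoop G⟩ : C(unitInterval, PathFunctor.cont.loops A))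
  map_zero' := ContinuousMap.ext fun _ => loop_ext fun _ => rfl
  map_add' _ _ := ContinuousMap.ext fun _ => loop_ext fun _ => rfl
  map_mul' _ _ := ContinuousMap.ext fun _ => loop_ext fun _ => rfl

theorem ev0_squareHomotopy (G : ker (tauTau A)) (s : unitInterval) :
    loopPath (PathFunctor.cont.ev0 _ (squareHomotopy A G)) s = squareVal G s 1 := by
  have : squareVal G (max s (lateRamp 0)) (max s (earlyRamp 0)) = squareVal G s 1 := by
    rw [lateRamp_zero, earlyRamp_zero, max_eq_left unitInterval.nonneg',
      max_eq_right unitInterval.le_one']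
  exact this

theorem ev1_squareHomotopy (G : ker (tauTau A)) (s : unitInterval) :
    loopPath (PathFunctor.cont.ev1 _ (squareHomotopy A G)) s = squareVal G 1 s := by
  have : squareVal G (max s (lateRamp 1)) (max s (earlyRamp 1)) = squareVal G 1 s := by
    rw [lateRamp_one, earlyRamp_one, max_eq_left (unitInterval.nonneg' (t := s)),
      max_eq_right unitInterval.le_one']
  exact this

/-- The loop `f`, seen as an element of the cone of `A`, is contracted to the identity there.
Lifting this contraction gives a smooth path `γ` in the cone of `A` ending at `f`. On the square
`(s, t) ↦ γ(s)(t)` the side `t = 1` is a smooth loop, the side `s = 1` is `f`, and one side deforms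
into the other. -/
theorem exists_smooth_loop (hp : FMWith A p) (f : QM m (PathFunctor.cont.loops A)) :
    ∃ h : QM m (PathFunctor.smooth.loops A),
      (QM.map m (loopCmp A).toRing h)⁻¹ * f ∈ nullSub m (PathFunctor.cont.loops A) := by
  set f1 := QM.map m (PathFunctor.cont.loopIncl A).toRing f with hf1
  have hτf : QM.map m (PathFunctor.cont.tau A).toRing f1 = 1 :=
    QM.ext fun i j => apply_kerIncl (PathFunctor.cont.tau A) (f.val i j)
  obtain ⟨γ, hγ⟩ := exists_smooth_lift hp.contCone (QM.map m (contractPath A) f1)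
  have hγ' : QM.map m (PathFunctor.smooth.tau _).toRing γ = f1 :=
    hγ.trans (QM.ext fun i j => tau_contractPath (f1.val i j))
  have h0 : QM.map m (PathFunctor.smooth.tau A).toRing
      (QM.map m (PathFunctor.smooth.coneMap (PathFunctor.cont.tau A)).toRing γ) = 1 := by
    rw [← hτf, ← hγ']
    exact QM.ext fun i j => PathFunctor.smooth.tau_coneMap (PathFunctor.cont.tau A) (γ.val i j)
  obtain ⟨h, hh⟩ := QM.exists_of_map_eq_one (PathFunctor.smooth.tau A) _ h0
  have h1 : QM.map m (tauTau A).toRing (QM.map m (coneIncl _).toRing γ) = 1 := by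
    rw [← hτf, ← hγ']
    rfl
  obtain ⟨G, hG⟩ := QM.exists_of_map_eq_one (tauTau A) _ h1
  refine ⟨h, ?_⟩
  have key := inv_mul_mem_nullSub_of_path (QM.map m (squareHomotopy A) G)
  have e0 : QM.map m (PathFunctor.cont.ev0 _).toRing (QM.map m (squareHomotopy A) G) =
      QM.map m (loopCmp A).toRing h := by
    refine QM.ext fun i j => loop_ext fun s => (ev0_squareHomotopy (G.val i j) s).trans ?_
    have a1 : kerIncl (tauTau A) (G.val i j) = coneIncl _ (γ.val i j) := QM.val_congr hG i j
    have a2 : PathFunctor.smooth.loopIncl A (h.val i j) =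
      PathFunctor.smooth.coneMap (PathFunctor.cont.tau A) (γ.val i j) := QM.val_congr hh i j
    have a3 : loopPath (loopCmp A (h.val i j)) s =
      (coneSeq (PathFunctor.smooth.loopIncl A (h.val i j))).1 0 s := rfl
    refine Eq.trans ?_ (a3.trans (by rw [a2])).symm
    rw [squareVal, a1]
    rfl
  have e1 : QM.map m (PathFunctor.cont.ev1 _).toRing (QM.map m (squareHomotopy A) G) = f := by
    refine QM.ext fun i j => loop_ext fun s => (ev1_squareHomotopy (G.val i j) s).trans ?_
    have a1 : kerIncl (tauTau A) (G.val i j) = coneIncl _ (γ.val i j) := QM.val_congr hG i j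
    have a2 : PathFunctor.smooth.tau _ (γ.val i j) = f1.val i j := QM.val_congr hγ' i j
    rw [squareVal, a1]
    exact congrArg (fun y => conePath y s) a2
  rwa [e0, e1] at key

/-- The inverse of the continuous null-homotopy is made smooth in its own parameter `t`, giving `M`
with values in continuous loops. Multiplied by `(t, u) ↦ h (t u)`, it becomes trivial at `t = 1`. At
`u = 1` the factor `M` disappears and `h` remains. Read as a path in `u`, the product joins the
identity to `h` through loops that are smooth in `t`. -/
theorem mem_nullSub_of_loopCmp_mem (hp : FMWith A p) (h : QM m (PathFunctor.smooth.loops A))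
    (hh : QM.map m (loopCmp A).toRing h ∈ nullSub m (PathFunctor.cont.loops A)) :
    h ∈ nullSub m (PathFunctor.smooth.loops A) := by
  obtain ⟨F, hF⟩ := hh
  obtain ⟨M, hM⟩ := exists_smooth_lift hp.contLoops F⁻¹
  rw [map_inv, hF] at hM
  set x := QM.map m (PathFunctor.smooth.loopIncl A).toRing h
  let K : QM m (PathFunctor.smooth.cone (PathFunctor.cont.cone A)) :=
    QM.map m (PathFunctor.smooth.coneMap (PathFunctor.cont.loopIncl A)).toRing M *
      QM.map m (rescale hp) x
  have t1 : QM.map m (PathFunctor.smooth.tau _).toRing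
      (QM.map m (PathFunctor.smooth.coneMap (PathFunctor.cont.loopIncl A)).toRing M) =
      (QM.map m (PathFunctor.cont.loopIncl A).toRing (QM.map m (loopCmp A).toRing h))⁻¹ := by
    rw [← map_inv, ← hM]
    exact QM.ext fun i j => PathFunctor.smooth.tau_coneMap (PathFunctor.cont.loopIncl A) (M.val i j)
  have t2 : QM.map m (PathFunctor.smooth.tau _).toRing (QM.map m (rescale hp) x) =
      QM.map m (PathFunctor.cont.loopIncl A).toRing (QM.map m (loopCmp A).toRing h) := by
    refine QM.ext fun i j => cone_ext fun u => (rescale_apply hp (x.val i j) 1 u).trans ?_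
    rw [one_mul]
    rfl
  -- At `t = 1` the factors are `h⁻¹` and `h`, so `K` consists of smooth loops in `t` with values in
  -- continuous paths in `u`.
  have hK : QM.map m (PathFunctor.smooth.tau _).toRing K = 1 := by
    rw [map_mul, t1, t2, inv_mul_cancel]
  obtain ⟨N, hN⟩ := QM.exists_of_map_eq_one (PathFunctor.smooth.tau _) K hK
  refine ⟨QM.map m (swapSmoothCont A).toRing N, ?_⟩
  apply QM.map_injective (f := (PathFunctor.smooth.loopIncl A).toRing)
    (kerIncl_injective (PathFunctor.smooth.tau A))
  have s1 : QM.map m (PathFunctor.smooth.loopIncl A).toRing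
      (QM.map m (PathFunctor.cont.tau _).toRing (QM.map m (swapSmoothCont A).toRing N)) =
      QM.map m (PathFunctor.smooth.coneMap (PathFunctor.cont.tau A)).toRing K := by
    rw [← hN]
    exact QM.ext fun i j => smoothCone_ext fun t => rfl
  have s2 : QM.map m (PathFunctor.smooth.coneMap (PathFunctor.cont.tau A)).toRing
      (QM.map m (PathFunctor.smooth.coneMap (PathFunctor.cont.loopIncl A)).toRing M) = 1 :=
    QM.ext fun i j => smoothCone_ext fun t => loopPath_one ((coneSeq (M.val i j)).1 0 t)
  have s3 : QM.map m (PathFunctor.smooth.coneMap (PathFunctor.cont.tau A)).toRing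
      (QM.map m (rescale hp) x) = x := by
    refine QM.ext fun i j => smoothCone_ext fun t => (rescale_apply hp (x.val i j) t 1).trans ?_
    rw [mul_one]
  rw [s1, map_mul, s2, s3, one_mul]

theorem kBij_loopCmp (hp : FMWith A p) : KBij (loopCmp A) :=
  fun _ => ⟨exists_smooth_loop hp, mem_nullSub_of_loopCmp_mem hp⟩

/-- Applying continuous loops to the comparison for `A` amounts, up to interchange of variables, to
the comparison for the algebra of continuous loops in `A`. This reduces `j + 1` to `j` for another
algebra, so the induction runs over all algebras at once. -/
theorem kBijLoops_loopCmp (j : ℕ) : ∀ {A : LCAlg.{u}} {p : ℕ → Seminorm ℂ A}, FMWith A p →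
    KBijLoops j (loopCmp A) := by
  induction j with
  | zero => exact fun hp => kBij_loopCmp hp
  | succ j ih =>
    intro A p hp
    have h1 : KBijLoops j (swapLoopsInv hp) := KBijLoops.of_inverse (g := swapLoops A)
      (fun X => loop_ext fun u => smoothLoop_ext fun t => rfl)
      fun Y => smoothLoop_ext fun t => loop_ext fun u => rfl
    have h2 : KBijLoops j (swapCont A) := KBijLoops.of_inverse (g := swapCont A)
      (fun X => loop_ext fun u => loop_ext fun t => rfl)
      fun Y => loop_ext fun t => loop_ext fun u => rfl
    have h3 : PathFunctor.cont.loopMap (loopCmp A) =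
        ((swapCont A).comp (loopCmp (PathFunctor.cont.loops A))).comp (swapLoopsInv hp) :=
      Hom.ext fun X => loop_ext fun u => loop_ext fun t => rfl
    change KBijLoops j (PathFunctor.cont.loopMap (loopCmp A))
    rw [h3]
    exact (h2.comp (ih hp.contLoops)).comp h1

/-! ### Iterated loops -/

/-- The iterated loop algebras. -/
def omega (P : PathFunctor.{u}) (A : LCAlg.{u}) : ℕ → LCAlg.{u}
  | 0 => A
  | n + 1 => P.loops (omega P A n)

/-- The inclusion of iterated smooth loops into iterated continuous loops. -/
def omegaCmp (A : LCAlg.{u}) :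
    ∀ n, Hom (omega PathFunctor.smooth A n) (omega PathFunctor.cont A n)
  | 0 => { NonUnitalAlgHom.id ℂ A with cont := continuous_id }
  | n + 1 => (PathFunctor.cont.loopMap (omegaCmp A n)).comp (loopCmp (omega PathFunctor.smooth A n))

theorem FMWith.omega_smooth (hp : FMWith A p) (n : ℕ) :
    ∃ q, FMWith (omega PathFunctor.smooth A n) q := by
  induction n with
  | zero => exact ⟨p, hp⟩
  | succ n ih =>
    obtain ⟨q, hq⟩ := ih
    exact ⟨_, hq.smoothLoops⟩

/-- All `j` are treated together, since `omegaCmp A (n + 1)` contains the continuous loops of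
`omegaCmp A n`. -/
theorem kBijLoops_omegaCmp (hp : FMWith A p) (n : ℕ) : ∀ j, KBijLoops j (omegaCmp A n) := by
  induction n with
  | zero => exact fun j => KBijLoops.of_inverse (g := omegaCmp A 0) (fun _ => rfl) fun _ => rfl
  | succ n ih =>
    intro j
    obtain ⟨q, hq⟩ := hp.omega_smooth n
    exact KBijLoops.comp (ih (j + 1)) (kBijLoops_loopCmp j hq)

end LCAlg

/-! ### Quasi-units and units -/

namespace QUnit

variable {R S : Type*} [NonUnitalRing R] [Ring S]

/-- The unit `1 + f x` defined by a quasi-unit `x`. -/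
def toUnits (f : R →ₙ+* S) : QUnit R →* Sˣ where
  toFun x :=
    { val := 1 + f x.val
      inv := 1 + f x.inv
      val_inv := by
        have h := congrArg f x.val_inv
        rw [map_add, map_add, map_mul, map_zero] at h
        calc (1 + f x.val) * (1 + f x.inv) = 1 + (f x.val + f x.inv + f x.val * f x.inv) := by
              noncomm_ring
          _ = 1 := by rw [h, add_zero]
      inv_val := by
        have h := congrArg f x.inv_val
        rw [map_add, map_add, map_mul, map_zero] at h
        calc (1 + f x.inv) * (1 + f x.val) = 1 + (f x.inv + f x.val + f x.inv * f x.val) := by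
              noncomm_ring
          _ = 1 := by rw [h, add_zero] }
  map_one' := Units.ext (by simp)
  map_mul' x y := Units.ext (by
    simp only [mul_val, map_add, map_mul, Units.val_mul]
    noncomm_ring)

theorem toUnits_injective {f : R →ₙ+* S} (hf : Function.Injective f) :
    Function.Injective (toUnits f) := fun _ _ h =>
  ext_val (hf (add_left_cancel (congrArg Units.val h)))

/-- The quasi-unit `g - 1` defined by a unit `g`. -/
def ofUnit (g : Sˣ) : QUnit S where
  val := g - 1
  inv := (g⁻¹ : Sˣ) - 1
  val_inv := by
    have h := g.mul_inv
    rw [sub_mul, mul_sub, h]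
    noncomm_ring
  inv_val := by
    have h := g.inv_mul
    rw [sub_mul, mul_sub, h]
    noncomm_ring

end QUnit

namespace LCAlg

variable {A B C : LCAlg.{u}} {m : ℕ}

/-- The inclusion of `A` into its unitization. -/
def inrHom (A : LCAlg.{u}) : A →ₙ+* Unitization ℂ A :=
  (Unitization.inrNonUnitalAlgHom ℂ A : A →ₙ+* Unitization ℂ A)

theorem inrHom_injective (A : LCAlg.{u}) : Function.Injective (inrHom A) :=
  Unitization.inr_injective

/-- The invertible matrix over the unitization defined by a quasi-unit. -/
def QM.toGLm (m : ℕ) (A : LCAlg.{u}) : QM m A →* GLm m A :=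
  (QUnit.toUnits (matMap m (inrHom A))).codRestrict (GLm m A) fun x => by
    refine Units.ext (Matrix.ext fun i j => ?_)
    change ((1 : Matrix (Fin m) (Fin m) (Unitization ℂ A)) i j + inrHom A (x.val i j)).fst =
      (1 : Matrix (Fin m) (Fin m) ℂ) i j
    rw [Unitization.fst_add, Matrix.one_apply, Matrix.one_apply]
    have : (inrHom A (x.val i j)).fst = 0 := Unitization.fst_inr ℂ _
    rw [this, add_zero]
    split_ifs <;> simp

theorem QM.toGLm_injective (m : ℕ) (A : LCAlg.{u}) : Function.Injective (QM.toGLm m A) :=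
  fun _ _ h => QUnit.toUnits_injective (matMap_injective (inrHom_injective A))
    (congrArg Subtype.val h)

/-- The scalar parts of `g` and of `g⁻¹` are the identity, so both `g - 1` and `g⁻¹ - 1` have
entries in `A`. -/
theorem QM.toGLm_surjective (m : ℕ) (A : LCAlg.{u}) : Function.Surjective (QM.toGLm m A) := by
  have key : ∀ g : GLm m A, (g.1.1 - 1 : Matrix (Fin m) (Fin m) (Unitization ℂ A)) ∈
      Set.range (matMap m (inrHom A)) := by
    intro g
    refine ⟨Matrix.of fun i j => (g.1.1 i j).snd, Matrix.ext fun i j => ?_⟩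
    have hg : unitsMat m (Unitization.fstHom ℂ A).toRingHom g.1 = 1 := g.2
    have h1 : (g.1.1 i j).fst = (1 : Matrix (Fin m) (Fin m) ℂ) i j :=
      congrFun (congrFun (show (unitsMat m (Unitization.fstHom ℂ A).toRingHom g.1).1 = 1 by
        rw [hg, Units.val_one]) i) j
    change (Unitization.inr (g.1.1 i j).snd : Unitization ℂ A) =
      g.1.1 i j - (1 : Matrix (Fin m) (Fin m) (Unitization ℂ A)) i j
    ext
    · rw [Unitization.fst_inr, sub_eq_add_neg, Unitization.fst_add, Unitization.fst_neg, h1,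
        Matrix.one_apply, Matrix.one_apply]
      split_ifs <;> simp
    · rw [Unitization.snd_inr, sub_eq_add_neg, Unitization.snd_add, Unitization.snd_neg,
        Matrix.one_apply]
      split_ifs <;> simp
  intro g
  obtain ⟨x, hx⟩ := QUnit.exists_lift (matMap_injective (m := m) (inrHom_injective A))
    (QUnit.ofUnit g.1) (key g) (key g⁻¹)
  refine ⟨x, Subtype.ext (Units.ext ?_)⟩
  have h : matMap m (inrHom A) x.val = g.1.1 - 1 := congrArg QUnit.val hx
  change 1 + matMap m (inrHom A) x.val = g.1.1
  rw [h, add_sub_cancel]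

theorem QM.map_toGLm (f : Hom A B) (x : QM m A) :
    GLm.map m f (QM.toGLm m A x) = QM.toGLm m B (QM.map m f.toRing x) := by
  refine Subtype.ext (Units.ext (Matrix.ext fun i j => ?_))
  change unitMap f ((1 : Matrix (Fin m) (Fin m) (Unitization ℂ A)) i j + inrHom A (x.val i j)) =
    (1 : Matrix (Fin m) (Fin m) (Unitization ℂ B)) i j + inrHom B (f (x.val i j))
  have h1 : unitMap f ((1 : Matrix (Fin m) (Fin m) (Unitization ℂ A)) i j) =
      (1 : Matrix (Fin m) (Fin m) (Unitization ℂ B)) i j := by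
    rw [Matrix.one_apply, Matrix.one_apply]
    split_ifs <;> simp
  rw [map_add, h1]
  congr 1
  ext
  · rw [unitMap_fst]; exact (Unitization.fst_inr ℂ _).trans (Unitization.fst_inr ℂ _).symm
  · rw [unitMap_snd]; rfl

/-- The class in `GL(A)` of a quasi-unit. -/
def QM.toStGL (m : ℕ) (A : LCAlg.{u}) : QM m A →* StGL A where
  toFun x := StGL.mk m (QM.toGLm m A x)
  map_one' := by rw [map_one, StGL.mk_one]
  map_mul' x y := by rw [map_mul, StGL.mk_mul]

theorem QM.toStGL_injective (m : ℕ) (A : LCAlg.{u}) : Function.Injective (QM.toStGL m A) :=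
  (StGL.mk_injective m).comp (QM.toGLm_injective m A)

theorem QM.map_toStGL (f : Hom A B) (x : QM m A) :
    StGL.map f (QM.toStGL m A x) = QM.toStGL m B (QM.map m f.toRing x) :=
  congrArg (StGL.mk m) (QM.map_toGLm f x)

/-! ### Representing stable classes by quasi-units -/

theorem StGL.mk_stabGL {i j : ℕ} (h : i ≤ j) (g : GLm i A) :
    StGL.mk j (stabGL A i j h g) = StGL.mk i g :=
  (DirectLimit.eq_of_le (F := fun m => GLm m A) (f := fun i j h => stabGL A i j h)
    ⟨i, g⟩ j h).symm

theorem StGL.exists_eq_toStGL (z : StGL A) : ∃ (m : ℕ) (x : QM m A), z = QM.toStGL m A x := by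
  obtain ⟨m, g, rfl⟩ := StGL.mk_surj z
  obtain ⟨x, rfl⟩ := QM.toGLm_surjective m A g
  exact ⟨m, x, rfl⟩

theorem StGL.exists_eq_toStGL₂ (z : StGL A) (w : StGL B) :
    ∃ (m : ℕ) (x : QM m A) (y : QM m B), z = QM.toStGL m A x ∧ w = QM.toStGL m B y := by
  obtain ⟨i, g, rfl⟩ := StGL.mk_surj z
  obtain ⟨j, h, rfl⟩ := StGL.mk_surj w
  obtain ⟨x, hx⟩ := QM.toGLm_surjective _ A (stabGL A i _ (le_max_left i j) g)
  obtain ⟨y, hy⟩ := QM.toGLm_surjective _ B (stabGL B j _ (le_max_right i j) h)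
  refine ⟨max i j, x, y, ?_, ?_⟩
  · rw [← StGL.mk_stabGL (le_max_left i j), ← hx]; rfl
  · rw [← StGL.mk_stabGL (le_max_right i j), ← hy]; rfl

/-! ### Joint kernels -/

/-- `j` identifies `B` with the joint kernel of the homomorphisms `f i`. -/
structure IsJointKer {ι : Type*} (j : Hom B C) {D : ι → LCAlg.{u}} (f : ∀ i, Hom C (D i)) :
    Prop where
  inj : Function.Injective j
  -- Needed in order that a continuous or smooth path of `C` with values in the image of `j` be one
  -- of `B`.
  inducing : IsInducing j
  apply_eq_zero : ∀ i b, f i (j b) = 0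
  exists_eq : ∀ c, (∀ i, f i c = 0) → ∃ b, j b = c

section jointKer

variable {ι : Type*} {j : Hom B C} {D : ι → LCAlg.{u}} {f : ∀ i, Hom C (D i)}

theorem IsJointKer.qm_exists_eq (h : IsJointKer j f) (x : QM m C)
    (hx : ∀ i, QM.map m (f i).toRing x = 1) : ∃ y : QM m B, QM.map m j.toRing y = x := by
  have hx' : ∀ i, QM.map m (f i).toRing x⁻¹ = 1 := fun i => by rw [map_inv, hx, inv_one]
  choose v hv using fun a b => h.exists_eq (x.val a b) fun i => QM.val_congr (hx i) a b
  choose w hw using fun a b => h.exists_eq (x.inv a b) fun i => QM.val_congr (hx' i) a b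
  exact QUnit.exists_lift (matMap_injective h.inj) x ⟨Matrix.of v, Matrix.ext hv⟩
    ⟨Matrix.of w, Matrix.ext hw⟩

/-- Left exactness of `GL`: if a matrix becomes trivial under every `f i`, then so does its inverse,
and the entries of both quasi-units lie in `B`. -/
theorem IsJointKer.mem_iInf_ker_iff (h : IsJointKer j f) (z : StGL C) :
    z ∈ ⨅ i, (StGL.map (f i)).ker ↔ ∃ w, StGL.map j w = z := by
  rw [Subgroup.mem_iInf]
  constructor
  · intro hz
    obtain ⟨m, x, rfl⟩ := StGL.exists_eq_toStGL z
    obtain ⟨y, rfl⟩ := h.qm_exists_eq x fun i => QM.toStGL_injective m _ (by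
      rw [← QM.map_toStGL, map_one]; exact hz i)
    exact ⟨QM.toStGL m B y, QM.map_toStGL j y⟩
  · rintro ⟨w, rfl⟩ i
    change StGL.map (f i) (StGL.map j w) = 1
    rw [StGL.map_map]
    exact StGL.map_eq_one (h.apply_eq_zero i) w

end jointKer

theorem StGL.map_injective {j : Hom B C} (hj : Function.Injective j) :
    Function.Injective (StGL.map j) := by
  intro z w h
  obtain ⟨m, x, y, rfl, rfl⟩ := StGL.exists_eq_toStGL₂ z w
  rw [QM.map_toStGL, QM.map_toStGL] at h
  rw [QM.map_injective (f := j.toRing) hj (QM.toStGL_injective m C h)]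

/-- The path functor `P` preserves joint kernels. -/
def PathFunctor.PreservesJointKer (P : PathFunctor.{u}) : Prop :=
  ∀ {n : ℕ} {B C : LCAlg.{u}} {j : Hom B C} {D : Fin n → LCAlg.{u}} {f : ∀ i, Hom C (D i)},
    IsJointKer j f → IsJointKer (P.coneMap j) fun i => P.coneMap (f i)

/-- A path killed by all `f i` is lifted pointwise through `j`; the lift is continuous because `j`
is inducing. -/
theorem cont_preservesJointKer : PathFunctor.cont.{u}.PreservesJointKer := by
  intro n B C j D f h
  refine ⟨fun x y hxy => cone_ext fun t => h.inj (congrArg (fun z => conePath z t) hxy), ?_,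
    fun i b => cone_ext fun t => h.apply_eq_zero i (conePath b t), fun c hc => ?_⟩
  · have h1 : IsInducing (conePath (A := C) ∘ PathFunctor.cont.coneMap j) :=
      (ContinuousMap.isInducing_postcomp j.toCMap h.inducing).comp IsInducing.subtypeVal
    exact h1.of_comp (PathFunctor.cont.coneMap j).continuous continuous_conePath
  · choose b hb using fun t => h.exists_eq (conePath c t) fun i =>
      congrArg (fun z => conePath z t) (hc i)
    have hb' : Continuous b := h.inducing.continuous_iff.2 (by
      have : j ∘ b = conePath c := funext hb
      rw [this]
      exact (conePath c).continuous)
    exact ⟨mkCone ⟨b, hb'⟩ (h.inj ((hb 0).trans ((conePath_zero c).trans (map_zero j).symm))),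
      cone_ext hb⟩

theorem continuous_coneSeq (n : ℕ) :
    Continuous fun x : PathFunctor.smooth.cone A => (coneSeq x).1 n := by
  have h : Continuous fun F : smoothMaps A => F.1 n :=
    (continuous_apply n).comp continuous_subtype_val
  exact h.comp (PathFunctor.smooth.incl A).continuous

/-- All derivatives of a path killed by the `f i` are killed too, so each of them lifts pointwise.
Convergence of the difference quotients of the lifts is tested after applying the inducing map `j`.
-/
theorem smooth_preservesJointKer : PathFunctor.smooth.{u}.PreservesJointKer := by
  intro n B C j D f h
  refine ⟨fun x y hxy => smoothCone_ext fun t => h.inj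
    (congrArg (fun z => (coneSeq z).1 0 t) hxy), ?_,
    fun i b => smoothCone_ext fun t => h.apply_eq_zero i ((coneSeq b).1 0 t), fun c hc => ?_⟩
  · have hv : IsInducing fun x : PathFunctor.smooth.cone B => (coneSeq x).1 :=
      (IsInducing.subtypeVal (t := (smoothMaps B : Set (ℕ → C(unitInterval, B))))).comp
        IsInducing.subtypeVal
    have h1 : IsInducing fun x : PathFunctor.smooth.cone B =>
        (coneSeq (PathFunctor.smooth.coneMap j x)).1 :=
      (IsInducing.piMap fun _ : ℕ =>
        ContinuousMap.isInducing_postcomp j.toCMap h.inducing).comp hv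
    exact IsInducing.of_comp (g := fun x : PathFunctor.smooth.cone C => (coneSeq x).1)
      (PathFunctor.smooth.coneMap j).continuous (continuous_pi continuous_coneSeq) h1
  · choose b hb using fun k t => h.exists_eq ((coneSeq c).1 k t) fun i =>
      congrArg (fun z => (coneSeq z).1 k t) (hc i)
    have hb' : ∀ k, Continuous (b k) := fun k => h.inducing.continuous_iff.2 (by
      have : j ∘ b k = (coneSeq c).1 k := funext (hb k)
      rw [this]
      exact ((coneSeq c).1 k).continuous)
    let F : smoothMaps B := ⟨fun k => ⟨b k, hb' k⟩, fun k t => by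
      rw [h.inducing.tendsto_nhds_iff]
      have := (coneSeq c).2 k t
      rw [← hb (k + 1) t] at this
      refine this.congr fun s => ?_
      rw [← hb k s, ← hb k t, ← map_sub, ← map_smul]
      rfl⟩
    exact ⟨mkSmoothCone F (h.inj ((hb 0 0).trans ((coneSeq_zero c).trans (map_zero j).symm))),
      smoothCone_ext (hb 0)⟩

/-! ### Iterated loops as joint kernels of faces -/

/-- The inclusion of the iterated loops into the iterated paths. -/
def omegaIncl (P : PathFunctor.{u}) (A : LCAlg.{u}) : ∀ n, Hom (omega P A n) (P.iter A n)
  | 0 => { NonUnitalAlgHom.id ℂ A with cont := continuous_id }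
  | n + 1 => (P.coneMap (omegaIncl P A n)).comp (P.loopIncl (omega P A n))

section moore

variable {P : PathFunctor.{u}}

/-- By hypothesis the faces other than `δ_0` cut out the cone of the `n`-fold loops. On it `δ_0` is
the endpoint map followed by an injection, so the last condition cuts out the loops. -/
theorem isJointKer_omegaIncl_succ {n : ℕ} (hn : Function.Injective (omegaIncl P A n))
    (h : IsJointKer (P.coneMap (omegaIncl P A n)) fun i : Fin n => P.face A n i.succ) :
    IsJointKer (omegaIncl P A (n + 1)) fun i : Fin (n + 1) => P.face A n i := by
  have hτ : ∀ y : P.cone (omega P A n), P.face A n 0 (P.coneMap (omegaIncl P A n) y) =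
      omegaIncl P A n (P.tau _ y) := fun y => by
    rw [P.face_zero]; exact P.tau_coneMap (omegaIncl P A n) y
  refine ⟨h.inj.comp (kerIncl_injective _), h.inducing.comp IsInducing.subtypeVal,
    fun i b => ?_, fun c hc => ?_⟩
  · refine Fin.cases ?_ (fun i => ?_) i
    · exact (hτ (P.loopIncl _ b)).trans
        ((congrArg _ (apply_kerIncl (P.tau _) b)).trans (map_zero _))
    · exact h.apply_eq_zero i (P.loopIncl _ b)
  · obtain ⟨b, rfl⟩ := h.exists_eq c fun i => hc i.succ
    refine ⟨kerMk (P.tau _) b (hn ?_), rfl⟩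
    rw [map_zero, ← hτ b]
    exact hc 0

/-- The faces `δ_(i + 1)` in one degree are `P` applied to the faces `δ_i` in the degree below, so
preservation of joint kernels carries the induction. It starts from an empty family of faces. -/
theorem isJointKer_coneMap_omegaIncl (hP : P.PreservesJointKer) (A : LCAlg.{u}) (n : ℕ) :
    Function.Injective (omegaIncl P A n) ∧
      IsJointKer (P.coneMap (omegaIncl P A n)) fun i : Fin n => P.face A n i.succ := by
  induction n with
  | zero =>
    have h : IsJointKer (omegaIncl P A 0) (D := fun _ : Fin 0 => A) (fun i => i.elim0) :=
      ⟨Function.injective_id, IsInducing.id, fun i => i.elim0, fun c _ => ⟨c, rfl⟩⟩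
    have h' := hP h
    exact ⟨h.inj, h'.inj, h'.inducing, fun i => i.elim0, fun c _ => h'.exists_eq c
      fun i => i.elim0⟩
  | succ n ih =>
    have h := isJointKer_omegaIncl_succ ih.1 ih.2
    exact ⟨h.inj, hP h⟩

theorem mem_cycles_iff (hP : P.PreservesJointKer) {n : ℕ} (z : StGL (P.iter A n)) :
    z ∈ P.cycles A n ↔ ∃ w, StGL.map (omegaIncl P A n) w = z := by
  cases n with
  | zero => exact ⟨fun _ => ⟨z, by
      obtain ⟨m, x, rfl⟩ := StGL.exists_eq_toStGL (A := A) z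
      exact QM.map_toStGL (omegaIncl P A 0) x⟩, fun _ => trivial⟩
  | succ n =>
    have h := isJointKer_coneMap_omegaIncl hP A n
    exact (isJointKer_omegaIncl_succ h.1 h.2).mem_iInf_ker_iff z

/-- The Moore group is `GL` of the cone of the `n`-fold loops, and its differential `δ_0` becomes
the endpoint map. -/
theorem mem_boundaries_iff (hP : P.PreservesJointKer) {n : ℕ} (z : StGL (P.iter A n)) :
    z ∈ P.boundaries A n ↔
      ∃ w, StGL.map (omegaIncl P A n) (StGL.map (P.tau (omega P A n)) w) = z := by
  have h := (isJointKer_coneMap_omegaIncl hP A n).2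
  have hτ : ∀ w : StGL (P.cone (omega P A n)), StGL.map (P.face A n 0)
      (StGL.map (P.coneMap (omegaIncl P A n)) w) =
        StGL.map (omegaIncl P A n) (StGL.map (P.tau (omega P A n)) w) := fun w => by
    rw [P.face_zero, StGL.map_map]
    exact (StGL.map_map (P.tau _) (P.coneMap (omegaIncl P A n)) w).trans
      (StGL.map_congr (P.tau_coneMap (omegaIncl P A n)) w)
  constructor
  · rintro ⟨x, hx, rfl⟩
    obtain ⟨w, rfl⟩ := (h.mem_iInf_ker_iff x).1 hx
    exact ⟨w, (hτ w).symm⟩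
  · rintro ⟨w, rfl⟩
    exact ⟨_, (h.mem_iInf_ker_iff _).2 ⟨w, rfl⟩, hτ w⟩

end moore

/-! ### Comparison of the homotopy groups -/

theorem cmp_omegaIncl (A : LCAlg.{u}) (n : ℕ) (x : omega PathFunctor.smooth A n) :
    cmp A n (omegaIncl PathFunctor.smooth A n x) =
      omegaIncl PathFunctor.cont A n (omegaCmp A n x) := by
  induction n with
  | zero => rfl
  | succ n ih => exact cone_ext fun t => ih ((loopSeq x).1 0 t)

theorem map_cmp_omegaIncl (A : LCAlg.{u}) (n : ℕ) (w : StGL (omega PathFunctor.smooth A n)) :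
    StGL.map (cmp A n) (StGL.map (omegaIncl PathFunctor.smooth A n) w) =
      StGL.map (omegaIncl PathFunctor.cont A n) (StGL.map (omegaCmp A n) w) := by
  rw [StGL.map_map, StGL.map_map]
  exact StGL.map_congr (cmp_omegaIncl A n) w

theorem homotopyCmp_injective {p : ℕ → Seminorm ℂ A} (hp : FMWith A p) (n : ℕ) :
    Function.Injective (homotopyCmp A n) := by
  rw [injective_iff_map_eq_one]
  intro q hq
  obtain ⟨⟨z, hz⟩, rfl⟩ := QuotientGroup.mk_surjective q
  have hb : StGL.map (cmp A n) z ∈ PathFunctor.cont.boundaries A n :=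
    (QuotientGroup.eq_one_iff (N := (PathFunctor.cont.boundaries A n).subgroupOf
      (PathFunctor.cont.cycles A n)) _).1 hq
  refine (QuotientGroup.eq_one_iff (N := (PathFunctor.smooth.boundaries A n).subgroupOf
    (PathFunctor.smooth.cycles A n)) _).2 ?_
  change z ∈ PathFunctor.smooth.boundaries A n
  obtain ⟨w, rfl⟩ := (mem_cycles_iff smooth_preservesJointKer z).1 hz
  obtain ⟨v, hv⟩ := (mem_boundaries_iff cont_preservesJointKer _).1 hb
  rw [map_cmp_omegaIncl] at hv
  have hv' := StGL.map_injective (isJointKer_coneMap_omegaIncl cont_preservesJointKer A n).1 hv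
  obtain ⟨m, x, F, rfl, rfl⟩ := StGL.exists_eq_toStGL₂ w v
  rw [QM.map_toStGL, QM.map_toStGL] at hv'
  -- The comparison of loops gives a null-homotopy over the iterated smooth loops that is still only
  -- continuous; `exists_smooth_lift` for that algebra makes it smooth.
  obtain ⟨G, hG⟩ := (kBijLoops_omegaCmp hp n 0 m).2 x ⟨F, QM.toStGL_injective m _ hv'⟩
  obtain ⟨r, hr⟩ := hp.omega_smooth n
  obtain ⟨γ, hγ⟩ := exists_smooth_lift hr G
  refine (mem_boundaries_iff smooth_preservesJointKer _).2 ⟨QM.toStGL m _ γ, ?_⟩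
  rw [QM.map_toStGL, hγ, hG]

theorem homotopyCmp_surjective {p : ℕ → Seminorm ℂ A} (hp : FMWith A p) (n : ℕ) :
    Function.Surjective (homotopyCmp A n) := by
  intro q
  obtain ⟨⟨z, hz⟩, rfl⟩ := QuotientGroup.mk_surjective q
  obtain ⟨w, rfl⟩ := (mem_cycles_iff cont_preservesJointKer z).1 hz
  obtain ⟨m, y, rfl⟩ := StGL.exists_eq_toStGL w
  -- The matrix `y` of iterated continuous loops equals one of iterated smooth loops up to the
  -- endpoint of the continuous path `F`, which is a boundary.
  obtain ⟨x, F, hF⟩ := (kBijLoops_omegaCmp hp n 0 m).1 y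
  refine ⟨QuotientGroup.mk ⟨StGL.map (omegaIncl PathFunctor.smooth A n) (QM.toStGL m _ x),
    (mem_cycles_iff smooth_preservesJointKer _).2 ⟨_, rfl⟩⟩, ?_⟩
  refine (QuotientGroup.eq (s := (PathFunctor.cont.boundaries A n).subgroupOf
    (PathFunctor.cont.cycles A n))).2 ?_
  change (StGL.map (cmp A n) (StGL.map (omegaIncl PathFunctor.smooth A n) (QM.toStGL m _ x)))⁻¹ *
    StGL.map (omegaIncl PathFunctor.cont A n) (QM.toStGL m _ y) ∈ PathFunctor.cont.boundaries A n
  refine (mem_boundaries_iff cont_preservesJointKer _).2 ⟨QM.toStGL m _ F, ?_⟩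
  rw [map_cmp_omegaIncl, QM.map_toStGL, hF, map_mul, map_mul, map_inv, map_inv,
    QM.map_toStGL (omegaCmp A n)]

end LCAlg

end

end SmoothK

theorem theorem1p14 (A : SmoothK.LCAlg.{u}) (hA : A.IsFrechetMichael) (n : ℕ) :
    Function.Bijective (SmoothK.LCAlg.beta A n) := by
  obtain ⟨p, hp⟩ := hA.exists_fmWith
  cases n with
  | zero => exact Function.bijective_id
  | succ n =>
    exact ⟨SmoothK.LCAlg.homotopyCmp_injective hp n, SmoothK.LCAlg.homotopyCmp_surjective hp n⟩
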